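/- Let $N\ge 1$ be odd, let $\sigma_j^\alpha$ ($1\le j\le N$, $\alpha=x,y,z$) be the Pauli operators on $(\mathbb C^2)^{\otimes N}$, $\sigma^\alpha_{j+N}=\sigma^\alpha_j$, and let $$H=\sum_{j=1}^N\big(\cos\phi\,\sigma_j^x\sigma_{j+1}^x+\sin\phi\,\sigma_j^y\sigma_{j+1}^y\big),\qquad \Pi^\alpha=\bigotimes_{j=1}^N\sigma_j^\alpha .$$ Put $c_j=\big(\bigotimes_{l<j}\sigma_l^z\big)\otimes\sigma_j^+$ with $\sigma_j^+=(\sigma_j^x+i\sigma_j^y)/2$, and $b_q=N^{-1/2}\sum_{j=1}^N c_j e^{-iqj}$. Put $\Gamma^-=\{2\pi k/N\}$ and $\Gamma^+=\{2\pi(k+\tfrac12)/N\}$, $0\le k\le N-1$, where momenta are understood modulo $2\pi$. Let $a_q=b_q$ for $q\in\{0,\pi\}$, and otherwise $a_q=\cos\theta_q\, b_q+i\sin\theta_q\, b_{-q}^\dagger$ with $$\theta_q=\arctan\frac{|\sin\phi+\cos\phi\, e^{2iq}|-(\sin\phi+\cos\phi)\cos q}{(\cos\phi-\sin\phi)\sin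 q}.$$ Let $|0^\pm\rangle=\prod_{q\in\Gamma^\pm,\,0<q<\pi}\big(\cos\theta_q-i\sin\theta_q\, b_q^\dagger b_{-q}^\dagger\big)|{\uparrow\cdots\uparrow}\rangle$. Let $\varepsilon(0)=-\varepsilon(\pi)=2(\cos\phi+\sin\phi)$ and $\varepsilon(q)=2|\cos\phi\, e^{2iq}+\sin\phi|$ for $q\ne 0,\pi$. The ground space of $H$ is the eigenspace of its least eigenvalue. 1. Let $\phi\in(-\pi/4,0)$. Then $q=0$ is the unique minimizer of $\varepsilon$ on $\Gamma^-$, and $q=\pi$ is the unique minimizer of the excitation energy $|\varepsilon|$ on $\Gamma^+$. The ground space is two-dimensional, spanned by $a_0^\dagger|0^-\rangle$, with $\Pi^z=-1$, and $\Pi^x a_0^\dagger|0^-\rangle$, with $\Pi^z=+1$. Moreover $\Pi^x a_0^\dagger|0^-\rangle=|0^+\rangle$ up to a phase factor. 2. Let $\phi\in(0,\pi/4)$ and $N\ge 3$. Put $p=\frac{\pi}{2}\big(1-\frac1N\big)$ if $N\bmod 4=1$, $p=\frac{\pi}{2}\big(1+\frac1N\big)$ if $N\bmod 4=3$, and $p'=\pi-p$.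 Then $\pm p\in\Gamma^-$ are exactly the minimizers of $\varepsilon$ on $\Gamma^-$, and $\pm p'\in\Gamma^+$ are exactly the minimizers of the excitation energy $|\varepsilon|$ on $\Gamma^+$. The ground space is four-dimensional, spanned by $a_p^\dagger|0^-\rangle$ and $a_{-p}^\dagger|0^-\rangle$, with $\Pi^z=-1$, and their images under $\Pi^x$, with $\Pi^z=+1$. Moreover $\Pi^x a_{\mp p}^\dagger|0^-\rangle=a_{\pm p'}^\dagger a_\pi^\dagger|0^+\rangle$ up to a phase factor. -/

import Mathlib

open Matrix

noncomputable section

namespace XYChain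

/-- Spin configurations of `N` spins; at each site `0` is spin up and `1` is spin down. -/
abbrev Config (N : ℕ) := Fin N → Fin 2

/-- State vectors of the `2 ^ N`-dimensional Hilbert space of the chain. -/
abbrev State (N : ℕ) := Config N → ℂ

/-- Operators on the Hilbert space; the adjoint is the conjugate transpose. -/
abbrev Op (N : ℕ) := Matrix (Config N) (Config N) ℂ

/-- The Pauli matrix `σˣ`. -/
def pauliX : Matrix (Fin 2) (Fin 2) ℂ := !![0, 1; 1, 0]

/-- The Pauli matrix `σʸ`. -/
def pauliY : Matrix (Fin 2) (Fin 2) ℂ := !![0, -Complex.I; Complex.I, 0]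

/-- The Pauli matrix `σᶻ`. -/
def pauliZ : Matrix (Fin 2) (Fin 2) ℂ := !![1, 0; 0, -1]

/-- The spin raising matrix `σ⁺ = (σˣ + i σʸ) / 2`. -/
def pauliPlus : Matrix (Fin 2) (Fin 2) ℂ := (1 / 2 : ℂ) • (pauliX + Complex.I • pauliY)

/-- The tensor product `A 0 ⊗ A 1 ⊗ ⋯ ⊗ A (N - 1)` of single-site matrices. -/
def tensorOp {N : ℕ} (A : Fin N → Matrix (Fin 2) (Fin 2) ℂ) : Op N :=
  Matrix.of fun s t => ∏ k, A k (s k) (t k)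

/-- The single-site matrix `A` acting on site `j`, tensored with the identity elsewhere. -/
def siteOp {N : ℕ} (j : Fin N) (A : Matrix (Fin 2) (Fin 2) ℂ) : Op N :=
  tensorOp fun k => if k = j then A else 1

/-- `H = ∑ⱼ (cos φ σˣⱼ σˣⱼ₊₁ + sin φ σʸⱼ σʸⱼ₊₁)` with periodic boundary conditions
(the addition `j + 1` in `Fin N` is modulo `N`). -/
def hamiltonian (N : ℕ) [NeZero N] (φ : ℝ) : Op N :=
  ∑ j : Fin N, ((Real.cos φ : ℂ) • (siteOp j pauliX * siteOp (j + 1) pauliX)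
    + (Real.sin φ : ℂ) • (siteOp j pauliY * siteOp (j + 1) pauliY))

/-- The parity operator `Πˣ = ⊗ⱼ σˣ`. -/
def parityX (N : ℕ) : Op N := tensorOp fun _ => pauliX

/-- The parity operator `Πᶻ = ⊗ⱼ σᶻ`. -/
def parityZ (N : ℕ) : Op N := tensorOp fun _ => pauliZ

/-- The Jordan-Wigner annihilation operator `cⱼ = (⊗_{l < j} σᶻ) ⊗ σ⁺ⱼ`. -/
def fermiC {N : ℕ} (j : Fin N) : Op N :=
  tensorOp fun l => if l < j then pauliZ else if l = j then pauliPlus else 1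

/-- The Fourier transform `b_q = N ^ (-1/2) ∑ⱼ cⱼ exp (-i q j)`. The sites carry the labels
`1, …, N`, so that the element `j` of `Fin N` is the site with label `j + 1`. -/
def fermiB (N : ℕ) (q : ℝ) : Op N :=
  ((1 / Real.sqrt N : ℝ) : ℂ) •
    ∑ j : Fin N, Complex.exp (-Complex.I * (q : ℂ) * ((j : ℕ) + 1 : ℂ)) • fermiC j

/-- The Bogoliubov angle `θ_q`, for `q` not a multiple of `π`. -/
def bogAngle (φ q : ℝ) : ℝ :=
  Real.arctan
    ((‖(Real.sin φ : ℂ) + (Real.cos φ : ℂ) * Complex.exp (Complex.I * 2 * (q : ℂ))‖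
        - (Real.sin φ + Real.cos φ) * Real.cos q)
      / ((Real.cos φ - Real.sin φ) * Real.sin q))

/-- The Bogoliubov annihilation operator: `a_q = b_q` for `q = 0, π`, and
`a_q = cos θ_q b_q + i sin θ_q b_{-q}†` otherwise. -/
def bogA (N : ℕ) (φ q : ℝ) : Op N :=
  if q = 0 ∨ q = Real.pi then fermiB N q
  else (Real.cos (bogAngle φ q) : ℂ) • fermiB N q
    + (Complex.I * (Real.sin (bogAngle φ q) : ℂ)) • (fermiB N (-q))ᴴ

/-- The momentum `2 π k / N` of the odd sector. -/
def momMinus (N k : ℕ) : ℝ := 2 * Real.pi * k / N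

/-- The momentum `2 π (k + 1/2) / N` of the even sector. -/
def momPlus (N k : ℕ) : ℝ := 2 * Real.pi * (k + 1 / 2) / N

/-- The momenta `Γ⁻` of the odd sector, represented in `[0, 2π)`. -/
def GammaMinus (N : ℕ) : Set ℝ := {q | ∃ k < N, q = momMinus N k}

/-- The momenta `Γ⁺` of the even sector, represented in `[0, 2π)`. -/
def GammaPlus (N : ℕ) : Set ℝ := {q | ∃ k < N, q = momPlus N k}

/-- The dispersion relation: `ε(0) = -ε(π) = 2 (cos φ + sin φ)`, and
`ε(q) = 2 |cos φ exp (2 i q) + sin φ|` otherwise. -/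
def dispersion (φ q : ℝ) : ℝ :=
  if q = 0 then 2 * (Real.cos φ + Real.sin φ)
  else if q = Real.pi then -(2 * (Real.cos φ + Real.sin φ))
  else 2 * ‖(Real.cos φ : ℂ) * Complex.exp (Complex.I * 2 * (q : ℂ)) + (Real.sin φ : ℂ)‖

/-- The Jordan-Wigner vacuum, in which all spins are up. -/
def allUp (N : ℕ) : State N := Pi.single (fun _ => 0) 1

/-- The operator `cos θ_q - i sin θ_q b_q† b_{-q}†` if `0 < q < π`, and the identity otherwise. -/
def pairFactor (N : ℕ) (φ q : ℝ) : Op N :=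
  if 0 < q ∧ q < Real.pi then
    (Real.cos (bogAngle φ q) : ℂ) • (1 : Op N)
      - (Complex.I * (Real.sin (bogAngle φ q) : ℂ)) • ((fermiB N q)ᴴ * (fermiB N (-q))ᴴ)
  else 1

/-- The vacuum `|0⁻⟩`: the product of the pair factors over `q ∈ Γ⁻`, `0 < q < π`,
applied to the Jordan-Wigner vacuum. -/
def vacMinus (N : ℕ) (φ : ℝ) : State N :=
  ((List.range N).map fun k => pairFactor N φ (momMinus N k)).prod *ᵥ allUp N

/-- The vacuum `|0⁺⟩`: the product of the pair factors over `q ∈ Γ⁺`, `0 < q < π`,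
applied to the Jordan-Wigner vacuum. -/
def vacPlus (N : ℕ) (φ : ℝ) : State N :=
  ((List.range N).map fun k => pairFactor N φ (momPlus N k)).prod *ᵥ allUp N

/-- The state `a_q† |0⁻⟩`. -/
def oneParticle (N : ℕ) (φ q : ℝ) : State N := (bogA N φ q)ᴴ *ᵥ vacMinus N φ

/-- The state `a_q† a_π† |0⁺⟩`. -/
def twoParticle (N : ℕ) (φ q : ℝ) : State N :=
  (bogA N φ q)ᴴ *ᵥ ((bogA N φ Real.pi)ᴴ *ᵥ vacPlus N φ)

/-- `V` is the ground space of `A`: the eigenspace of the least real eigenvalue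
(which, for the Hermitian operators considered here, is the least eigenvalue). -/
def IsGroundSpace {N : ℕ} (A : Op N) (V : Submodule ℂ (State N)) : Prop :=
  ∃ E : ℝ, IsLeast {x : ℝ | Module.End.HasEigenvalue (Matrix.toLin' A) (x : ℂ)} E ∧
    V = Module.End.eigenspace (Matrix.toLin' A) (E : ℂ)

/-- The momentum `p`, for odd `N`: `π/2 (1 - 1/N)` if `N mod 4 = 1` and `π/2 (1 + 1/N)` if
`N mod 4 = 3`. -/
def groundMomentum (N : ℕ) : ℝ :=
  if N % 4 = 1 then Real.pi / 2 * (1 - 1 / N) else Real.pi / 2 * (1 + 1 / N)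

end XYChain

end

open XYChain

/-! On the sector where Πᶻ = -1 the Jordan-Wigner transformation turns `H` into a quadratic fermion
operator with periodic boundary conditions. A Fourier transform over Γ⁻ and a Bogoliubov rotation of
each pair (q, -q) bring it to the form ∑ ε(q) (a_q† a_q - 1/2), see
`fermiHamiltonian_eq_freeEnergy`. Since N is odd, π is not in Γ⁻, so every ε(q) that occurs is
positive. The vacuum |0⁻⟩ is, up to a scalar, the only vector killed by all a_q, but it has Πᶻ = +1
and is excluded. The lowest odd states are therefore exactly the one-particle states of least ε
(`IsCAR.eigenvector_freeEnergy`, `odd_eigenvector`).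

The even sector is never diagonalised. For odd N the operator Πˣ commutes with `H` and anticommutes
with Πᶻ, so it carries each sector onto the other and every level is doubled (`isGroundSpace_span`).
Dimensions follow from orthonormality.

The even vacuum |0⁺⟩ only enters when Πˣ-images are identified. Conjugation by Πˣ maps b_q to
-b_{π-q}†, and θ_{q-π} = θ_q - π/2 for 0 < q < π, so it maps a_q to a phase times a_{q-π} there. For
odd N a shift by π exchanges Γ⁻ and Γ⁺. Hence Πˣ|0⁺⟩ is killed by a_q for all nonzero q in Γ⁻ and by
a_0†, which leaves only multiples of a_0†|0⁻⟩ (`exists_parityX_mulVec_vacuum`). The two-particle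
states follow by conjugating their creation operators.

The minimizers come from (ε(q)/2)² = 1 + sin 2φ cos 2q (`norm_sq_symbol`): for φ < 0 the largest
value of cos 2q is wanted, attained at 0 or π; for φ > 0 the smallest, attained at the momenta
nearest to ±π/2, which are found by arithmetic modulo 4. -/

noncomputable section

namespace XYChain

/-! ### Canonical anticommutation relations and Bogoliubov transforms -/

section CAR

variable {m ι κ : Type*} [Fintype m] [DecidableEq m] [DecidableEq ι] [DecidableEq κ]

/-- The canonical anticommutation relations for a family of annihilation operators. -/
def IsCAR (b : ι → Matrix m m ℂ) : Prop :=
  (∀ k l, b k * b l + b l * b k = 0) ∧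
    ∀ k l, b k * (b l)ᴴ + (b l)ᴴ * b k = if k = l then 1 else 0

namespace IsCAR

variable {b : ι → Matrix m m ℂ}

theorem mul_eq_neg (hb : IsCAR b) (k l : ι) : b k * b l = -(b l * b k) :=
  eq_neg_of_add_eq_zero_left (hb.1 k l)

theorem adj_mul_adj_eq_neg (hb : IsCAR b) (k l : ι) :
    (b k)ᴴ * (b l)ᴴ = -((b l)ᴴ * (b k)ᴴ) := by
  have h := congrArg conjTranspose (hb.mul_eq_neg l k)
  simpa using h

theorem adj_mul_adj_self (hb : IsCAR b) (k : ι) : (b k)ᴴ * (b k)ᴴ = 0 := by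
  ext i j
  exact self_eq_neg.mp (congrFun₂ (hb.adj_mul_adj_eq_neg k k) i j)

theorem mul_adj_of_ne (hb : IsCAR b) {k l : ι} (h : k ≠ l) :
    b k * (b l)ᴴ = -((b l)ᴴ * b k) := by
  have := hb.2 k l
  rw [if_neg h] at this
  exact eq_neg_of_add_eq_zero_left this

theorem mul_adj_self (hb : IsCAR b) (k : ι) : b k * (b k)ᴴ = 1 - (b k)ᴴ * b k := by
  have := hb.2 k k
  rw [if_pos rfl] at this
  exact eq_sub_of_add_eq this

/-- Applied below to the Fourier matrix: orthonormality of the rows of `U` is all that the mixed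
relation needs. -/
theorem linearCombination [Fintype ι] (hb : IsCAR b) (U : κ → ι → ℂ)
    (hU : ∀ k l, ∑ j, U k j * star (U l j) = if k = l then 1 else 0) :
    IsCAR fun k => ∑ j, U k j • b j := by
  constructor
  · intro k l
    simp only [Finset.sum_mul_sum, smul_mul_smul_comm]
    rw [Finset.sum_comm, ← Finset.sum_add_distrib]
    refine Finset.sum_eq_zero fun j _ => ?_
    rw [← Finset.sum_add_distrib]
    refine Finset.sum_eq_zero fun i _ => ?_
    rw [mul_comm (U l j), ← smul_add, hb.1, smul_zero]
  · intro k l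
    have h : ∀ j i, (U k j * star (U l i)) • (b j * (b i)ᴴ)
        + (star (U l i) * U k j) • ((b i)ᴴ * b j)
        = if j = i then (U k j * star (U l j)) • (1 : Matrix m m ℂ) else 0 := by
      intro j i
      rw [mul_comm (star (U l i)), ← smul_add, hb.2]
      split_ifs with h
      · rw [h]
      · rw [smul_zero]
    simp only [conjTranspose_sum, conjTranspose_smul, Finset.sum_mul_sum, smul_mul_smul_comm]
    rw [Finset.sum_comm (f := fun i j => (star (U l i) * U k j) • ((b i)ᴴ * b j)),
      ← Finset.sum_add_distrib]
    simp only [← Finset.sum_add_distrib, h, Finset.sum_ite_eq, Finset.mem_univ, if_true]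
    rw [← Finset.sum_smul, hU]
    split_ifs <;> simp

end IsCAR

/-- The Bogoliubov transform of the modes `b` with angles `θ`, pairing the mode `k` with `τ k`. -/
def bogoliubov (b : ι → Matrix m m ℂ) (τ : ι → ι) (θ : ι → ℝ) (k : ι) : Matrix m m ℂ :=
  (Real.cos (θ k) : ℂ) • b k + (Complex.I * (Real.sin (θ k) : ℂ)) • (b (τ k))ᴴ

/-- The mixed relation is cos² + sin² = 1. In the relation between two annihilators the only
surviving terms occur at `l = τ k`, where sin(θ_k + θ_{τ k}) appears; it vanishes because θ is odd
under τ. -/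
theorem IsCAR.isCAR_bogoliubov {b : ι → Matrix m m ℂ} (hb : IsCAR b) {τ : ι → ι}
    (hτ : Function.Involutive τ) {θ : ι → ℝ} (hθ : ∀ k, θ (τ k) = -θ k) :
    IsCAR (bogoliubov b τ θ) := by
  have hadd : ∀ k l, (b (τ k))ᴴ * b l = (if l = τ k then 1 else 0) - b l * (b (τ k))ᴴ := by
    intro k l
    exact eq_sub_of_add_eq' (hb.2 l (τ k))
  constructor
  · intro k l
    simp only [bogoliubov, add_mul, mul_add, smul_mul_smul_comm]
    rw [hb.mul_eq_neg l k, hb.adj_mul_adj_eq_neg (τ l) (τ k), hadd k l, hadd l k]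
    by_cases h : l = τ k
    · have h' : k = τ l := by rw [h, hτ]
      rw [if_pos h, if_pos h']
      have : θ l = -θ k := by rw [h, hθ]
      rw [this, Real.cos_neg, Real.sin_neg]
      push_cast
      module
    · have h' : k ≠ τ l := fun h' => h (by rw [h', hτ])
      rw [if_neg h, if_neg h']
      module
  · intro k l
    have hs : star (Complex.I * ((Real.sin (θ l) : ℝ) : ℂ)) = -(Complex.I * (Real.sin (θ l) : ℂ)) := by
      rw [star_mul', Complex.star_def, Complex.conj_I, Complex.conj_ofReal, neg_mul]
    have hc : star ((Real.cos (θ l) : ℝ) : ℂ) = (Real.cos (θ l) : ℂ) := Complex.conj_ofReal _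
    have h1 : b k * (b l)ᴴ = (if k = l then 1 else 0) - (b l)ᴴ * b k :=
      eq_sub_of_add_eq (hb.2 k l)
    have h2 : (b (τ k))ᴴ * b (τ l) = (if k = l then 1 else 0) - b (τ l) * (b (τ k))ᴴ := by
      rw [hadd]
      simp only [hτ.injective.eq_iff, eq_comm]
    simp only [bogoliubov, conjTranspose_add, conjTranspose_smul,
      conjTranspose_conjTranspose, hs, hc, add_mul, mul_add, smul_mul_smul_comm]
    rw [h1, h2, hb.mul_eq_neg k (τ l), hb.adj_mul_adj_eq_neg (τ k) l]
    by_cases h : k = l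
    · subst h
      rw [if_pos rfl]
      have h3 : (Real.cos (θ k) : ℂ) * (Real.cos (θ k) : ℂ)
          + (Real.sin (θ k) : ℂ) * (Real.sin (θ k) : ℂ) = 1 := by
        norm_cast
        nlinarith [Real.sin_sq_add_cos_sq (θ k)]
      have h4 : Complex.I * (Real.sin (θ k) : ℂ) * -(Complex.I * (Real.sin (θ k) : ℂ))
          = (Real.sin (θ k) : ℂ) * (Real.sin (θ k) : ℂ) := by
        linear_combination (-(Real.sin (θ k) : ℂ) * (Real.sin (θ k) : ℂ)) * Complex.I_mul_I
      rw [mul_comm (-(Complex.I * (Real.sin (θ k) : ℂ))) (Complex.I * (Real.sin (θ k) : ℂ)), h4]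
      have h5 : (1 : Matrix m m ℂ) = ((Real.cos (θ k) : ℂ) * (Real.cos (θ k) : ℂ)
          + (Real.sin (θ k) : ℂ) * (Real.sin (θ k) : ℂ)) • 1 := by rw [h3, one_smul]
      conv_rhs => rw [h5]
      module
    · rw [if_neg h]
      module

end CAR

/-! ### Pair factors and how they intertwine the two sets of modes -/

section Pairs

variable {m ι : Type*} [Fintype m] [DecidableEq m]

/-- The operator `cos θ_k - i sin θ_k b_k† b_{τ k}†` if `P k`, and the identity otherwise. -/
def pairOp (b : ι → Matrix m m ℂ) (τ : ι → ι) (θ : ι → ℝ) (P : ι → Prop) [DecidablePred P]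
    (k : ι) : Matrix m m ℂ :=
  if P k then (Real.cos (θ k) : ℂ) • (1 : Matrix m m ℂ)
      - (Complex.I * (Real.sin (θ k) : ℂ)) • ((b k)ᴴ * (b (τ k))ᴴ)
  else 1

variable {b : ι → Matrix m m ℂ} {τ : ι → ι} {θ : ι → ℝ} {P : ι → Prop} [DecidablePred P]

/-- Passing a product of two creation operators costs two signs, which cancel. -/
theorem commute_pairOp {X : Matrix m m ℂ} {k : ι} (h1 : X * (b k)ᴴ = -((b k)ᴴ * X))
    (h2 : X * (b (τ k))ᴴ = -((b (τ k))ᴴ * X)) : Commute X (pairOp b τ θ P k) := by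
  have h : Commute X ((b k)ᴴ * (b (τ k))ᴴ) := by
    change _ = _
    rw [← mul_assoc, h1, neg_mul, mul_assoc, h2, mul_neg, neg_neg, mul_assoc]
  unfold pairOp
  split_ifs
  · exact ((Commute.one_right X).smul_right _).sub_right (h.smul_right _)
  · exact Commute.one_right X

variable [DecidableEq ι]

theorem IsCAR.commute_pairOp (hb : IsCAR b) {k l : ι} (h1 : l ≠ k) (h2 : l ≠ τ k) :
    Commute (b l) (pairOp b τ θ P k) :=
  XYChain.commute_pairOp (hb.mul_adj_of_ne h1) (hb.mul_adj_of_ne h2)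

theorem IsCAR.bogoliubov_commute_pairOp (hb : IsCAR b) {k l : ι} (h1 : l ≠ k) (h2 : l ≠ τ k) :
    Commute (bogoliubov b τ θ l) (pairOp b τ θ P k) := by
  refine ((hb.commute_pairOp h1 h2).smul_left _).add_left (Commute.smul_left ?_ _)
  exact XYChain.commute_pairOp (hb.adj_mul_adj_eq_neg _ _) (hb.adj_mul_adj_eq_neg _ _)

/-- Moving `b k` through the pair produces a stray (b_{τ k})†, and the second term of the Bogoliubov
mode produces the opposite one. Stated as an operator identity rather than on the vacuum, this
yields both the annihilation and the uniqueness of the new vacuum. -/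
theorem IsCAR.bogoliubov_mul_pairOp (hb : IsCAR b) {k : ι} (hP : P k) (hk : τ k ≠ k) :
    bogoliubov b τ θ k * pairOp b τ θ P k
      = (Real.cos (θ k) : ℂ) • (pairOp b τ θ P k * b k) := by
  have h1 : b k * ((b k)ᴴ * (b (τ k))ᴴ) = (b (τ k))ᴴ + (b k)ᴴ * (b (τ k))ᴴ * b k := by
    rw [← mul_assoc, hb.mul_adj_self, sub_mul, one_mul, mul_assoc, hb.mul_adj_of_ne hk.symm]
    rw [mul_neg, sub_neg_eq_add, mul_assoc]
  have h2 : (b (τ k))ᴴ * ((b k)ᴴ * (b (τ k))ᴴ) = 0 := by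
    rw [hb.adj_mul_adj_eq_neg k, mul_neg, ← mul_assoc, hb.adj_mul_adj_self, zero_mul, neg_zero]
  simp only [pairOp, if_pos hP, bogoliubov, add_mul, mul_sub, sub_mul, smul_mul_assoc,
    mul_smul_comm, one_mul, mul_one, h1, h2]
  module

theorem IsCAR.bogoliubov_partner_mul_pairOp (hb : IsCAR b) (hτ : Function.Involutive τ)
    (hθ : ∀ k, θ (τ k) = -θ k) {k : ι} (hP : P k) (hk : τ k ≠ k) :
    bogoliubov b τ θ (τ k) * pairOp b τ θ P k
      = (Real.cos (θ (τ k)) : ℂ) • (pairOp b τ θ P k * b (τ k)) := by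
  have h1 : b (τ k) * ((b k)ᴴ * (b (τ k))ᴴ) = -(b k)ᴴ + (b k)ᴴ * (b (τ k))ᴴ * b (τ k) := by
    rw [← mul_assoc, hb.mul_adj_of_ne hk, neg_mul, mul_assoc, hb.mul_adj_self, mul_sub, mul_one,
      mul_assoc]
    abel
  have h2 : (b k)ᴴ * ((b k)ᴴ * (b (τ k))ᴴ) = 0 := by
    rw [← mul_assoc, hb.adj_mul_adj_self, zero_mul]
  simp only [pairOp, if_pos hP, bogoliubov, add_mul, mul_sub, sub_mul, smul_mul_assoc,
    mul_smul_comm, one_mul, mul_one, h1, h2, hτ k, hθ, Real.cos_neg, Real.sin_neg]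
  push_cast
  module

/-- The pair operator squares to zero, so the factor is a nonzero scalar plus a nilpotent. -/
theorem IsCAR.isUnit_pairOp (hb : IsCAR b) (hcos : ∀ k, Real.cos (θ k) ≠ 0) (k : ι) :
    IsUnit (pairOp b τ θ P k) := by
  unfold pairOp
  split_ifs
  · have h0 : ((b k)ᴴ * (b (τ k))ᴴ) * ((b k)ᴴ * (b (τ k))ᴴ) = 0 := by
      rw [hb.adj_mul_adj_eq_neg k (τ k), neg_mul_neg, mul_assoc, ← mul_assoc _ _ ((b k)ᴴ),
        hb.adj_mul_adj_eq_neg k (τ k), neg_mul, mul_assoc, hb.adj_mul_adj_self]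
      simp
    have hn : IsNilpotent (-((Complex.I * (Real.sin (θ k) : ℂ)) • ((b k)ᴴ * (b (τ k))ᴴ))) :=
      ⟨2, by rw [sq, neg_mul_neg, smul_mul_smul_comm, h0, smul_zero]⟩
    rw [sub_eq_add_neg]
    have hu : IsUnit ((Real.cos (θ k) : ℂ) • (1 : Matrix m m ℂ)) := by
      rw [← Algebra.algebraMap_eq_smul_one]
      exact (IsUnit.mk0 _ (by exact_mod_cast hcos k)).map _
    refine hn.isUnit_add_left_of_commute hu ?_
    exact ((Commute.one_right _).smul_right _)
  · exact isUnit_one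

theorem IsCAR.commute_prod (hb : IsCAR b) {l : ι} {L : List ι}
    (h : ∀ k ∈ L, P k → l ≠ k ∧ l ≠ τ k) :
    Commute (b l) (L.map (pairOp b τ θ P)).prod ∧
      Commute (bogoliubov b τ θ l) (L.map (pairOp b τ θ P)).prod := by
  constructor <;>
  · refine Commute.list_prod_right _ _ fun x hx => ?_
    obtain ⟨k, hk, rfl⟩ := List.mem_map.mp hx
    by_cases hP : P k
    · first
        | exact hb.commute_pairOp (h k hk hP).1 (h k hk hP).2
        | exact hb.bogoliubov_commute_pairOp (h k hk hP).1 (h k hk hP).2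
    · rw [pairOp, if_neg hP]
      exact Commute.one_right _

/-- `P` selects at most one member of each pair, so a single factor involves the modes `k` and `τ
k`; all other factors commute past. -/
theorem IsCAR.bogoliubov_mul_prod_of_mem (hb : IsCAR b) (hτ : Function.Involutive τ)
    (hθ : ∀ k, θ (τ k) = -θ k) (hP : ∀ k, P k → τ k ≠ k ∧ ¬ P (τ k)) {L : List ι} (hL : L.Nodup) {k : ι} (hk : k ∈ L)
    (hPk : P k) {l : ι} (hl : l = k ∨ l = τ k) :
    bogoliubov b τ θ l * (L.map (pairOp b τ θ P)).prod
      = (Real.cos (θ l) : ℂ) • ((L.map (pairOp b τ θ P)).prod * b l) := by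
  obtain ⟨L₁, L₂, rfl⟩ := List.append_of_mem hk
  have hkk : ∀ i, P i → i ≠ k → l ≠ i ∧ l ≠ τ i := by
    intro i hi hik
    rcases hl with rfl | rfl
    · refine ⟨hik.symm, fun h => (hP i hi).2 (h ▸ hPk)⟩
    · refine ⟨fun h => (hP k hPk).2 (h ▸ hi), fun h => hik (hτ.injective h).symm⟩
  have hne : ∀ i ∈ L₁ ++ L₂, i ≠ k := by
    intro i hi hik
    have := (List.nodup_middle.mp hL)
    rw [List.nodup_cons] at this
    exact this.1 (hik ▸ hi)
  have h1 := (hb.commute_prod (θ := θ) (l := l) (L := L₁) fun i hi hPi =>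
    hkk i hPi (hne i (List.mem_append_left _ hi))).2
  have h2 := (hb.commute_prod (θ := θ) (l := l) (L := L₂) fun i hi hPi =>
    hkk i hPi (hne i (List.mem_append_right _ hi))).1
  have h3 : bogoliubov b τ θ l * pairOp b τ θ P k
      = (Real.cos (θ l) : ℂ) • (pairOp b τ θ P k * b l) := by
    rcases hl with rfl | rfl
    · exact hb.bogoliubov_mul_pairOp hPk (hP _ hPk).1
    · exact hb.bogoliubov_partner_mul_pairOp hτ hθ hPk (hP _ hPk).1
  rw [List.map_append, List.map_cons, List.prod_append, List.prod_cons, ← mul_assoc, h1.eq,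
    mul_assoc, ← mul_assoc (bogoliubov b τ θ l), h3, smul_mul_assoc, mul_smul_comm,
    mul_assoc (pairOp b τ θ P k), h2.eq]
  simp only [mul_assoc]

end Pairs

/-! ### The Bogoliubov vacuum: annihilation, uniqueness, norm -/

section Vacuum

variable {m ι : Type*} [Fintype m]

theorem star_mulVec_dotProduct (A : Matrix m m ℂ) (v w : m → ℂ) :
    star (A *ᵥ v) ⬝ᵥ w = star v ⬝ᵥ (Aᴴ *ᵥ w) := by
  rw [star_mulVec, dotProduct_mulVec]

theorem star_dotProduct_self_eq_ofReal (v : m → ℂ) :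
    star v ⬝ᵥ v = ((∑ i, Complex.normSq (v i) : ℝ) : ℂ) := by
  rw [dotProduct, Complex.ofReal_sum]
  exact Finset.sum_congr rfl fun i _ => (Complex.normSq_eq_conj_mul_self).symm

theorem sum_normSq_nonneg (v : m → ℂ) : 0 ≤ ∑ i, Complex.normSq (v i) :=
  Finset.sum_nonneg fun _ _ => Complex.normSq_nonneg _

theorem sum_normSq_eq_zero {v : m → ℂ} (h : ∑ i, Complex.normSq (v i) = 0) : v = 0 := by
  rw [Finset.sum_eq_zero_iff_of_nonneg fun i _ => Complex.normSq_nonneg _] at h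
  exact funext fun i => Complex.normSq_eq_zero.mp (h i (Finset.mem_univ i))

variable [DecidableEq m] [DecidableEq ι] {b : ι → Matrix m m ℂ} {τ : ι → ι} {θ : ι → ℝ} {P : ι → Prop}
  [DecidablePred P]

theorem IsCAR.bogoliubov_mul_prod (hb : IsCAR b) (hτ : Function.Involutive τ)
    (hθ : ∀ k, θ (τ k) = -θ k) (hP : ∀ k, P k → τ k ≠ k ∧ ¬ P (τ k))
    (hcover : ∀ k, τ k ≠ k → P k ∨ P (τ k)) {L : List ι} (hL : L.Nodup) (hmem : ∀ k, k ∈ L)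
    (l : ι) :
    bogoliubov b τ θ l * (L.map (pairOp b τ θ P)).prod
      = (Real.cos (θ l) : ℂ) • ((L.map (pairOp b τ θ P)).prod * b l) := by
  by_cases hl : τ l = l
  -- An unpaired mode is not rotated, since θ_l = -θ_l, and no pair factor involves it.
  · have h0 : θ l = 0 := by
      have := hθ l
      rw [hl] at this
      linarith
    have ha : bogoliubov b τ θ l = b l := by
      simp [bogoliubov, h0]
    rw [ha, h0, Real.cos_zero, Complex.ofReal_one, one_smul]
    refine (hb.commute_prod fun k _ hk => ⟨?_, ?_⟩).1
    · rintro rfl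
      exact (hP _ hk).1 hl
    · intro h
      refine (hP _ hk).1 (hτ.injective ?_)
      rw [← h, hl]
  · rcases hcover l hl with h | h
    · exact hb.bogoliubov_mul_prod_of_mem hτ hθ hP hL (hmem l) h (Or.inl rfl)
    · exact hb.bogoliubov_mul_prod_of_mem hτ hθ hP hL (hmem _) h (Or.inr (hτ l).symm)

theorem IsCAR.bogoliubov_mulVec_vacuum (hb : IsCAR b) (hτ : Function.Involutive τ)
    (hθ : ∀ k, θ (τ k) = -θ k) (hP : ∀ k, P k → τ k ≠ k ∧ ¬ P (τ k))
    (hcover : ∀ k, τ k ≠ k → P k ∨ P (τ k)) {L : List ι} (hL : L.Nodup) (hmem : ∀ k, k ∈ L)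
    {Ω : m → ℂ} (hΩ : ∀ k, b k *ᵥ Ω = 0) (l : ι) :
    bogoliubov b τ θ l *ᵥ ((L.map (pairOp b τ θ P)).prod *ᵥ Ω) = 0 := by
  rw [mulVec_mulVec, hb.bogoliubov_mul_prod hτ hθ hP hcover hL hmem, smul_mulVec,
    ← mulVec_mulVec, hΩ, mulVec_zero, smul_zero]

theorem IsCAR.isUnit_prod (hb : IsCAR b) (hcos : ∀ k, Real.cos (θ k) ≠ 0) (L : List ι) :
    IsUnit (L.map (pairOp b τ θ P)).prod := by
  induction L with
  | nil => simp
  | cons k L ih =>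
    rw [List.map_cons, List.prod_cons]
    exact (hb.isUnit_pairOp hcos k).mul ih

/-- The product `M` of pair factors is invertible and a_k M = cos θ_k · M b_k with cos θ_k ≠ 0.
Hence M⁻¹ maps a vector killed by all new modes to one killed by all old modes, where uniqueness is
assumed. -/
theorem IsCAR.eq_smul_vacuum (hb : IsCAR b) (hτ : Function.Involutive τ)
    (hθ : ∀ k, θ (τ k) = -θ k) (hP : ∀ k, P k → τ k ≠ k ∧ ¬ P (τ k))
    (hcover : ∀ k, τ k ≠ k → P k ∨ P (τ k)) {L : List ι} (hL : L.Nodup) (hmem : ∀ k, k ∈ L)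
    (hcos : ∀ k, Real.cos (θ k) ≠ 0)
    {Ω : m → ℂ} (hΩ : ∀ ψ : m → ℂ, (∀ k, b k *ᵥ ψ = 0) → ∃ z : ℂ, ψ = z • Ω)
    {ψ : m → ℂ} (hψ : ∀ k, bogoliubov b τ θ k *ᵥ ψ = 0) :
    ∃ z : ℂ, ψ = z • ((L.map (pairOp b τ θ P)).prod *ᵥ Ω) := by
  obtain ⟨u, hu⟩ := hb.isUnit_prod (τ := τ) (P := P) hcos L
  set M := (L.map (pairOp b τ θ P)).prod with hM
  have hinv : M * (↑u⁻¹ : Matrix m m ℂ) = 1 := by rw [← hu, Units.mul_inv]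
  have hinv' : (↑u⁻¹ : Matrix m m ℂ) * M = 1 := by rw [← hu, Units.inv_mul]
  obtain ⟨z, hz⟩ := hΩ ((↑u⁻¹ : Matrix m m ℂ) *ᵥ ψ) fun k => by
    have h1 := hψ k
    rw [← one_mulVec ψ, ← hinv, ← mulVec_mulVec, mulVec_mulVec _ _ M,
      hb.bogoliubov_mul_prod hτ hθ hP hcover hL hmem, smul_mulVec, smul_eq_zero] at h1
    have h2 := h1.resolve_left (by exact_mod_cast hcos k)
    have h3 := congrArg (fun v => (↑u⁻¹ : Matrix m m ℂ) *ᵥ v) h2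
    simp only [mulVec_mulVec, mulVec_zero] at h3
    rwa [← mul_assoc, ← mul_assoc, hinv', one_mul, ← mulVec_mulVec] at h3
  refine ⟨z, ?_⟩
  rw [← mulVec_smul, ← hz, mulVec_mulVec, hinv, one_mulVec]

/-- A pair factor need not be unitary, but on a vector χ killed by both modes it is isometric: χ and
its pair excitation are orthogonal and of equal norm, and their coefficients are cos θ and -i sin θ.
-/
theorem IsCAR.star_pairOp_dotProduct (hb : IsCAR b) {k : ι} (hk : τ k ≠ k) {χ : m → ℂ}
    (h1 : b k *ᵥ χ = 0) (h2 : b (τ k) *ᵥ χ = 0) :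
    star (pairOp b τ θ P k *ᵥ χ) ⬝ᵥ (pairOp b τ θ P k *ᵥ χ) = star χ ⬝ᵥ χ := by
  by_cases hP : P k
  · set D : Matrix m m ℂ := (b k)ᴴ * (b (τ k))ᴴ with hD
    have hD1 : Dᴴ *ᵥ χ = 0 := by
      rw [hD, conjTranspose_mul, conjTranspose_conjTranspose, conjTranspose_conjTranspose,
        ← mulVec_mulVec, h1, mulVec_zero]
    have hD2 : Dᴴ *ᵥ (D *ᵥ χ) = χ := by
      have h3 : b k *ᵥ ((b (τ k))ᴴ *ᵥ χ) = 0 := by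
        rw [mulVec_mulVec, hb.mul_adj_of_ne hk.symm, neg_mulVec, ← mulVec_mulVec, h1,
          mulVec_zero, neg_zero]
      rw [hD, conjTranspose_mul, conjTranspose_conjTranspose, conjTranspose_conjTranspose,
        ← mulVec_mulVec, ← mulVec_mulVec, mulVec_mulVec _ (b k), hb.mul_adj_self, sub_mulVec,
        ← mulVec_mulVec, h3, one_mulVec, mulVec_zero, sub_zero, mulVec_mulVec, hb.mul_adj_self,
        sub_mulVec, ← mulVec_mulVec, h2, one_mulVec, mulVec_zero, sub_zero]
    have hD3 : star χ ⬝ᵥ (D *ᵥ χ) = 0 := by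
      have := star_mulVec_dotProduct Dᴴ χ χ
      rw [conjTranspose_conjTranspose, hD1, star_zero, zero_dotProduct] at this
      exact this.symm
    have hF : pairOp b τ θ P k *ᵥ χ = (Real.cos (θ k) : ℂ) • χ
        - (Complex.I * (Real.sin (θ k) : ℂ)) • (D *ᵥ χ) := by
      rw [pairOp, if_pos hP, sub_mulVec, smul_mulVec, smul_mulVec, one_mulVec]
    have hs : star (Complex.I * ((Real.sin (θ k) : ℝ) : ℂ))
        = -(Complex.I * (Real.sin (θ k) : ℂ)) := by
      rw [star_mul', Complex.star_def, Complex.conj_I, Complex.conj_ofReal, neg_mul]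
    have hc : star ((Real.cos (θ k) : ℝ) : ℂ) = (Real.cos (θ k) : ℂ) := Complex.conj_ofReal _
    have hcs : (Real.cos (θ k) : ℂ) * (Real.cos (θ k) : ℂ)
          + (Real.sin (θ k) : ℂ) * (Real.sin (θ k) : ℂ) = 1 := by
        norm_cast
        nlinarith [Real.sin_sq_add_cos_sq (θ k)]
    rw [hF, star_sub, star_smul, star_smul, hs, hc]
    simp only [sub_dotProduct, dotProduct_sub, smul_dotProduct, dotProduct_smul,
      star_mulVec_dotProduct, hD1, hD2, hD3, dotProduct_zero, smul_eq_mul, mul_zero, sub_zero,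
      zero_sub]
    linear_combination (star χ ⬝ᵥ χ) * hcs
      - (star χ ⬝ᵥ χ) * (Real.sin (θ k) : ℂ) * (Real.sin (θ k) : ℂ) * Complex.I_mul_I
  · rw [pairOp, if_neg hP, one_mulVec]

theorem IsCAR.star_vacuum_dotProduct (hb : IsCAR b) (hτ : Function.Involutive τ)
    (hP : ∀ k, P k → τ k ≠ k ∧ ¬ P (τ k)) {L : List ι} (hL : L.Nodup)
    {Ω : m → ℂ} (hΩ : ∀ k, b k *ᵥ Ω = 0) :
    star ((L.map (pairOp b τ θ P)).prod *ᵥ Ω) ⬝ᵥ ((L.map (pairOp b τ θ P)).prod *ᵥ Ω)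
      = star Ω ⬝ᵥ Ω := by
  induction L with
  | nil => simp
  | cons k L ih =>
    rw [List.nodup_cons] at hL
    rw [List.map_cons, List.prod_cons, ← mulVec_mulVec, ← ih hL.2]
    by_cases hPk : P k
    · have h1 : b k *ᵥ ((L.map (pairOp b τ θ P)).prod *ᵥ Ω) = 0 := by
        rw [mulVec_mulVec, (hb.commute_prod (θ := θ) (L := L) fun i hi hPi => ⟨?_, ?_⟩).1.eq,
          ← mulVec_mulVec, hΩ, mulVec_zero]
        · rintro rfl
          exact hL.1 hi
        · rintro rfl
          exact (hP _ hPi).2 hPk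
      have h2 : b (τ k) *ᵥ ((L.map (pairOp b τ θ P)).prod *ᵥ Ω) = 0 := by
        rw [mulVec_mulVec, (hb.commute_prod (θ := θ) (L := L) fun i hi hPi => ⟨?_, ?_⟩).1.eq,
          ← mulVec_mulVec, hΩ, mulVec_zero]
        · rintro rfl
          exact (hP _ hPk).2 hPi
        · intro h
          exact hL.1 (hτ.injective h ▸ hi)
      exact hb.star_pairOp_dotProduct (hP k hPk).1 h1 h2
    · rw [pairOp, if_neg hPk, one_mulVec]

end Vacuum

/-! ### Spectrum of a free fermion operator near its bottom -/

section Energy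

variable {m ι : Type*} [Fintype m] [Fintype ι] {a : ι → Matrix m m ℂ}

/-- The free fermion operator `∑ₖ ε_k a_k† a_k`. -/
def freeEnergy (a : ι → Matrix m m ℂ) (ε : ι → ℝ) : Matrix m m ℂ :=
  ∑ k, (ε k : ℂ) • ((a k)ᴴ * a k)

theorem star_dotProduct_freeEnergy (ε : ι → ℝ) (χ : m → ℂ) :
    star χ ⬝ᵥ (freeEnergy a ε *ᵥ χ)
      = ((∑ l, ε l * ∑ i, Complex.normSq ((a l *ᵥ χ) i) : ℝ) : ℂ) := by
  rw [freeEnergy, Matrix.sum_mulVec, dotProduct_sum, Complex.ofReal_sum]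
  refine Finset.sum_congr rfl fun l _ => ?_
  rw [smul_mulVec, dotProduct_smul, Complex.ofReal_mul, ← star_dotProduct_self_eq_ofReal,
    star_mulVec_dotProduct, mulVec_mulVec, smul_eq_mul]

variable [DecidableEq m] [DecidableEq ι]

/-- Only the term `l = k` fails to commute with `a k`: removing a particle lowers the energy by ε_k.
-/
theorem IsCAR.freeEnergy_mul (ha : IsCAR a) (ε : ι → ℝ) (k : ι) :
    freeEnergy a ε * a k = a k * freeEnergy a ε - (ε k : ℂ) • a k := by
  have h : ∀ l, (a l)ᴴ * a l * a k = a k * ((a l)ᴴ * a l) - if k = l then a k else 0 := by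
    intro l
    have h1 : a k * (a l)ᴴ = (if k = l then 1 else 0) - (a l)ᴴ * a k :=
      eq_sub_of_add_eq (ha.2 k l)
    rw [← mul_assoc (a k), h1, mul_assoc, ha.mul_eq_neg l k]
    split_ifs with hkl
    · subst hkl
      noncomm_ring
    · noncomm_ring
  simp only [freeEnergy, Finset.sum_mul, Finset.mul_sum, smul_mul_assoc, mul_smul_comm, h,
    smul_sub, Finset.sum_sub_distrib]
  simp

theorem IsCAR.freeEnergy_mul_adj (ha : IsCAR a) (ε : ι → ℝ) (k : ι) :
    freeEnergy a ε * (a k)ᴴ = (a k)ᴴ * freeEnergy a ε + (ε k : ℂ) • (a k)ᴴ := by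
  have h0 : (freeEnergy a ε)ᴴ = freeEnergy a ε := by
    simp [freeEnergy, conjTranspose_sum, conjTranspose_smul, conjTranspose_mul]
  have h := congrArg conjTranspose (ha.freeEnergy_mul ε k)
  simp only [conjTranspose_mul, conjTranspose_sub, conjTranspose_smul, h0, Complex.star_def,
    Complex.conj_ofReal] at h
  rw [h, sub_add_cancel]

/-- Low-lying eigenvectors of a free fermion operator are the vacuum and one-particle states. -/
theorem IsCAR.eigenvector_freeEnergy (ha : IsCAR a) {ε : ι → ℝ} {e : ℝ} (he : 0 < e)
    (hε : ∀ k, e ≤ ε k) {Ω : m → ℂ}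
    (hΩ : ∀ ψ : m → ℂ, (∀ k, a k *ᵥ ψ = 0) → ∃ z : ℂ, ψ = z • Ω) {x : ℝ} (hx : x ≤ e)
    {ψ : m → ℂ} (hψ : freeEnergy a ε *ᵥ ψ = (x : ℂ) • ψ) :
    (∃ z : ℂ, ψ = z • Ω) ∨
      (x = e ∧ ψ ∈ Submodule.span ℂ ((fun k => (a k)ᴴ *ᵥ Ω) '' {k | ε k = e})) := by
  -- The vector a_k ψ satisfies the eigenvalue equation with x - ε_k ≤ 0, whereas the free energy is
  -- a nonnegative form. So all a_l kill a_k ψ, and a_k ψ itself vanishes unless x = ε_k = e.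
  have key : ∀ k, (∃ z : ℂ, a k *ᵥ ψ = z • Ω) ∧ (a k *ᵥ ψ = 0 ∨ (x = e ∧ ε k = e)) := by
    intro k
    have h1 : freeEnergy a ε *ᵥ (a k *ᵥ ψ) = ((x - ε k : ℝ) : ℂ) • (a k *ᵥ ψ) := by
      rw [mulVec_mulVec, ha.freeEnergy_mul, sub_mulVec, ← mulVec_mulVec, hψ, mulVec_smul,
        smul_mulVec, ← sub_smul, Complex.ofReal_sub]
    have h2 := star_dotProduct_freeEnergy (a := a) ε (a k *ᵥ ψ)
    rw [h1, dotProduct_smul, star_dotProduct_self_eq_ofReal, smul_eq_mul] at h2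
    norm_cast at h2
    have hpos : ∀ l, 0 < ε l := fun l => he.trans_le (hε l)
    have hterm : ∀ l ∈ Finset.univ, 0 ≤ ε l * ∑ i, Complex.normSq ((a l *ᵥ (a k *ᵥ ψ)) i) :=
      fun l _ => mul_nonneg (hpos l).le (sum_normSq_nonneg _)
    have hsum := Finset.sum_nonneg hterm
    have hn := sum_normSq_nonneg (a k *ᵥ ψ)
    have hle : x - ε k ≤ 0 := by linarith [hε k]
    have hz : (x - ε k) * ∑ i, Complex.normSq ((a k *ᵥ ψ) i) = 0 :=
      le_antisymm (mul_nonpos_of_nonpos_of_nonneg hle hn) (h2 ▸ hsum)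
    constructor
    · refine hΩ _ fun l => ?_
      have := (Finset.sum_eq_zero_iff_of_nonneg hterm).mp (h2.symm.trans hz) l (Finset.mem_univ l)
      exact sum_normSq_eq_zero ((mul_eq_zero.mp this).resolve_left (hpos l).ne')
    · rcases mul_eq_zero.mp hz with h | h
      · exact Or.inr ⟨by linarith [hε k], by linarith [hε k]⟩
      · exact Or.inl (sum_normSq_eq_zero h)
  by_cases hx' : x = e
  · right
    refine ⟨hx', ?_⟩
    -- The eigenvalue equation, divided by x = e > 0, rebuilds ψ from the vectors a_k ψ, which are
    -- multiples of the vacuum.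
    have hψ' : ψ = (x : ℂ)⁻¹ • ∑ k, (ε k : ℂ) • ((a k)ᴴ *ᵥ (a k *ᵥ ψ)) := by
      have h : ∑ k, (ε k : ℂ) • ((a k)ᴴ *ᵥ (a k *ᵥ ψ)) = freeEnergy a ε *ᵥ ψ := by
        simp only [freeEnergy, Matrix.sum_mulVec, smul_mulVec, mulVec_mulVec]
      have hx0 : (x : ℂ) ≠ 0 := by
        rw [hx']
        exact_mod_cast he.ne'
      rw [h, hψ, smul_smul, inv_mul_cancel₀ hx0, one_smul]
    rw [hψ']
    refine Submodule.smul_mem _ _ (Submodule.sum_mem _ fun k _ => Submodule.smul_mem _ _ ?_)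
    obtain ⟨⟨z, hz⟩, h | h⟩ := key k
    · rw [h, mulVec_zero]
      exact Submodule.zero_mem _
    · rw [hz, mulVec_smul]
      exact Submodule.smul_mem _ _ (Submodule.subset_span ⟨k, h.2, rfl⟩)
  · left
    exact hΩ ψ fun k => (key k).2.resolve_right fun h => hx' h.1

end Energy

/-! ### Identities for the Pauli matrices -/

section Pauli

theorem pauliPlus_eq : pauliPlus = !![0, 1; 0, 0] := by
  ext i j
  fin_cases i <;> fin_cases j <;> norm_num [pauliPlus, pauliX, pauliY]

theorem pauliPlus_conjTranspose : pauliPlusᴴ = !![0, 0; 1, 0] := by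
  rw [pauliPlus_eq]
  ext i j
  fin_cases i <;> fin_cases j <;> simp

theorem pauliZ_eq_diagonal : pauliZ = diagonal ![1, -1] := by
  ext i j
  fin_cases i <;> fin_cases j <;> simp [pauliZ]

theorem pauliX_mul_self : pauliX * pauliX = 1 := by
  ext i j
  fin_cases i <;> fin_cases j <;> simp [pauliX]

theorem pauliZ_mul_self : pauliZ * pauliZ = 1 := by
  ext i j
  fin_cases i <;> fin_cases j <;> simp [pauliZ]

theorem pauliX_mul_pauliZ : pauliX * pauliZ = -(pauliZ * pauliX) := by
  ext i j
  fin_cases i <;> fin_cases j <;> simp [pauliX, pauliZ]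

theorem pauliY_mul_pauliZ : pauliY * pauliZ = -(pauliZ * pauliY) := by
  ext i j
  fin_cases i <;> fin_cases j <;> simp [pauliY, pauliZ]

theorem pauliY_mul_pauliX : pauliY * pauliX = -(pauliX * pauliY) := by
  ext i j
  fin_cases i <;> fin_cases j <;> simp [pauliX, pauliY]

theorem pauliPlus_mul_pauliZ : pauliPlus * pauliZ = -(pauliZ * pauliPlus) := by
  rw [pauliPlus_eq]
  ext i j
  fin_cases i <;> fin_cases j <;> simp [pauliZ]

theorem pauliPlusAdj_mul_pauliZ : pauliPlusᴴ * pauliZ = -(pauliZ * pauliPlusᴴ) := by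
  rw [pauliPlus_conjTranspose]
  ext i j
  fin_cases i <;> fin_cases j <;> simp [pauliZ]

theorem pauliPlus_mul_self : pauliPlus * pauliPlus = 0 := by
  rw [pauliPlus_eq]
  ext i j
  fin_cases i <;> fin_cases j <;> simp

theorem pauliPlus_anticomm_adj : pauliPlus * pauliPlusᴴ + pauliPlusᴴ * pauliPlus = 1 := by
  rw [pauliPlus_conjTranspose, pauliPlus_eq]
  ext i j
  fin_cases i <;> fin_cases j <;> simp

theorem pauliPlusAdj_mul_pauliPlus : pauliPlusᴴ * pauliPlus = diagonal ![0, 1] := by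
  rw [pauliPlus_conjTranspose, pauliPlus_eq]
  ext i j
  fin_cases i <;> fin_cases j <;> simp

theorem pauliX_conj_pauliPlus : pauliX * pauliPlus * pauliX = pauliPlusᴴ := by
  rw [pauliPlus_conjTranspose, pauliPlus_eq]
  ext i j
  fin_cases i <;> fin_cases j <;> simp [pauliX]

theorem pauliX_conj_pauliZ : pauliX * pauliZ * pauliX = -pauliZ := by
  rw [pauliX_mul_pauliZ, neg_mul, mul_assoc, pauliX_mul_self, mul_one]

theorem pauliPlusAdj_add : pauliPlusᴴ + pauliPlus = pauliX := by
  rw [pauliPlus_conjTranspose, pauliPlus_eq]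
  ext i j
  fin_cases i <;> fin_cases j <;> simp [pauliX]

theorem pauliPlusAdj_sub : pauliPlusᴴ - pauliPlus = -Complex.I • pauliY := by
  rw [pauliPlus_conjTranspose, pauliPlus_eq]
  ext i j
  fin_cases i <;> fin_cases j <;> simp [pauliY]

theorem pauliX_mul_pauliZ_eq : pauliX * pauliZ = -Complex.I • pauliY := by
  ext i j
  fin_cases i <;> fin_cases j <;> simp [pauliX, pauliY, pauliZ]

theorem pauliY_mul_pauliZ_eq : pauliY * pauliZ = Complex.I • pauliX := by
  ext i j
  fin_cases i <;> fin_cases j <;> simp [pauliX, pauliY, pauliZ]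

end Pauli

/-! ### Tensor products, Jordan-Wigner strings, parities, and the Hamiltonian on the odd sector -/

section Tensor

variable {N : ℕ}

theorem tensorOp_mul (A B : Fin N → Matrix (Fin 2) (Fin 2) ℂ) :
    tensorOp A * tensorOp B = tensorOp fun k => A k * B k := by
  ext s t
  simp only [tensorOp, mul_apply, of_apply, ← Finset.prod_mul_distrib]
  rw [Finset.prod_univ_sum, Fintype.piFinset_univ]

theorem tensorOp_diagonal (d : Fin N → Fin 2 → ℂ) :
    (tensorOp fun k => diagonal (d k)) = diagonal fun s => ∏ k, d k (s k) := by
  ext s t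
  by_cases h : s = t
  · subst h
    simp [tensorOp]
  · obtain ⟨k, hk⟩ := Function.ne_iff.mp h
    rw [diagonal_apply_ne _ h, tensorOp, of_apply]
    exact Finset.prod_eq_zero (Finset.mem_univ k) (diagonal_apply_ne _ hk)

theorem tensorOp_one : (tensorOp fun _ : Fin N => (1 : Matrix (Fin 2) (Fin 2) ℂ)) = 1 := by
  have := tensorOp_diagonal fun (_ : Fin N) (_ : Fin 2) => (1 : ℂ)
  simpa using this

theorem tensorOp_conjTranspose (A : Fin N → Matrix (Fin 2) (Fin 2) ℂ) :
    (tensorOp A)ᴴ = tensorOp fun k => (A k)ᴴ := by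
  ext s t
  simp [tensorOp]

theorem tensorOp_smul (z : Fin N → ℂ) (A : Fin N → Matrix (Fin 2) (Fin 2) ℂ) :
    (tensorOp fun k => z k • A k) = (∏ k, z k) • tensorOp A := by
  ext s t
  simp [tensorOp, Finset.prod_mul_distrib]

theorem tensorOp_smul_of {A B : Fin N → Matrix (Fin 2) (Fin 2) ℂ} (j : Fin N) (z : ℂ)
    (h : ∀ k, k ≠ j → A k = B k) (hj : A j = z • B j) : tensorOp A = z • tensorOp B := by
  have hA : A = fun k => (if k = j then z else 1) • B k := by
    funext k
    by_cases hk : k = j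
    · rw [if_pos hk, hk, hj]
    · rw [if_neg hk, h k hk, one_smul]
  rw [hA, tensorOp_smul, Finset.prod_ite_eq']
  simp

theorem tensorOp_neg_of {A B : Fin N → Matrix (Fin 2) (Fin 2) ℂ} (j : Fin N)
    (h : ∀ k, k ≠ j → A k = B k) (hj : A j = -B j) : tensorOp A = -tensorOp B := by
  rw [tensorOp_smul_of j (-1) h (by rw [hj, neg_one_smul]), neg_one_smul]

theorem tensorOp_add_of {A B C : Fin N → Matrix (Fin 2) (Fin 2) ℂ} (j : Fin N)
    (hA : ∀ k, k ≠ j → A k = C k) (hB : ∀ k, k ≠ j → B k = C k) (hj : C j = A j + B j) :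
    tensorOp C = tensorOp A + tensorOp B := by
  ext s t
  simp only [tensorOp, of_apply, Matrix.add_apply]
  rw [← Finset.mul_prod_erase _ _ (Finset.mem_univ j),
    ← Finset.mul_prod_erase _ (fun k => A k (s k) (t k)) (Finset.mem_univ j),
    ← Finset.mul_prod_erase _ (fun k => B k (s k) (t k)) (Finset.mem_univ j), hj, Matrix.add_apply,
    add_mul]
  congr 2
  · exact Finset.prod_congr rfl fun k hk => by rw [hA k (Finset.ne_of_mem_erase hk)]
  · exact Finset.prod_congr rfl fun k hk => by rw [hB k (Finset.ne_of_mem_erase hk)]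

/-- The string `(⊗_{l < j} σᶻ) ⊗ M` with the matrix `M` at site `j`. -/
def jwString (j : Fin N) (M : Matrix (Fin 2) (Fin 2) ℂ) : Op N :=
  tensorOp fun l => if l < j then pauliZ else if l = j then M else 1

theorem pauliZ_conjTranspose : pauliZᴴ = pauliZ := by
  ext i j
  fin_cases i <;> fin_cases j <;> simp [pauliZ]

theorem jwString_conjTranspose (j : Fin N) (M : Matrix (Fin 2) (Fin 2) ℂ) :
    (jwString j M)ᴴ = jwString j Mᴴ := by
  rw [jwString, tensorOp_conjTranspose, jwString]
  congr 1
  funext l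
  split_ifs
  · exact pauliZ_conjTranspose
  · rfl
  · exact conjTranspose_one

theorem jwString_add (j : Fin N) (M M' : Matrix (Fin 2) (Fin 2) ℂ) :
    jwString j (M + M') = jwString j M + jwString j M' := by
  refine tensorOp_add_of j (fun k hk => ?_) (fun k hk => ?_) ?_ <;> simp [*]

theorem jwString_smul (j : Fin N) (z : ℂ) (M : Matrix (Fin 2) (Fin 2) ℂ) :
    jwString j (z • M) = z • jwString j M := by
  refine tensorOp_smul_of j z (fun k hk => ?_) ?_ <;> simp [*]

theorem siteOp_add (j : Fin N) (M M' : Matrix (Fin 2) (Fin 2) ℂ) :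
    siteOp j (M + M') = siteOp j M + siteOp j M' := by
  refine tensorOp_add_of j (fun k hk => ?_) (fun k hk => ?_) ?_ <;> simp [*]

theorem siteOp_one (j : Fin N) : siteOp j 1 = 1 := by
  simp only [siteOp, ite_self, tensorOp_one]

theorem siteOp_zero (j : Fin N) : siteOp j 0 = 0 := by
  have := siteOp_add j 0 0
  rwa [add_zero, right_eq_add] at this

theorem jwString_mul_self (j : Fin N) (M M' : Matrix (Fin 2) (Fin 2) ℂ) :
    jwString j M * jwString j M' = siteOp j (M * M') := by
  rw [jwString, jwString, tensorOp_mul, siteOp]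
  congr 1
  funext l
  rcases lt_trichotomy l j with h | h | h
  · rw [if_pos h, if_pos h, if_neg h.ne, pauliZ_mul_self]
  · simp [h]
  · simp [h.not_gt, h.ne']

/-- The sign arises at site `j` alone, where `M` meets the σᶻ of the longer string; every other site
commutes. -/
theorem jwString_mul_of_lt {j l : Fin N} (h : j < l) {M : Matrix (Fin 2) (Fin 2) ℂ}
    (hM : M * pauliZ = -(pauliZ * M)) (M' : Matrix (Fin 2) (Fin 2) ℂ) :
    jwString j M * jwString l M' = -(jwString l M' * jwString j M) := by
  simp only [jwString, tensorOp_mul]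
  refine tensorOp_neg_of j (fun k hk => ?_) ?_
  · rcases lt_trichotomy k j with h' | h' | h'
    · simp [h', h'.trans h]
    · exact absurd h' hk
    · simp [h'.not_gt, hk]
  · simp [h, hM]

theorem jwString_anticomm {j l : Fin N} (h : j ≠ l) {M M' : Matrix (Fin 2) (Fin 2) ℂ}
    (hM : M * pauliZ = -(pauliZ * M)) (hM' : M' * pauliZ = -(pauliZ * M')) :
    jwString j M * jwString l M' + jwString l M' * jwString j M = 0 := by
  rcases h.lt_or_gt with h | h
  · rw [jwString_mul_of_lt h hM, neg_add_cancel]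
  · rw [jwString_mul_of_lt h hM', add_neg_cancel]

theorem fermiC_eq (j : Fin N) : fermiC j = jwString j pauliPlus := rfl

theorem fermiC_adj (j : Fin N) : (fermiC j)ᴴ = jwString j pauliPlusᴴ := by
  rw [fermiC_eq, jwString_conjTranspose]

theorem isCAR_fermiC : IsCAR (fermiC (N := N)) := by
  constructor
  · intro k l
    rw [fermiC_eq, fermiC_eq]
    by_cases h : k = l
    · rw [h, jwString_mul_self, pauliPlus_mul_self, siteOp_zero, add_zero]
    · exact jwString_anticomm h pauliPlus_mul_pauliZ pauliPlus_mul_pauliZ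
  · intro k l
    rw [fermiC_adj, fermiC_eq]
    by_cases h : k = l
    · rw [if_pos h, h, jwString_mul_self, jwString_mul_self, ← siteOp_add,
        pauliPlus_anticomm_adj, siteOp_one]
    · rw [if_neg h]
      exact jwString_anticomm h pauliPlus_mul_pauliZ pauliPlusAdj_mul_pauliZ

theorem siteOp_diagonal (j : Fin N) (d : Fin 2 → ℂ) :
    siteOp j (diagonal d) = diagonal fun s => d (s j) := by
  have h : (fun k => if k = j then diagonal d else (1 : Matrix (Fin 2) (Fin 2) ℂ))
      = fun k => diagonal (if k = j then d else 1) := by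
    funext k
    split_ifs
    · rfl
    · exact diagonal_one.symm
  rw [siteOp, h, tensorOp_diagonal]
  congr 1
  funext s
  rw [Finset.prod_eq_single j] <;> simp +contextual

/-- This indicates spin down at site `j`. A vector killed by all `fermiC j` must then vanish on
every configuration with a down spin, which makes the Jordan-Wigner vacuum unique. -/
theorem fermiC_adj_mul_fermiC (j : Fin N) :
    (fermiC j)ᴴ * fermiC j = diagonal fun s => (![0, 1] : Fin 2 → ℂ) (s j) := by
  rw [fermiC_adj, fermiC_eq, jwString_mul_self, pauliPlusAdj_mul_pauliPlus, siteOp_diagonal]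

theorem fermiC_mulVec_allUp (j : Fin N) : fermiC j *ᵥ allUp N = 0 := by
  have h : star (fermiC j *ᵥ allUp N) ⬝ᵥ (fermiC j *ᵥ allUp N) = 0 := by
    rw [star_mulVec_dotProduct, mulVec_mulVec, fermiC_adj_mul_fermiC]
    have h0 : (diagonal fun s : Config N => (![0, 1] : Fin 2 → ℂ) (s j)) *ᵥ allUp N = 0 := by
      funext s
      rw [mulVec_diagonal, allUp]
      by_cases hs : s = fun _ => 0
      · simp [hs]
      · rw [Pi.single_eq_of_ne hs, mul_zero, Pi.zero_apply]
    rw [h0, dotProduct_zero]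
  rw [star_dotProduct_self_eq_ofReal, Complex.ofReal_eq_zero] at h
  exact sum_normSq_eq_zero h

theorem eq_smul_allUp {ψ : State N} (h : ∀ j, fermiC j *ᵥ ψ = 0) : ∃ z : ℂ, ψ = z • allUp N := by
  refine ⟨ψ fun _ => 0, ?_⟩
  funext s
  by_cases hs : s = fun _ => 0
  · simp [hs, allUp]
  · obtain ⟨j, hj⟩ := Function.ne_iff.mp hs
    have h1 : ((fermiC j)ᴴ * fermiC j) *ᵥ ψ = 0 := by rw [← mulVec_mulVec, h j, mulVec_zero]
    rw [fermiC_adj_mul_fermiC] at h1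
    have h2 := congrFun h1 s
    rw [mulVec_diagonal, Fin.eq_one_of_ne_zero _ hj] at h2
    simpa [allUp, hs] using h2

theorem star_allUp_dotProduct : star (allUp N) ⬝ᵥ allUp N = 1 := by
  rw [allUp, dotProduct_single_one]
  simp

theorem parityZ_eq_diagonal :
    parityZ N = diagonal fun s => ∏ k, (![1, -1] : Fin 2 → ℂ) (s k) := by
  rw [parityZ, pauliZ_eq_diagonal, tensorOp_diagonal]

theorem parityZ_mulVec_allUp : parityZ N *ᵥ allUp N = allUp N := by
  funext s
  rw [parityZ_eq_diagonal, mulVec_diagonal, allUp]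
  by_cases hs : s = fun _ => 0
  · simp [hs]
  · simp [hs]

theorem parityZ_mul_self : parityZ N * parityZ N = 1 := by
  simp only [parityZ, tensorOp_mul, pauliZ_mul_self, tensorOp_one]

theorem parityX_mul_self : parityX N * parityX N = 1 := by
  simp only [parityX, tensorOp_mul, pauliX_mul_self, tensorOp_one]

theorem pauliX_conjTranspose : pauliXᴴ = pauliX := by
  ext i j
  fin_cases i <;> fin_cases j <;> simp [pauliX]

theorem parityX_conjTranspose : (parityX N)ᴴ = parityX N := by
  simp only [parityX, tensorOp_conjTranspose, pauliX_conjTranspose]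

/-- Each site contributes one sign, N in total; oddness of N makes the parities anticommute. -/
theorem parityX_mul_parityZ (hN : Odd N) : parityX N * parityZ N = -(parityZ N * parityX N) := by
  simp only [parityX, parityZ, tensorOp_mul]
  have h : (fun _ : Fin N => pauliX * pauliZ) = fun _ => (-1 : ℂ) • (pauliZ * pauliX) := by
    funext k
    rw [pauliX_mul_pauliZ, neg_one_smul]
  rw [h, tensorOp_smul]
  simp [hN.neg_one_pow]

theorem parityZ_mul_fermiC (j : Fin N) : parityZ N * fermiC j = -(fermiC j * parityZ N) := by
  simp only [parityZ, fermiC, tensorOp_mul]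
  refine tensorOp_neg_of j (fun k hk => ?_) ?_
  · by_cases h : k < j <;> simp [h, hk]
  · simp [pauliPlus_mul_pauliZ]

/-- The sign counts the σᶻ factors to the left of site `j`, each of which changes sign under σˣ; σ⁺
becomes its adjoint. -/
theorem parityX_conj_fermiC (j : Fin N) :
    parityX N * fermiC j * parityX N = (-1 : ℂ) ^ (j : ℕ) • (fermiC j)ᴴ := by
  rw [fermiC_adj, fermiC_eq]
  simp only [parityX, jwString, tensorOp_mul]
  have h : (fun k => pauliX * (if k < j then pauliZ else if k = j then pauliPlus else 1) * pauliX)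
      = fun k => (if k < j then (-1 : ℂ) else 1) •
        (if k < j then pauliZ else if k = j then pauliPlusᴴ else 1) := by
    funext k
    split_ifs
    · rw [pauliX_conj_pauliZ, neg_one_smul]
    · rw [pauliX_conj_pauliPlus, one_smul]
    · rw [mul_one, pauliX_mul_self, one_smul]
  rw [h, tensorOp_smul, Finset.prod_ite, Finset.prod_const, Finset.prod_const_one, mul_one]
  congr 2
  rw [← Fin.card_Iio j]
  congr 1
  ext k
  simp

theorem siteOp_mul_tensorOp_const (j : Fin N) {A P : Matrix (Fin 2) (Fin 2) ℂ}
    (h : A * P = -(P * A)) :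
    (siteOp j A * tensorOp fun _ => P) = -((tensorOp fun _ => P) * siteOp j A) := by
  simp only [siteOp, tensorOp_mul]
  refine tensorOp_neg_of j (fun k hk => ?_) ?_
  · simp [hk]
  · simp [h]

theorem siteOp_commute_tensorOp_const (j : Fin N) {A P : Matrix (Fin 2) (Fin 2) ℂ}
    (h : A * P = P * A) : Commute (siteOp j A) (tensorOp fun _ => P) := by
  simp only [Commute, SemiconjBy, siteOp, tensorOp_mul]
  congr 1
  funext k
  by_cases hk : k = j <;> simp [hk, h]

theorem commute_mul_of_anticommute {R : Type*} [Ring R] {a b p : R} (ha : a * p = -(p * a))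
    (hb : b * p = -(p * b)) : Commute (a * b) p := by
  change _ = _
  rw [mul_assoc, hb, mul_neg, ← mul_assoc, ha, neg_mul, neg_neg, mul_assoc]

theorem hamiltonian_commute_parityX [NeZero N] (φ : ℝ) :
    Commute (hamiltonian N φ) (parityX N) := by
  refine Commute.sum_left _ _ _ fun j _ => Commute.add_left (Commute.smul_left ?_ _)
    (Commute.smul_left ?_ _)
  · exact (siteOp_commute_tensorOp_const _ rfl).mul_left (siteOp_commute_tensorOp_const _ rfl)
  · exact commute_mul_of_anticommute (siteOp_mul_tensorOp_const _ pauliY_mul_pauliX)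
      (siteOp_mul_tensorOp_const _ pauliY_mul_pauliX)

theorem hamiltonian_commute_parityZ [NeZero N] (φ : ℝ) :
    Commute (hamiltonian N φ) (parityZ N) := by
  refine Commute.sum_left _ _ _ fun j _ => Commute.add_left (Commute.smul_left ?_ _)
    (Commute.smul_left ?_ _)
  · exact commute_mul_of_anticommute (siteOp_mul_tensorOp_const _ pauliX_mul_pauliZ)
      (siteOp_mul_tensorOp_const _ pauliX_mul_pauliZ)
  · exact commute_mul_of_anticommute (siteOp_mul_tensorOp_const _ pauliY_mul_pauliZ)
      (siteOp_mul_tensorOp_const _ pauliY_mul_pauliZ)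

/-- The Majorana operator `c_j† + c_j`. -/
def majA (j : Fin N) : Op N := (fermiC j)ᴴ + fermiC j

/-- The Majorana operator `c_j† - c_j`. -/
def majB (j : Fin N) : Op N := (fermiC j)ᴴ - fermiC j

theorem majA_eq (j : Fin N) : majA j = jwString j pauliX := by
  rw [majA, fermiC_adj, fermiC_eq, ← jwString_add, pauliPlusAdj_add]

theorem majB_eq (j : Fin N) : majB j = -Complex.I • jwString j pauliY := by
  rw [majB, fermiC_adj, fermiC_eq, ← jwString_smul, ← pauliPlusAdj_sub, sub_eq_add_neg,
    sub_eq_add_neg, jwString_add, ← neg_one_smul ℂ pauliPlus, jwString_smul, neg_one_smul]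

/-- The strings cancel to the left of `j`, and the σᶻ of the longer one remains at `j`. -/
theorem jwString_mul_succ {j l : Fin N} (h : (l : ℕ) = j + 1) (M M' : Matrix (Fin 2) (Fin 2) ℂ) :
    jwString j M * jwString l M' = siteOp j (M * pauliZ) * siteOp l M' := by
  simp only [jwString, siteOp, tensorOp_mul]
  congr 1
  funext k
  have hjl : j < l := by rw [Fin.lt_def]; lia
  rcases lt_trichotomy k j with h' | h' | h'
  · simp [h', h'.ne, h'.trans hjl, (h'.trans hjl).ne, pauliZ_mul_self]
  · subst h'
    simp [hjl, hjl.ne]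
  · have : ¬ k < l := by
      rw [Fin.lt_def] at h' ⊢
      lia
    simp [h'.not_gt, h'.ne', this]

/-- For the bond joining the last site to the first, the string runs over the whole chain and is
absorbed by Πᶻ. On the odd sector the sign -1 of Πᶻ cancels the sign here, so this bond looks like
all the others. -/
theorem jwString_mul_wrap {j l : Fin N} (hj : (j : ℕ) + 1 = N) (hl : (l : ℕ) = 0)
    (M : Matrix (Fin 2) (Fin 2) ℂ) {M' : Matrix (Fin 2) (Fin 2) ℂ}
    (hM' : M' * pauliZ = -(pauliZ * M')) :
    jwString j M * jwString l M' * parityZ N = -(siteOp j (M * pauliZ) * siteOp l M') := by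
  simp only [jwString, siteOp, parityZ, tensorOp_mul]
  refine tensorOp_neg_of l (fun k hk => ?_) ?_
  · have h1 : ¬ k < l := by
      rw [Fin.lt_def]
      lia
    have h2 : k < j ∨ k = j := by
      rw [Fin.lt_def, Fin.ext_iff]
      lia
    rcases h2 with h2 | h2
    · simp [h1, hk, h2, h2.ne, pauliZ_mul_self]
    · subst h2
      simp [h1, hk]
  -- The case `l = j` is the chain with a single site.
  · have h2 : l < j ∨ l = j := by
      rw [Fin.lt_def, Fin.ext_iff]
      lia
    rcases h2 with h2 | h2
    · simp only [h2, lt_irrefl, h2.ne, if_true, if_false, mul_assoc, hM', mul_neg]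
      rw [← mul_assoc, pauliZ_mul_self]
    · subst h2
      simp only [lt_irrefl, if_true, if_false, mul_assoc, hM', mul_neg]

/-- The quadratic form in the fermions that agrees with the Hamiltonian on the odd sector. -/
def fermiHamiltonian (N : ℕ) [NeZero N] (φ : ℝ) : Op N :=
  ∑ j : Fin N, ((Real.cos φ : ℂ) • (majB j * majA (j + 1))
    - (Real.sin φ : ℂ) • (majA j * majB (j + 1)))

theorem siteOp_smul (j : Fin N) (z : ℂ) (M : Matrix (Fin 2) (Fin 2) ℂ) :
    siteOp j (z • M) = z • siteOp j M := by
  refine tensorOp_smul_of j z (fun k hk => ?_) ?_ <;> simp [*]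

theorem val_add_one_mod [NeZero N] (j : Fin N) : ((j + 1 : Fin N) : ℕ) = ((j : ℕ) + 1) % N := by
  rw [Fin.val_add, Fin.val_one', Nat.add_mod_mod]

theorem siteOp_mul_siteOp_succ_mulVec [NeZero N] (j : Fin N) {M M' : Matrix (Fin 2) (Fin 2) ℂ}
    (hM' : M' * pauliZ = -(pauliZ * M')) {ψ : State N} (hψ : parityZ N *ᵥ ψ = -ψ) :
    (siteOp j (M * pauliZ) * siteOp (j + 1) M') *ᵥ ψ
      = (jwString j M * jwString (j + 1) M') *ᵥ ψ := by
  by_cases hj : (j : ℕ) + 1 = N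
  · have hl : ((j + 1 : Fin N) : ℕ) = 0 := by rw [val_add_one_mod, hj, Nat.mod_self]
    rw [← neg_eq_iff_eq_neg.mpr (jwString_mul_wrap hj hl M hM'), neg_mulVec, ← mulVec_mulVec _ _
      (parityZ N), hψ, mulVec_neg, neg_neg]
  · have hl : ((j + 1 : Fin N) : ℕ) = j + 1 := by
      rw [val_add_one_mod, Nat.mod_eq_of_lt]
      lia
    rw [jwString_mul_succ hl]

/-- A σᶻ turns σʸ into a multiple of σˣ and conversely, so each σˣσˣ bond is a product B_j A_{j+1}
and each σʸσʸ bond a product -A_j B_{j+1} of Majorana operators. -/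
theorem hamiltonian_mulVec_of_odd [NeZero N] (φ : ℝ) {ψ : State N}
    (hψ : parityZ N *ᵥ ψ = -ψ) : hamiltonian N φ *ᵥ ψ = fermiHamiltonian N φ *ᵥ ψ := by
  have hI : ∀ v : State N, -Complex.I • (Complex.I • v) = v := fun v => by
    rw [smul_smul, neg_mul, Complex.I_mul_I, neg_neg, one_smul]
  have hI' : ∀ v : State N, -Complex.I • (-Complex.I • v) = -v := fun v => by
    rw [smul_smul, neg_mul_neg, Complex.I_mul_I, neg_one_smul]
  have hX : ∀ j : Fin N, (siteOp j pauliX * siteOp (j + 1) pauliX) *ᵥ ψ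
      = (majB j * majA (j + 1)) *ᵥ ψ := fun j => by
    rw [majA_eq, majB_eq, smul_mul_assoc, smul_mulVec, ← siteOp_mul_siteOp_succ_mulVec j
      pauliX_mul_pauliZ hψ, pauliY_mul_pauliZ_eq, siteOp_smul, smul_mul_assoc, smul_mulVec, hI]
  have hY : ∀ j : Fin N, (siteOp j pauliY * siteOp (j + 1) pauliY) *ᵥ ψ
      = -((majA j * majB (j + 1)) *ᵥ ψ) := fun j => by
    rw [majA_eq, majB_eq, mul_smul_comm, smul_mulVec, ← siteOp_mul_siteOp_succ_mulVec j
      pauliY_mul_pauliZ hψ, pauliX_mul_pauliZ_eq, siteOp_smul, smul_mul_assoc, smul_mulVec, hI',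
      neg_neg]
  simp only [hamiltonian, fermiHamiltonian, Matrix.sum_mulVec, add_mulVec, neg_mulVec, smul_mulVec,
    hX, hY, smul_neg, sub_eq_add_neg]

end Tensor

/-! ### Number operators in terms of the combinations b_{-q}† ± b_q -/

section Majorana

variable {m ι : Type*} [Fintype m] [DecidableEq m] [DecidableEq ι]
  {b : ι → Matrix m m ℂ} {τ : ι → ι} {θ : ι → ℝ}

/-- The even combination `b_k + b_{τ k}†`. -/
def evenComb (b : ι → Matrix m m ℂ) (τ : ι → ι) (k : ι) : Matrix m m ℂ := b k + (b (τ k))ᴴ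

/-- The odd combination `b_{τ k}† - b_k`. -/
def oddComb (b : ι → Matrix m m ℂ) (τ : ι → ι) (k : ι) : Matrix m m ℂ := (b (τ k))ᴴ - b k

/-- In terms of these combinations the Bogoliubov rotation is multiplication by e^{±iθ}. The mode
and its partner are added so that the products of two even or of two odd combinations collapse to
constants by anticommutation, leaving only mixed products, whose phases are e^{±2iθ}. -/
theorem IsCAR.number_add_number (hb : IsCAR b) (hτ : Function.Involutive τ)
    (hθ : ∀ k, θ (τ k) = -θ k) (k : ι) :
    (bogoliubov b τ θ k)ᴴ * bogoliubov b τ θ k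
        + (bogoliubov b τ θ (τ k))ᴴ * bogoliubov b τ θ (τ k)
      = (1 / 2 * Complex.exp (2 * Complex.I * θ k)) • (oddComb b τ (τ k) * evenComb b τ k)
        + (1 / 2 * Complex.exp (2 * Complex.I * θ (τ k))) • (oddComb b τ k * evenComb b τ (τ k))
        + 1 := by
  set α := evenComb b τ k with hα
  set α' := evenComb b τ (τ k) with hα'
  set β := oddComb b τ k with hβ
  set β' := oddComb b τ (τ k) with hβ'
  have r1 := hb.1 k (τ k)
  have r2 := hb.2 k k
  have r3 := hb.2 (τ k) (τ k)
  have r4 := hb.adj_mul_adj_eq_neg (τ k) k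
  rw [if_pos rfl] at r2 r3
  have hαα : α * α' = (2 : ℂ) • 1 - α' * α := by
    have : α * α' + α' * α = (b k * (b k)ᴴ + (b k)ᴴ * b k)
        + (b (τ k) * (b (τ k))ᴴ + (b (τ k))ᴴ * b (τ k)) + (b k * b (τ k) + b (τ k) * b k)
        + ((b (τ k))ᴴ * (b k)ᴴ + (b k)ᴴ * (b (τ k))ᴴ) := by
      simp only [hα, hα', evenComb, hτ k]
      noncomm_ring
    rw [r1, r2, r3, r4, neg_add_cancel] at this
    rw [eq_sub_iff_add_eq, this]
    module
  have hββ : β * β' = -((2 : ℂ) • 1) - β' * β := by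
    have : β * β' + β' * β = -(b k * (b k)ᴴ + (b k)ᴴ * b k)
        - (b (τ k) * (b (τ k))ᴴ + (b (τ k))ᴴ * b (τ k)) + (b k * b (τ k) + b (τ k) * b k)
        + ((b (τ k))ᴴ * (b k)ᴴ + (b k)ᴴ * (b (τ k))ᴴ) := by
      simp only [hβ, hβ', oddComb, hτ k]
      noncomm_ring
    rw [r1, r2, r3, r4, neg_add_cancel] at this
    rw [eq_sub_iff_add_eq, this]
    module
  have hαβ : α * β' = -(β' * α) := by
    have : α * β' + β' * α = (b k * (b k)ᴴ + (b k)ᴴ * b k)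
        - (b (τ k) * (b (τ k))ᴴ + (b (τ k))ᴴ * b (τ k)) - (b k * b (τ k) + b (τ k) * b k)
        + ((b (τ k))ᴴ * (b k)ᴴ + (b k)ᴴ * (b (τ k))ᴴ) := by
      simp only [hα, hβ', oddComb, evenComb, hτ k]
      noncomm_ring
    rw [r1, r2, r3, r4, neg_add_cancel] at this
    rw [eq_neg_iff_add_eq_zero, this]
    module
  have hαβ' : α' * β = -(β * α') := by
    have : α' * β + β * α' = -(b k * (b k)ᴴ + (b k)ᴴ * b k)
        + (b (τ k) * (b (τ k))ᴴ + (b (τ k))ᴴ * b (τ k)) - (b k * b (τ k) + b (τ k) * b k)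
        + ((b (τ k))ᴴ * (b k)ᴴ + (b k)ᴴ * (b (τ k))ᴴ) := by
      simp only [hα', hβ, oddComb, evenComb, hτ k]
      noncomm_ring
    rw [r1, r2, r3, r4, neg_add_cancel] at this
    rw [eq_neg_iff_add_eq_zero, this]
    module
  have hexp : ∀ x : ℝ, Complex.exp (2 * Complex.I * x) = Complex.exp (Complex.I * x) ^ 2 :=
    fun x => by
      rw [← Complex.exp_nat_mul]
      ring_nf
  have hneg : Complex.exp (Complex.I * ((-θ k : ℝ) : ℂ)) * Complex.exp (Complex.I * θ k) = 1 := by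
    rw [← Complex.exp_add]
    simp
  set e := Complex.exp (Complex.I * θ k) with he
  set e' := Complex.exp (Complex.I * ((-θ k : ℝ) : ℂ)) with he'
  have hcos : (Real.cos (θ k) : ℂ) = (e + e') / 2 := by
    rw [Complex.ofReal_cos, Complex.cos, he, he']
    push_cast
    ring_nf
  have hsin : Complex.I * (Real.sin (θ k) : ℂ) = (e - e') / 2 := by
    rw [Complex.ofReal_sin, Complex.sin, he, he']
    push_cast
    rw [mul_comm Complex.I (θ k : ℂ), mul_comm Complex.I (-(θ k : ℂ))]
    linear_combination ((Complex.exp (-(θ k : ℂ) * Complex.I)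
      - Complex.exp ((θ k : ℂ) * Complex.I)) / 2) * Complex.I_mul_I
  have h1 : bogoliubov b τ θ k = (e / 2) • α - (e' / 2) • β := by
    rw [bogoliubov, hcos, hsin, hα, hβ, evenComb, oddComb]
    module
  have h2 : bogoliubov b τ θ (τ k) = (e' / 2) • α' - (e / 2) • β' := by
    rw [bogoliubov, hθ, Real.cos_neg, Real.sin_neg, Complex.ofReal_neg, mul_neg, hcos, hsin, hα',
      hβ', evenComb, oddComb, hτ]
    module
  have hαadj : αᴴ = α' := by
    simp [hα, hα', evenComb, hτ k, add_comm]
  have hβadj : βᴴ = -β' := by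
    simp [hβ, hβ', oddComb, hτ k]
  have hα'adj : α'ᴴ = α := by rw [← hαadj, conjTranspose_conjTranspose]
  have hβ'adj : β'ᴴ = -β := by
    rw [← neg_neg β', ← hβadj, conjTranspose_neg, conjTranspose_conjTranspose]
  have hestar : star (e / 2) = e' / 2 := by
    rw [star_div₀, Complex.star_def, he, he', ← Complex.exp_conj, map_mul,
      Complex.conj_I, Complex.conj_ofReal, map_ofNat]
    push_cast
    ring_nf
  have he'star : star (e' / 2) = e / 2 := by rw [← hestar, star_star]
  rw [h1, h2, hexp, hexp, hθ, ← he, ← he']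
  simp only [conjTranspose_sub, conjTranspose_smul, hαadj, hβadj, hα'adj, hβ'adj, hestar, he'star,
    mul_sub, sub_mul, smul_mul_smul_comm, neg_mul, smul_neg]
  rw [hαα, hββ, hαβ, hαβ']
  have h5 : (1 : Matrix m m ℂ) = (e' * e) • 1 := by rw [hneg, one_smul]
  conv_rhs => rw [h5]
  module

/-- Reindexing by τ lets the sum be counted twice, so that each mode is accompanied by its partner;
fixed points of τ then need no separate treatment. -/
theorem IsCAR.freeEnergy_bogoliubov [Fintype ι] (hb : IsCAR b) (hτ : Function.Involutive τ)
    (hθ : ∀ k, θ (τ k) = -θ k) {ε : ι → ℝ} (hε : ∀ k, ε (τ k) = ε k) :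
    freeEnergy (bogoliubov b τ θ) ε
      = ∑ k, ((ε k : ℂ) / 2 * Complex.exp (2 * Complex.I * θ k))
          • (oddComb b τ (τ k) * evenComb b τ k)
        + ((∑ k, ε k / 2 : ℝ) : ℂ) • 1 := by
  set e : Equiv.Perm ι := hτ.toPerm
  have h1 : freeEnergy (bogoliubov b τ θ) ε = ∑ k, (ε k : ℂ) •
      ((bogoliubov b τ θ (τ k))ᴴ * bogoliubov b τ θ (τ k)) := by
    rw [freeEnergy, ← Equiv.sum_comp e]
    exact Finset.sum_congr rfl fun k _ => by simp only [e, Function.Involutive.coe_toPerm, hε]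
  have h2 : ∑ k, ((ε k : ℂ) / 2 * Complex.exp (2 * Complex.I * θ k))
          • (oddComb b τ (τ k) * evenComb b τ k)
      = ∑ k, ((ε k : ℂ) / 2 * Complex.exp (2 * Complex.I * θ (τ k)))
          • (oddComb b τ k * evenComb b τ (τ k)) := by
    rw [← Equiv.sum_comp e]
    exact Finset.sum_congr rfl fun k _ => by
      simp only [e, Function.Involutive.coe_toPerm, hε, hτ k]
  have h3 : (2 : ℂ) • freeEnergy (bogoliubov b τ θ) ε
      = (2 : ℂ) • (∑ k, ((ε k : ℂ) / 2 * Complex.exp (2 * Complex.I * θ k))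
          • (oddComb b τ (τ k) * evenComb b τ k)
        + ((∑ k, ε k / 2 : ℝ) : ℂ) • 1) := by
    rw [two_smul, smul_add, two_smul ℂ (∑ k, _)]
    nth_rw 1 [freeEnergy]
    nth_rw 2 [h2]
    rw [h1, Complex.ofReal_sum, Finset.sum_smul, Finset.smul_sum, ← Finset.sum_add_distrib,
      ← Finset.sum_add_distrib, ← Finset.sum_add_distrib]
    refine Finset.sum_congr rfl fun k _ => ?_
    rw [← smul_add, hb.number_add_number hτ hθ]
    push_cast
    module
  exact smul_right_injective _ two_ne_zero h3

end Majorana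

/-! ### Fourier transform and the quadratic Hamiltonian in momentum space -/

section Fourier

variable {N : ℕ}

/-- The momentum `2 π (k + s) / N`. -/
def modeMom (s : ℝ) (k : Fin N) : ℝ := 2 * Real.pi * ((k : ℕ) + s) / N

/-- The coefficients of the Fourier transform. -/
def fourierCoeff (s : ℝ) (k j : Fin N) : ℂ :=
  ((1 / Real.sqrt N : ℝ) : ℂ) *
    Complex.exp (-Complex.I * (modeMom s k : ℂ) * ((j : ℕ) + 1 : ℂ))

theorem fermiB_modeMom (s : ℝ) (k : Fin N) :
    fermiB N (modeMom s k) = ∑ j, fourierCoeff s k j • fermiC j := by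
  simp only [fermiB, fourierCoeff, Finset.smul_sum, smul_smul]

theorem star_fourierCoeff (s : ℝ) (k j : Fin N) :
    star (fourierCoeff s k j) = ((1 / Real.sqrt N : ℝ) : ℂ) *
      Complex.exp (Complex.I * (modeMom s k : ℂ) * ((j : ℕ) + 1 : ℂ)) := by
  rw [fourierCoeff, star_mul', Complex.star_def, Complex.conj_ofReal, ← Complex.exp_conj]
  simp

theorem inv_sqrt_mul_self :
    ((1 / Real.sqrt N : ℝ) : ℂ) * ((1 / Real.sqrt N : ℝ) : ℂ) = 1 / N := by
  rw [← Complex.ofReal_mul, div_mul_div_comm, Real.mul_self_sqrt (Nat.cast_nonneg N)]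
  simp

theorem fermiB_mulVec_allUp (q : ℝ) : fermiB N q *ᵥ allUp N = 0 := by
  simp only [fermiB, smul_mulVec, Matrix.sum_mulVec, fermiC_mulVec_allUp, smul_zero,
    Finset.sum_const_zero]

theorem fermiB_add_int_mul_two_pi (q : ℝ) (n : ℤ) :
    fermiB N (q + n * (2 * Real.pi)) = fermiB N q := by
  unfold fermiB
  congr 1
  refine Finset.sum_congr rfl fun j _ => ?_
  congr 1
  have : -Complex.I * ((q + n * (2 * Real.pi) : ℝ) : ℂ) * ((j : ℕ) + 1 : ℂ)
      = -Complex.I * (q : ℂ) * ((j : ℕ) + 1 : ℂ)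
        + ((-(n * ((j : ℕ) + 1)) : ℤ) : ℂ) * (2 * Real.pi * Complex.I) := by
    push_cast
    ring
  rw [this, Complex.exp_add, Complex.exp_int_mul_two_pi_mul_I, mul_one]

theorem majA_mul_majB (j l : Fin N) : majA j * majB l = -(majB l * majA j) := by
  have hC := isCAR_fermiC (N := N)
  have h : majA j * majB l + majB l * majA j
      = (fermiC j * (fermiC l)ᴴ + (fermiC l)ᴴ * fermiC j)
        - (fermiC l * (fermiC j)ᴴ + (fermiC j)ᴴ * fermiC l)
        - (fermiC j * fermiC l + fermiC l * fermiC j)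
        + ((fermiC j)ᴴ * (fermiC l)ᴴ + (fermiC l)ᴴ * (fermiC j)ᴴ) := by
    simp only [majA, majB]
    noncomm_ring
  rw [hC.2, hC.2, hC.1, hC.adj_mul_adj_eq_neg j l, neg_add_cancel] at h
  rw [eq_neg_iff_add_eq_zero, h]
  by_cases hjl : j = l
  · simp [hjl]
  · simp [hjl, Ne.symm hjl]

theorem fin_dvd_sub_iff (k l : Fin N) : (N : ℤ) ∣ ((l : ℕ) : ℤ) - ((k : ℕ) : ℤ) ↔ k = l := by
  constructor
  · intro h
    have hk := k.2
    have hl := l.2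
    have h1 := Int.eq_zero_of_abs_lt_dvd h (by rw [abs_lt]; omega)
    rw [Fin.ext_iff]
    lia
  · rintro rfl
    simp

variable [NeZero N]

theorem sum_exp_eq (d : ℤ) :
    ∑ k : Fin N, Complex.exp (2 * Real.pi * Complex.I * ((k : ℕ) * d / N))
      = if (N : ℤ) ∣ d then (N : ℂ) else 0 := by
  have hN : (N : ℂ) ≠ 0 := NeZero.ne _
  set ζ := Complex.exp (2 * Real.pi * Complex.I * (d / N)) with hζ
  have h1 : ∀ k : Fin N, Complex.exp (2 * Real.pi * Complex.I * ((k : ℕ) * d / N))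
      = ζ ^ (k : ℕ) := by
    intro k
    rw [hζ, ← Complex.exp_nat_mul]
    ring_nf
  have hpi : (2 * Real.pi * Complex.I : ℂ) ≠ 0 := Complex.two_pi_I_ne_zero
  have h2 : ζ = 1 ↔ (N : ℤ) ∣ d := by
    rw [hζ, Complex.exp_eq_one_iff]
    constructor
    · rintro ⟨n, hn⟩
      refine ⟨n, ?_⟩
      rw [mul_comm (n : ℂ)] at hn
      have := mul_left_cancel₀ hpi hn
      rw [div_eq_iff hN] at this
      have h3 : d = n * N := by exact_mod_cast this
      rw [h3, mul_comm]
    · rintro ⟨n, rfl⟩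
      refine ⟨n, ?_⟩
      push_cast
      field_simp
  rw [Finset.sum_congr rfl fun k _ => h1 k, Fin.sum_univ_eq_sum_range fun k => ζ ^ k]
  split_ifs with h
  · rw [h2.mpr h]
    simp
  · have h3 : ζ ^ N = 1 := by
      rw [hζ, ← Complex.exp_nat_mul, Complex.exp_eq_one_iff]
      exact ⟨d, by field_simp⟩
    rw [geom_sum_eq (fun h' => h (h2.mp h')), h3, sub_self, zero_div]

theorem fourierCoeff_orthogonal (s : ℝ) (k l : Fin N) :
    ∑ j, fourierCoeff s k j * star (fourierCoeff s l j) = if k = l then 1 else 0 := by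
  have hN : (N : ℂ) ≠ 0 := NeZero.ne _
  have h : ∀ j : Fin N, fourierCoeff s k j * star (fourierCoeff s l j)
      = (1 / N * Complex.exp (2 * Real.pi * Complex.I * (((l : ℕ) - (k : ℕ)) / N)))
        * Complex.exp (2 * Real.pi * Complex.I
            * ((j : ℕ) * (((l : ℕ) : ℤ) - ((k : ℕ) : ℤ) : ℤ) / N)) := by
    intro j
    rw [star_fourierCoeff, fourierCoeff, mul_mul_mul_comm, inv_sqrt_mul_self, mul_assoc (1 / (N : ℂ)),
      ← Complex.exp_add, ← Complex.exp_add]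
    congr 2
    rw [modeMom, modeMom]
    push_cast
    field_simp
    ring
  rw [Finset.sum_congr rfl fun j _ => h j, ← Finset.mul_sum, sum_exp_eq]
  simp only [fin_dvd_sub_iff]
  split_ifs with hkl
  · subst hkl
    simp [hN]
  · rw [mul_zero]

theorem isCAR_fermiB (s : ℝ) : IsCAR fun k : Fin N => fermiB N (modeMom s k) := by
  simp only [fermiB_modeMom]
  exact isCAR_fermiC.linearCombination _ (fourierCoeff_orthogonal s)

/-- A one-sided inverse of a square matrix is two-sided, so orthonormal rows give orthonormal
columns. -/
theorem fourierCoeff_complete (s : ℝ) (j l : Fin N) :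
    ∑ k, star (fourierCoeff s k j) * fourierCoeff s k l = if j = l then 1 else 0 := by
  let U : Matrix (Fin N) (Fin N) ℂ := Matrix.of (fourierCoeff s)
  have h : U * Uᴴ = 1 := by
    ext k l
    rw [mul_apply, one_apply, ← fourierCoeff_orthogonal s]
    rfl
  have h' : (Uᴴ * U) j l = (1 : Matrix (Fin N) (Fin N) ℂ) j l := by rw [mul_eq_one_comm.mp h]
  rw [mul_apply, one_apply] at h'
  exact h'

/-- Fourier inversion; it transfers the uniqueness of the vacuum from sites to momenta. -/
theorem fermiC_eq_sum (s : ℝ) (j : Fin N) :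
    fermiC j = ∑ k, star (fourierCoeff s k j) • fermiB N (modeMom s k) := by
  simp only [fermiB_modeMom, Finset.smul_sum, smul_smul]
  rw [Finset.sum_comm]
  simp only [← Finset.sum_smul, fourierCoeff_complete]
  simp

theorem eq_smul_allUp_of_fermiB (s : ℝ) {ψ : State N}
    (h : ∀ k : Fin N, fermiB N (modeMom s k) *ᵥ ψ = 0) : ∃ z : ℂ, ψ = z • allUp N := by
  refine eq_smul_allUp fun j => ?_
  rw [fermiC_eq_sum s]
  simp only [Matrix.sum_mulVec, smul_mulVec, h, smul_zero, Finset.sum_const_zero]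

theorem modeMom_neg (k : Fin N) :
    ∃ n : ℤ, modeMom 0 (-k) = -modeMom 0 k + n * (2 * Real.pi) := by
  have hN : (N : ℝ) ≠ 0 := NeZero.ne _
  have h : (((-k : Fin N) : ℕ) : ℤ) = (N - (k : ℕ) : ℤ) % N := by
    rw [Fin.val_neg']
    push_cast [k.2.le]
    rfl
  have h2 := Int.emod_add_mul_ediv (N - (k : ℕ) : ℤ) N
  refine ⟨1 - (N - (k : ℕ) : ℤ) / N, ?_⟩
  have h3 : (((-k : Fin N) : ℕ) : ℝ) = N - (k : ℕ) - N * (((N - (k : ℕ) : ℤ) / N : ℤ) : ℝ) := by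
    have : (((-k : Fin N) : ℕ) : ℤ) = N - (k : ℕ) - N * ((N - (k : ℕ) : ℤ) / N) := by
      rw [h]
      linarith
    exact_mod_cast this
  rw [modeMom, modeMom, h3]
  push_cast
  field_simp
  ring

theorem star_fourierCoeff_neg (k j : Fin N) :
    star (fourierCoeff 0 (-k) j) = fourierCoeff 0 k j := by
  obtain ⟨n, hn⟩ := modeMom_neg k
  rw [star_fourierCoeff, fourierCoeff, hn]
  congr 1
  have : Complex.I * ((-modeMom 0 k + n * (2 * Real.pi) : ℝ) : ℂ) * ((j : ℕ) + 1 : ℂ)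
      = -Complex.I * (modeMom 0 k : ℂ) * ((j : ℕ) + 1 : ℂ)
        + ((n * ((j : ℕ) + 1) : ℤ) : ℂ) * (2 * Real.pi * Complex.I) := by
    push_cast
    ring
  rw [this, Complex.exp_add, Complex.exp_int_mul_two_pi_mul_I, mul_one]

theorem evenComb_fermiB (k : Fin N) :
    evenComb (fun k : Fin N => fermiB N (modeMom 0 k)) (fun k => -k) k
      = ∑ j, fourierCoeff 0 k j • majA j := by
  simp only [evenComb, fermiB_modeMom, conjTranspose_sum, conjTranspose_smul,
    star_fourierCoeff_neg, majA, smul_add, Finset.sum_add_distrib]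
  rw [add_comm]

theorem oddComb_fermiB (k : Fin N) :
    oddComb (fun k : Fin N => fermiB N (modeMom 0 k)) (fun k => -k) k
      = ∑ j, fourierCoeff 0 k j • majB j := by
  simp only [oddComb, fermiB_modeMom, conjTranspose_sum, conjTranspose_smul,
    star_fourierCoeff_neg, majB, smul_sub, Finset.sum_sub_distrib]

/-- A factor e^{iqd} in momentum space selects the couplings between sites at distance `d` around
the ring. -/
theorem fourierCoeff_shift (j l : Fin N) (d : ℤ) :
    ∑ k : Fin N, Complex.exp (Complex.I * modeMom 0 k * d)
        * (fourierCoeff 0 (-k) j * fourierCoeff 0 k l)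
      = if (N : ℤ) ∣ d + (j : ℕ) - (l : ℕ) then 1 else 0 := by
  have hN : (N : ℂ) ≠ 0 := NeZero.ne _
  have h : ∀ k : Fin N, Complex.exp (Complex.I * modeMom 0 k * d)
        * (fourierCoeff 0 (-k) j * fourierCoeff 0 k l)
      = 1 / N * Complex.exp (2 * Real.pi * Complex.I
            * ((k : ℕ) * (d + (j : ℕ) - (l : ℕ) : ℤ) / N)) := by
    intro k
    rw [← star_fourierCoeff_neg (-k), neg_neg, star_fourierCoeff, fourierCoeff, mul_mul_mul_comm,
      inv_sqrt_mul_self, mul_left_comm, ← Complex.exp_add, ← Complex.exp_add]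
    congr 2
    rw [modeMom]
    push_cast
    field_simp
    ring
  rw [Finset.sum_congr rfl fun j _ => h j, ← Finset.mul_sum, sum_exp_eq]
  split_ifs
  · field_simp
  · rw [mul_zero]

theorem dvd_one_add_sub_iff (j l : Fin N) :
    (N : ℤ) ∣ 1 + ((j : ℕ) : ℤ) - ((l : ℕ) : ℤ) ↔ l = j + 1 := by
  rw [Fin.ext_iff, val_add_one_mod]
  have hl := l.2
  rw [show 1 + ((j : ℕ) : ℤ) - ((l : ℕ) : ℤ) = (((j : ℕ) + 1 : ℕ) : ℤ) - ((l : ℕ) : ℤ) by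
    push_cast; ring, ← Nat.modEq_iff_dvd]
  unfold Nat.ModEq
  rw [Nat.mod_eq_of_lt hl]

theorem sum_oddComb_mul_evenComb (g : Fin N → ℂ) :
    ∑ k : Fin N, g k • (oddComb (fun k : Fin N => fermiB N (modeMom 0 k)) (fun k => -k) (-k)
        * evenComb (fun k : Fin N => fermiB N (modeMom 0 k)) (fun k => -k) k)
      = ∑ j, ∑ l, (∑ k, g k * (fourierCoeff 0 (-k) j * fourierCoeff 0 k l))
          • (majB j * majA l) := by
  simp only [evenComb_fermiB, oddComb_fermiB, Finset.sum_mul_sum, smul_mul_smul_comm,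
    Finset.smul_sum, smul_smul, Finset.sum_smul]
  rw [Finset.sum_comm]
  exact Finset.sum_congr rfl fun j _ => Finset.sum_comm

/-- The coefficient cos φ e^{iq} comes from the bonds j → j+1 and sin φ e^{-iq} from the bonds j+1 →
j, after A_j B_{j+1} is reordered as -B_{j+1} A_j. -/
theorem fermiHamiltonian_eq (φ : ℝ) :
    fermiHamiltonian N φ = ∑ k : Fin N,
      ((Real.cos φ : ℂ) * Complex.exp (Complex.I * modeMom 0 k)
          + (Real.sin φ : ℂ) * Complex.exp (-(Complex.I * modeMom 0 k)))
        • (oddComb (fun k : Fin N => fermiB N (modeMom 0 k)) (fun k => -k) (-k)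
          * evenComb (fun k : Fin N => fermiB N (modeMom 0 k)) (fun k => -k) k) := by
  rw [sum_oddComb_mul_evenComb]
  have h : ∀ j l : Fin N, ∑ k : Fin N,
      ((Real.cos φ : ℂ) * Complex.exp (Complex.I * modeMom 0 k)
          + (Real.sin φ : ℂ) * Complex.exp (-(Complex.I * modeMom 0 k)))
        * (fourierCoeff 0 (-k) j * fourierCoeff 0 k l)
      = (Real.cos φ : ℂ) * (if l = j + 1 then 1 else 0)
        + (Real.sin φ : ℂ) * (if j = l + 1 then 1 else 0) := by
    intro j l
    have h1 := fourierCoeff_shift j l 1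
    have h2 := fourierCoeff_shift j l (-1)
    have h3 : (N : ℤ) ∣ -1 + ((j : ℕ) : ℤ) - ((l : ℕ) : ℤ) ↔ j = l + 1 := by
      rw [← dvd_one_add_sub_iff, ← dvd_neg]
      ring_nf
    simp only [dvd_one_add_sub_iff, h3, Int.cast_one, mul_one, Int.cast_neg, mul_neg] at h1 h2
    rw [← h1, ← h2, Finset.mul_sum, Finset.mul_sum, ← Finset.sum_add_distrib]
    exact Finset.sum_congr rfl fun k _ => by ring
  simp only [h, add_smul, Finset.sum_add_distrib, mul_ite, mul_one, mul_zero, ite_smul, zero_smul]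
  rw [Finset.sum_comm (f := fun j l => if j = l + 1 then (Real.sin φ : ℂ) • (majB j * majA l)
    else 0)]
  simp only [Finset.sum_ite_eq', Finset.mem_univ, if_true, fermiHamiltonian, majA_mul_majB,
    smul_neg, sub_neg_eq_add, Finset.sum_add_distrib]

end Fourier

/-! ### The dispersion relation and the Bogoliubov angle -/

section Trigonometry

/-- The product of the two quantities is cos 2φ > 0, and cos φ > 0 fixes the signs. -/
theorem cos_add_sin_pos {φ : ℝ} (hφ : φ ∈ Set.Ioo (-(Real.pi / 4)) (Real.pi / 4)) :
    0 < Real.cos φ + Real.sin φ ∧ 0 < Real.cos φ - Real.sin φ := by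
  have hc : 0 < Real.cos φ :=
    Real.cos_pos_of_mem_Ioo ⟨by linarith [hφ.1, Real.pi_pos], by linarith [hφ.2, Real.pi_pos]⟩
  have h2 : 0 < Real.cos (2 * φ) :=
    Real.cos_pos_of_mem_Ioo ⟨by linarith [hφ.1], by linarith [hφ.2]⟩
  rw [Real.cos_two_mul'] at h2
  have h := abs_lt.mp (abs_lt_of_sq_lt_sq (by linarith : Real.sin φ ^ 2 < Real.cos φ ^ 2) hc.le)
  exact ⟨by linarith [h.1], by linarith [h.2]⟩

theorem sin_ne_zero_of_lt_two_pi {q : ℝ} (h0 : 0 < q) (h1 : q < 2 * Real.pi)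
    (h2 : q ≠ Real.pi) : Real.sin q ≠ 0 := by
  rcases lt_or_gt_of_ne h2 with h | h
  · exact (Real.sin_pos_of_pos_of_lt_pi h0 h).ne'
  · have h3 := Real.sin_neg_of_neg_of_neg_pi_lt (x := q - 2 * Real.pi) (by linarith) (by linarith)
    rw [Real.sin_sub_two_pi] at h3
    exact h3.ne

/-- The momentum enters only through cos 2q, and the sign of sin 2φ decides which extreme of cos 2q
is energetically favourable. -/
theorem norm_sq_symbol (φ q : ℝ) :
    ‖(Real.sin φ : ℂ) + (Real.cos φ : ℂ) * Complex.exp (Complex.I * 2 * (q : ℂ))‖ ^ 2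
      = 1 + Real.sin (2 * φ) * Real.cos (2 * q) := by
  have h : Complex.exp (Complex.I * 2 * (q : ℂ))
      = (Real.cos (2 * q) : ℂ) + (Real.sin (2 * q) : ℂ) * Complex.I := by
    rw [Complex.ofReal_cos, Complex.ofReal_sin, ← Complex.exp_mul_I]
    push_cast
    ring_nf
  rw [h, ← Complex.normSq_eq_norm_sq, Complex.normSq_apply]
  simp only [Complex.add_re, Complex.add_im, Complex.mul_re, Complex.mul_im, Complex.ofReal_re,
    Complex.ofReal_im, Complex.I_re, Complex.I_im]
  rw [Real.sin_two_mul φ]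
  linear_combination Real.sin_sq_add_cos_sq φ
    + Real.cos φ ^ 2 * Real.sin_sq_add_cos_sq (2 * q)

theorem norm_sq_symbol' (φ q : ℝ) :
    ‖(Real.sin φ : ℂ) + (Real.cos φ : ℂ) * Complex.exp (Complex.I * 2 * (q : ℂ))‖ ^ 2
      = ((Real.sin φ + Real.cos φ) * Real.cos q) ^ 2
        + ((Real.cos φ - Real.sin φ) * Real.sin q) ^ 2 := by
  rw [norm_sq_symbol, Real.sin_two_mul, Real.cos_two_mul']
  linear_combination -(Real.sin_sq_add_cos_sq q)
    - (Real.sin q ^ 2 + Real.cos q ^ 2) * Real.sin_sq_add_cos_sq φ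

theorem norm_symbol_congr {φ q q' : ℝ} (h : Real.cos (2 * q) = Real.cos (2 * q')) :
    ‖(Real.sin φ : ℂ) + (Real.cos φ : ℂ) * Complex.exp (Complex.I * 2 * (q : ℂ))‖
      = ‖(Real.sin φ : ℂ) + (Real.cos φ : ℂ) * Complex.exp (Complex.I * 2 * (q' : ℂ))‖ := by
  rw [← sq_eq_sq₀ (norm_nonneg _) (norm_nonneg _), norm_sq_symbol, norm_sq_symbol, h]

theorem cos_two_mul_add_int (q : ℝ) (n : ℤ) :
    Real.cos (2 * (q + n * (2 * Real.pi))) = Real.cos (2 * q) := by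
  rw [show 2 * (q + n * (2 * Real.pi)) = 2 * q + (2 * n : ℤ) * (2 * Real.pi) by push_cast; ring,
    Real.cos_add_int_mul_two_pi]

theorem bogAngle_add_int_mul_two_pi (φ q : ℝ) (n : ℤ) :
    bogAngle φ (q + n * (2 * Real.pi)) = bogAngle φ q := by
  rw [bogAngle, norm_symbol_congr (cos_two_mul_add_int q n), Real.cos_add_int_mul_two_pi,
    Real.sin_add_int_mul_two_pi, bogAngle]

theorem bogAngle_neg (φ q : ℝ) : bogAngle φ (-q) = -bogAngle φ q := by
  rw [bogAngle, norm_symbol_congr (q := -q) (q' := q) (by rw [mul_neg, Real.cos_neg]),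
    Real.cos_neg, Real.sin_neg, mul_neg, div_neg, Real.arctan_neg, bogAngle]

/-- The Bogoliubov angle, extended by `0` to the momenta `0` and `π`. -/
def modeAngle (φ q : ℝ) : ℝ := if q = 0 ∨ q = Real.pi then 0 else bogAngle φ q

theorem bogA_eq (N : ℕ) (φ q : ℝ) :
    bogA N φ q = (Real.cos (modeAngle φ q) : ℂ) • fermiB N q
      + (Complex.I * (Real.sin (modeAngle φ q) : ℂ)) • (fermiB N (-q))ᴴ := by
  unfold bogA modeAngle
  split_ifs <;> simp

theorem cos_modeAngle_pos (φ q : ℝ) : 0 < Real.cos (modeAngle φ q) := by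
  unfold modeAngle
  split_ifs
  · simp
  · exact Real.cos_arctan_pos _

/-- The right-hand side is x + iy with x = (sin φ + cos φ) cos q and y = (cos φ - sin φ) sin q, of
modulus r. The half-angle formula tan(arg/2) = (r - x)/y shows that θ_q is half its argument. -/
theorem norm_symbol_mul_exp {φ q : ℝ} (hφ : φ ∈ Set.Ioo (-(Real.pi / 4)) (Real.pi / 4))
    (hq : Real.sin q ≠ 0) :
    (‖(Real.sin φ : ℂ) + (Real.cos φ : ℂ) * Complex.exp (Complex.I * 2 * (q : ℂ))‖ : ℂ)
        * Complex.exp (2 * Complex.I * bogAngle φ q)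
      = (Real.cos φ : ℂ) * Complex.exp (Complex.I * q)
        + (Real.sin φ : ℂ) * Complex.exp (-(Complex.I * q)) := by
  have hr2 := norm_sq_symbol' φ q
  unfold bogAngle
  set r := ‖(Real.sin φ : ℂ) + (Real.cos φ : ℂ) * Complex.exp (Complex.I * 2 * (q : ℂ))‖
  set x := (Real.sin φ + Real.cos φ) * Real.cos q with hx
  set y := (Real.cos φ - Real.sin φ) * Real.sin q with hy
  have hy0 : y ≠ 0 := mul_ne_zero (cos_add_sin_pos hφ).2.ne' hq
  have hr0 : r ≠ 0 := by
    intro h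
    rw [h] at hr2
    have := pow_pos (abs_pos.mpr hy0) 2
    rw [sq_abs] at this
    nlinarith [sq_nonneg x]
  have hrx : r - x ≠ 0 := by
    intro h
    have : r = x := by linarith
    rw [this] at hr2
    exact hy0 (pow_eq_zero_iff two_ne_zero |>.mp (by linarith))
  set t := (r - x) / y with ht
  have hty : t * y = r - x := div_mul_cancel₀ _ hy0
  have h1 : r * (1 + t ^ 2)⁻¹ * (2 * t) = y := by
    have h2 : (1 + t ^ 2) * y = 2 * t * r := by
      apply mul_right_cancel₀ hy0
      linear_combination (t * y - r - x) * hty - hr2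
    have h3 : 1 + t ^ 2 ≠ 0 := by positivity
    field_simp
    linear_combination -h2
  have h1' : r * (2 * (1 + t ^ 2)⁻¹ - 1) = x := by
    have h3 : 1 + t ^ 2 ≠ 0 := by positivity
    have h4 : 2 * r = (1 + t ^ 2) * (r + x) := by
      apply mul_right_cancel₀ hrx
      have h2 : (1 + t ^ 2) * y = 2 * t * r := by
        apply mul_right_cancel₀ hy0
        linear_combination (t * y - r - x) * hty - hr2
      linear_combination (-2 * r) * hty - y * h2 - (1 + t ^ 2) * hr2
    field_simp
    linear_combination h4
  have hcos : r * Real.cos (2 * Real.arctan t) = x := by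
    rw [Real.cos_two_mul, Real.cos_sq_arctan, ← h1', one_div]
  have hsin : r * Real.sin (2 * Real.arctan t) = y := by
    have h : Real.sin (Real.arctan t) = t * Real.cos (Real.arctan t) := by
      conv_rhs => rw [← Real.tan_arctan t, Real.arctan_tan (Real.neg_pi_div_two_lt_arctan t)
        (Real.arctan_lt_pi_div_two t)]
      rw [Real.tan_mul_cos (Real.cos_arctan_pos t).ne']
    rw [Real.sin_two_mul, h]
    have h5 := Real.cos_sq_arctan t
    rw [one_div] at h5
    linear_combination h1 + 2 * r * t * h5
  have he : Complex.exp (2 * Complex.I * (Real.arctan t : ℂ))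
      = (Real.cos (2 * Real.arctan t) : ℂ) + (Real.sin (2 * Real.arctan t) : ℂ) * Complex.I := by
    rw [Complex.ofReal_cos, Complex.ofReal_sin, ← Complex.exp_mul_I]
    push_cast
    ring_nf
  have he1 : Complex.exp (Complex.I * q)
      = (Real.cos q : ℂ) + (Real.sin q : ℂ) * Complex.I := by
    rw [Complex.ofReal_cos, Complex.ofReal_sin, ← Complex.exp_mul_I, mul_comm]
  have he2 : Complex.exp (-(Complex.I * q))
      = (Real.cos q : ℂ) - (Real.sin q : ℂ) * Complex.I := by
    have := Complex.exp_mul_I ((-q : ℝ) : ℂ)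
    rw [← Complex.ofReal_cos, ← Complex.ofReal_sin, Real.cos_neg, Real.sin_neg] at this
    rw [show -(Complex.I * q) = ((-q : ℝ) : ℂ) * Complex.I by push_cast; ring, this]
    push_cast
    ring
  rw [he, he1, he2]
  have hcos' : (r : ℂ) * (Real.cos (2 * Real.arctan t) : ℂ) = x := by exact_mod_cast hcos
  have hsin' : (r : ℂ) * (Real.sin (2 * Real.arctan t) : ℂ) = y := by exact_mod_cast hsin
  rw [hx] at hcos'
  rw [hy] at hsin'
  rw [Complex.ofReal_mul, Complex.ofReal_add] at hcos'
  rw [Complex.ofReal_mul, Complex.ofReal_sub] at hsin'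
  linear_combination hcos' + Complex.I * hsin'

/-- At 0 and π the norm equals |cos φ + sin φ|, so apart from the sign at π the special values in
the definition agree with the general formula. -/
theorem abs_dispersion {φ : ℝ} (hφ : φ ∈ Set.Ioo (-(Real.pi / 4)) (Real.pi / 4)) (q : ℝ) :
    |dispersion φ q|
      = 2 * ‖(Real.sin φ : ℂ) + (Real.cos φ : ℂ) * Complex.exp (Complex.I * 2 * (q : ℂ))‖ := by
  have hpos := (cos_add_sin_pos hφ).1
  have h : ∀ q : ℝ, Real.cos (2 * q) = 1 →
      ‖(Real.sin φ : ℂ) + (Real.cos φ : ℂ) * Complex.exp (Complex.I * 2 * (q : ℂ))‖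
        = Real.cos φ + Real.sin φ := by
    intro q hq
    rw [← sq_eq_sq₀ (norm_nonneg _) hpos.le, norm_sq_symbol, hq, Real.sin_two_mul]
    linear_combination -Real.sin_sq_add_cos_sq φ
  unfold dispersion
  split_ifs with h0 h1
  · rw [h q (by simp [h0]), abs_of_pos (by linarith)]
  · rw [h q (by simp [h1]), abs_neg, abs_of_pos (by linarith)]
  · rw [abs_of_nonneg (by positivity), add_comm]

theorem dispersion_eq {φ q : ℝ} (hφ : φ ∈ Set.Ioo (-(Real.pi / 4)) (Real.pi / 4))
    (hq : q ≠ Real.pi) :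
    dispersion φ q
      = 2 * ‖(Real.sin φ : ℂ) + (Real.cos φ : ℂ) * Complex.exp (Complex.I * 2 * (q : ℂ))‖ := by
  rw [← abs_dispersion hφ, abs_of_nonneg]
  unfold dispersion
  rw [if_neg hq]
  split_ifs
  · linarith [(cos_add_sin_pos hφ).1]
  · positivity

theorem norm_symbol_lt {φ q q' : ℝ}
    (h : Real.sin (2 * φ) * Real.cos (2 * q) < Real.sin (2 * φ) * Real.cos (2 * q')) :
    ‖(Real.sin φ : ℂ) + (Real.cos φ : ℂ) * Complex.exp (Complex.I * 2 * (q : ℂ))‖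
      < ‖(Real.sin φ : ℂ) + (Real.cos φ : ℂ) * Complex.exp (Complex.I * 2 * (q' : ℂ))‖ := by
  refine lt_of_pow_lt_pow_left₀ 2 (norm_nonneg _) ?_
  rw [norm_sq_symbol, norm_sq_symbol]
  linarith

theorem setOf_isMinOn_eq {Γ S : Set ℝ} {f : ℝ → ℝ} {m : ℝ} (hS : S ⊆ Γ) (hne : S.Nonempty)
    (h1 : ∀ q ∈ S, f q = m) (h2 : ∀ q ∈ Γ, q ∉ S → m < f q) :
    {q ∈ Γ | IsMinOn f Γ q} = S := by
  ext q
  constructor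
  · rintro ⟨hq, hmin⟩
    by_contra hqS
    obtain ⟨p, hp⟩ := hne
    have := isMinOn_iff.mp hmin p (hS hp)
    linarith [h1 p hp, h2 q hq hqS]
  · intro hq
    refine ⟨hS hq, isMinOn_iff.mpr fun p hp => ?_⟩
    by_cases hpS : p ∈ S
    · rw [h1 q hq, h1 p hpS]
    · rw [h1 q hq]
      exact (h2 p hp hpS).le

/-- For odd m with |m| ≤ N, the values ±1 are nearest to 0 and cosine decreases in |m|; the
remaining range is reflected by m ↦ 2N - m. Doubled momenta take the form π + πm/N with such m. -/
theorem cos_pi_mul_odd_lt {N : ℕ} {m : ℤ} (hN : 0 < N) (hm : Odd m) (h1 : -(N : ℤ) ≤ m)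
    (h2 : m ≤ 3 * N) (h3 : m ≠ 1) (h4 : m ≠ -1) (h5 : m ≠ 2 * N - 1) (h6 : m ≠ 2 * N + 1) :
    Real.cos (Real.pi * m / N) < Real.cos (Real.pi * 1 / N) := by
  have hN' : (0 : ℝ) < N := by exact_mod_cast hN
  have key : ∀ m : ℤ, 1 < |m| → |m| ≤ N →
      Real.cos (Real.pi * m / N) < Real.cos (Real.pi * 1 / N) := by
    intro m hm1 hm2
    have h1' : (1 : ℝ) < |(m : ℝ)| := by exact_mod_cast hm1
    have h2' : |(m : ℝ)| ≤ N := by exact_mod_cast hm2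
    rw [← Real.cos_abs (Real.pi * m / N), abs_div, abs_mul, abs_of_pos Real.pi_pos,
      abs_of_pos hN']
    have hp := Real.pi_pos
    refine Real.strictAntiOn_cos ⟨by positivity, ?_⟩ ⟨by positivity, ?_⟩ ?_
    · rw [div_le_iff₀ hN']
      nlinarith
    · rw [div_le_iff₀ hN']
      nlinarith
    · gcongr
  by_cases h : m ≤ N
  · refine key m ?_ (abs_le.mpr ⟨h1, h⟩)
    obtain ⟨n, rfl⟩ := hm
    rw [lt_abs]
    omega
  · have h' := key (2 * N - m) ?_ (abs_le.mpr ⟨by omega, by omega⟩)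
    · rwa [show Real.pi * ((2 * N - m : ℤ) : ℝ) / N = 2 * Real.pi - Real.pi * m / N by
        push_cast; field_simp, Real.cos_two_pi_sub] at h'
    · obtain ⟨n, rfl⟩ := hm
      rw [lt_abs]
      omega

end Trigonometry

/-! ### Labels of momenta, the pairing q ↔ -q, and the diagonalised Hamiltonian -/

section Modes

variable {N : ℕ} {s : ℝ}

theorem modeMom_nonneg (hs : 0 ≤ s) (k : Fin N) : 0 ≤ modeMom s k := by
  unfold modeMom
  positivity

/-- The map `τ` sends the label of a momentum `q` to the label of `-q`. -/
def IsPairing (s : ℝ) (τ : Fin N → Fin N) : Prop :=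
  ∀ k, ∃ n : ℤ, modeMom s (τ k) = -modeMom s k + n * (2 * Real.pi)

theorem IsPairing.fermiB_neg {τ : Fin N → Fin N} (hτ : IsPairing s τ) (k : Fin N) :
    fermiB N (-modeMom s k) = fermiB N (modeMom s (τ k)) := by
  obtain ⟨n, hn⟩ := hτ k
  rw [hn, fermiB_add_int_mul_two_pi]

theorem IsPairing.bogA_eq_bogoliubov {τ : Fin N → Fin N} (hτ : IsPairing s τ) (φ : ℝ) (k : Fin N) :
    bogA N φ (modeMom s k) = bogoliubov (fun k : Fin N => fermiB N (modeMom s k)) τ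
      (fun k => modeAngle φ (modeMom s k)) k := by
  rw [bogA_eq, bogoliubov, hτ.fermiB_neg]

/-- The label of a momentum in the open interval from `0` to `π`. -/
def InUpperHalf (s : ℝ) (k : Fin N) : Prop := 0 < modeMom s k ∧ modeMom s k < Real.pi

instance {N : ℕ} (s : ℝ) : DecidablePred (InUpperHalf (N := N) s) := fun _ => Classical.propDecidable _

theorem IsPairing.pairFactor_eq_pairOp {τ : Fin N → Fin N} (hτ : IsPairing s τ) (φ : ℝ) (k : Fin N) :
    pairFactor N φ (modeMom s k) = pairOp (fun k : Fin N => fermiB N (modeMom s k)) τ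
      (fun k => modeAngle φ (modeMom s k)) (InUpperHalf s) k := by
  unfold pairFactor pairOp
  by_cases h : 0 < modeMom s k ∧ modeMom s k < Real.pi
  · have h' : InUpperHalf s k := h
    have ha : modeAngle φ (modeMom s k) = bogAngle φ (modeMom s k) :=
      if_neg (not_or.mpr ⟨h.1.ne', h.2.ne⟩)
    rw [if_pos h, if_pos h', hτ.fermiB_neg, ← ha]
  · have h' : ¬ InUpperHalf s k := h
    rw [if_neg h, if_neg h']

variable [NeZero N]

theorem modeMom_lt (hs : s < 1) (k : Fin N) : modeMom s k < 2 * Real.pi := by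
  have hN : (0 : ℝ) < N := by exact_mod_cast NeZero.pos N
  have hk : ((k : ℕ) : ℝ) + 1 ≤ N := by exact_mod_cast k.2
  unfold modeMom
  rw [div_lt_iff₀ hN]
  have := Real.pi_pos
  gcongr
  linarith

theorem modeMom_injective : Function.Injective (modeMom s : Fin N → ℝ) := by
  intro k l h
  have hN : (N : ℝ) ≠ 0 := NeZero.ne _
  have hp := Real.pi_ne_zero
  unfold modeMom at h
  field_simp at h
  have h' : ((k : ℕ) : ℝ) = (l : ℕ) := by linarith
  exact Fin.ext (by exact_mod_cast h')

theorem isPairing_neg : IsPairing (N := N) 0 fun k => -k := modeMom_neg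

theorem isPairing_rev : IsPairing (N := N) (1 / 2) Fin.rev := by
  intro k
  refine ⟨1, ?_⟩
  have hN : (N : ℝ) ≠ 0 := NeZero.ne _
  have h : ((Fin.rev k : ℕ) : ℝ) = N - ((k : ℕ) + 1) := by
    rw [Fin.val_rev, Nat.cast_sub k.2]
    push_cast
    ring
  rw [modeMom, modeMom, h]
  push_cast
  field_simp
  ring

theorem modeMom_pos_label (k : Fin N) (hk : k ≠ 0) : 0 < modeMom 0 k := by
  have h : 0 < (k : ℕ) := Nat.pos_of_ne_zero fun h => hk (Fin.ext (by simpa using h))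
  have hN : 0 < N := NeZero.pos N
  have := Real.pi_pos
  unfold modeMom
  positivity

variable {τ : Fin N → Fin N}

/-- Both representatives lie in [0, 2π), so only the multiples 0 and 2π can occur. -/
theorem IsPairing.cases (hτ : IsPairing s τ) (h0 : 0 ≤ s) (h1 : s < 1) (k : Fin N) :
    (modeMom s k = 0 ∧ modeMom s (τ k) = 0) ∨
      (0 < modeMom s k ∧ modeMom s (τ k) = 2 * Real.pi - modeMom s k) := by
  obtain ⟨n, hn⟩ := hτ k
  have a1 := modeMom_nonneg h0 k
  have a2 := modeMom_nonneg h0 (τ k)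
  have a3 := modeMom_lt h1 k
  have a4 := modeMom_lt h1 (τ k)
  have hp := Real.pi_pos
  have b1 : -1 < n := by
    have : (-1 : ℝ) < n := by nlinarith
    exact_mod_cast this
  have b2 : n < 2 := by
    have : (n : ℝ) < 2 := by nlinarith
    exact_mod_cast this
  obtain rfl | rfl : n = 0 ∨ n = 1 := by omega
  · left
    push_cast at hn
    constructor <;> linarith
  · right
    push_cast at hn
    constructor <;> linarith

theorem IsPairing.involutive (hτ : IsPairing s τ) (h0 : 0 ≤ s) (h1 : s < 1) :
    Function.Involutive τ := by
  intro k
  apply modeMom_injective (s := s)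
  rcases hτ.cases h0 h1 k with ⟨a, b⟩ | ⟨a, b⟩ <;>
    rcases hτ.cases h0 h1 (τ k) with ⟨c, d⟩ | ⟨c, d⟩
  · rw [d, a]
  · linarith
  · have := modeMom_lt h1 k
    linarith
  · rw [d, b]
    ring

theorem IsPairing.modeAngle_partner (hτ : IsPairing s τ) (h0 : 0 ≤ s) (h1 : s < 1) (φ : ℝ) (k : Fin N) :
    modeAngle φ (modeMom s (τ k)) = -modeAngle φ (modeMom s k) := by
  have h2 := modeMom_lt h1 k
  rcases hτ.cases h0 h1 k with ⟨a, b⟩ | ⟨a, b⟩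
  · simp [modeAngle, a, b]
  · rw [b]
    by_cases hp : modeMom s k = Real.pi
    · have : 2 * Real.pi - Real.pi = Real.pi := by ring
      simp [modeAngle, hp, this]
    · rw [modeAngle, modeAngle, if_neg, if_neg, ← bogAngle_neg,
        ← bogAngle_add_int_mul_two_pi φ (-modeMom s k) 1]
      · congr 1
        push_cast
        ring
      · exact not_or.mpr ⟨a.ne', hp⟩
      · refine not_or.mpr ⟨by linarith, fun h => hp (by linarith)⟩

theorem IsPairing.of_inUpperHalf (hτ : IsPairing s τ) (h0 : 0 ≤ s) (h1 : s < 1) (k : Fin N)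
    (hk : InUpperHalf s k) : τ k ≠ k ∧ ¬ InUpperHalf s (τ k) := by
  rcases hτ.cases h0 h1 k with ⟨a, b⟩ | ⟨a, b⟩
  · exact absurd a hk.1.ne'
  · constructor
    · intro h
      rw [h] at b
      linarith [hk.2]
    · intro h
      linarith [hk.2, h.2]

theorem IsPairing.inUpperHalf_or (hτ : IsPairing s τ) (h0 : 0 ≤ s) (h1 : s < 1) (k : Fin N)
    (hk : τ k ≠ k) : InUpperHalf s k ∨ InUpperHalf s (τ k) := by
  have h2 := modeMom_lt h1 k
  rcases hτ.cases h0 h1 k with ⟨a, b⟩ | ⟨a, b⟩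
  · exact absurd (modeMom_injective (b.trans a.symm)) hk
  · rcases lt_trichotomy (modeMom s k) Real.pi with h | h | h
    · exact Or.inl ⟨a, h⟩
    · refine absurd (modeMom_injective (s := s) ?_) hk
      rw [b, h]
      ring
    · exact Or.inr ⟨by linarith, by linarith⟩

/-- The Bogoliubov vacuum for the momenta with shift `s`. -/
def vacuum (N : ℕ) [NeZero N] (s φ : ℝ) : State N :=
  ((List.finRange N).map fun k => pairFactor N φ (modeMom s k)).prod *ᵥ allUp N

theorem vacMinus_eq (φ : ℝ) : vacMinus N φ = vacuum N 0 φ := by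
  rw [vacMinus, vacuum, ← List.map_coe_finRange_eq_range, List.map_map]
  congr 3
  funext k
  simp [momMinus, modeMom]

theorem vacPlus_eq (φ : ℝ) : vacPlus N φ = vacuum N (1 / 2) φ := by
  rw [vacPlus, vacuum, ← List.map_coe_finRange_eq_range, List.map_map]
  rfl

theorem IsPairing.vacuum_eq (hτ : IsPairing s τ) (φ : ℝ) :
    vacuum N s φ = ((List.finRange N).map (pairOp (fun k : Fin N => fermiB N (modeMom s k)) τ
      (fun k => modeAngle φ (modeMom s k)) (InUpperHalf s))).prod *ᵥ allUp N := by
  rw [vacuum]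
  congr 3
  funext k
  exact hτ.pairFactor_eq_pairOp φ k

theorem IsPairing.bogA_mulVec_vacuum (hτ : IsPairing s τ) (h0 : 0 ≤ s) (h1 : s < 1) (φ : ℝ)
    (k : Fin N) : bogA N φ (modeMom s k) *ᵥ vacuum N s φ = 0 := by
  rw [hτ.vacuum_eq, hτ.bogA_eq_bogoliubov]
  exact (isCAR_fermiB s).bogoliubov_mulVec_vacuum (hτ.involutive h0 h1) (hτ.modeAngle_partner h0 h1 φ)
    (hτ.of_inUpperHalf h0 h1) (hτ.inUpperHalf_or h0 h1) (List.nodup_finRange N)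
    List.mem_finRange (fun k => fermiB_mulVec_allUp _) k

theorem IsPairing.star_vacuum_dotProduct (hτ : IsPairing s τ) (h0 : 0 ≤ s) (h1 : s < 1) (φ : ℝ) :
    star (vacuum N s φ) ⬝ᵥ vacuum N s φ = 1 := by
  rw [hτ.vacuum_eq, (isCAR_fermiB s).star_vacuum_dotProduct (hτ.involutive h0 h1)
    (hτ.of_inUpperHalf h0 h1) (List.nodup_finRange N) (fun k => fermiB_mulVec_allUp _),
    star_allUp_dotProduct]

theorem IsPairing.eq_smul_vacuum (hτ : IsPairing s τ) (h0 : 0 ≤ s) (h1 : s < 1) (φ : ℝ)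
    {ψ : State N} (hψ : ∀ k : Fin N, bogA N φ (modeMom s k) *ᵥ ψ = 0) :
    ∃ z : ℂ, ψ = z • vacuum N s φ := by
  rw [hτ.vacuum_eq]
  simp only [hτ.bogA_eq_bogoliubov] at hψ
  exact (isCAR_fermiB s).eq_smul_vacuum (hτ.involutive h0 h1) (hτ.modeAngle_partner h0 h1 φ)
    (hτ.of_inUpperHalf h0 h1) (hτ.inUpperHalf_or h0 h1) (List.nodup_finRange N)
    List.mem_finRange (fun k => (cos_modeAngle_pos _ _).ne')
    (fun ψ => eq_smul_allUp_of_fermiB s) hψ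

theorem IsPairing.isCAR_bogA (hτ : IsPairing s τ) (h0 : 0 ≤ s) (h1 : s < 1) (φ : ℝ) :
    IsCAR fun k : Fin N => bogA N φ (modeMom s k) := by
  simp only [hτ.bogA_eq_bogoliubov]
  exact (isCAR_fermiB s).isCAR_bogoliubov (hτ.involutive h0 h1) (hτ.modeAngle_partner h0 h1 φ)

theorem modeMom_ne_pi (hN : Odd N) (k : Fin N) : modeMom 0 k ≠ Real.pi := by
  intro h
  have hN0 : (N : ℝ) ≠ 0 := NeZero.ne _
  rw [modeMom, div_eq_iff hN0, add_zero, mul_comm 2, mul_assoc] at h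
  have h' := mul_left_cancel₀ Real.pi_ne_zero h
  have h2 : 2 * (k : ℕ) = N := by exact_mod_cast h'
  obtain ⟨n, hn⟩ := hN
  omega

/-- Oddness of N keeps π out of Γ⁻. This matters because ε(π) = -ε(0) is negative; on the remaining
momenta ε is twice the norm. -/
theorem fermiHamiltonian_eq_freeEnergy (hN : Odd N) {φ : ℝ}
    (hφ : φ ∈ Set.Ioo (-(Real.pi / 4)) (Real.pi / 4)) :
    fermiHamiltonian N φ = freeEnergy (fun k : Fin N => bogA N φ (modeMom 0 k))
        (fun k => dispersion φ (modeMom 0 k))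
      - ((∑ k : Fin N, dispersion φ (modeMom 0 k) / 2 : ℝ) : ℂ) • 1 := by
  have hτ := isPairing_neg (N := N)
  have hε : ∀ k : Fin N, dispersion φ (modeMom 0 (-k)) = dispersion φ (modeMom 0 k) := by
    intro k
    rw [dispersion_eq hφ (modeMom_ne_pi hN _), dispersion_eq hφ (modeMom_ne_pi hN _)]
    congr 1
    apply norm_symbol_congr
    obtain ⟨n, hn⟩ := modeMom_neg k
    rw [hn, cos_two_mul_add_int, mul_neg, Real.cos_neg]
  simp only [hτ.bogA_eq_bogoliubov]
  rw [(isCAR_fermiB 0).freeEnergy_bogoliubov (hτ.involutive le_rfl one_pos)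
    (hτ.modeAngle_partner le_rfl one_pos φ) hε, add_sub_cancel_right, fermiHamiltonian_eq]
  refine Finset.sum_congr rfl fun k _ => ?_
  congr 1
  -- At q = 0 the angle is 0 and both coefficients are cos φ + sin φ; elsewhere
  -- `norm_symbol_mul_exp` identifies them.
  by_cases hk : modeMom 0 k = 0
  · rw [hk]
    simp [modeAngle, dispersion]
  · have h1 : 0 < modeMom 0 k := lt_of_le_of_ne (modeMom_nonneg le_rfl k) (Ne.symm hk)
    have h2 := modeMom_ne_pi hN k
    have hs := sin_ne_zero_of_lt_two_pi h1 (modeMom_lt one_pos k) h2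
    rw [← norm_symbol_mul_exp hφ hs, dispersion_eq hφ h2, modeAngle, if_neg (not_or.mpr ⟨hk, h2⟩)]
    push_cast
    ring

end Modes

/-! ### Action of the parities on modes, vacua and particle states -/

section Parity

variable {N : ℕ}

/-- The sign (-1)^j from the string is absorbed as a momentum shift by π. The site label is j + 1
and not j, which leaves the overall minus sign. -/
theorem parityX_conj_fermiB (q : ℝ) :
    parityX N * fermiB N q * parityX N = -(fermiB N (Real.pi - q))ᴴ := by
  have hc : star ((1 / Real.sqrt N : ℝ) : ℂ) = ((1 / Real.sqrt N : ℝ) : ℂ) :=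
    Complex.conj_ofReal _
  simp only [fermiB, conjTranspose_smul, conjTranspose_sum, mul_smul_comm, smul_mul_assoc,
    Finset.mul_sum, Finset.sum_mul, parityX_conj_fermiC, smul_smul, hc]
  rw [← smul_neg, ← Finset.sum_neg_distrib]
  congr 1
  refine Finset.sum_congr rfl fun j _ => ?_
  rw [← neg_smul]
  congr 1
  rw [Complex.star_def, ← Complex.exp_conj]
  have h : (starRingEnd ℂ) (-Complex.I * ((Real.pi - q : ℝ) : ℂ) * ((j : ℕ) + 1 : ℂ))
      = ((((j : ℕ) + 1 : ℕ) : ℂ)) * (Real.pi * Complex.I)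
        + -Complex.I * (q : ℂ) * ((j : ℕ) + 1 : ℂ) := by
    simp only [map_mul, map_neg, Complex.conj_I, Complex.conj_ofReal, map_add, map_natCast, map_one]
    push_cast
    ring
  rw [h, Complex.exp_add, Complex.exp_nat_mul, Complex.exp_pi_mul_I, pow_succ]
  ring

theorem parityX_conj_conjTranspose (A : Op N) :
    parityX N * Aᴴ * parityX N = (parityX N * A * parityX N)ᴴ := by
  rw [conjTranspose_mul, conjTranspose_mul, parityX_conjTranspose, mul_assoc]

theorem parityX_mulVec_mulVec (A : Op N) (ψ : State N) :
    parityX N *ᵥ (A *ᵥ ψ) = (parityX N * A * parityX N) *ᵥ (parityX N *ᵥ ψ) := by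
  rw [mulVec_mulVec, mulVec_mulVec, mul_assoc, parityX_mul_self, mul_one]

theorem parityX_mulVec_self (ψ : State N) : parityX N *ᵥ (parityX N *ᵥ ψ) = ψ := by
  rw [mulVec_mulVec, parityX_mul_self, one_mulVec]

theorem mulVec_parityX_mulVec (A : Op N) (ψ : State N) :
    A *ᵥ (parityX N *ᵥ ψ) = parityX N *ᵥ ((parityX N * A * parityX N) *ᵥ ψ) := by
  rw [mulVec_mulVec, mulVec_mulVec, ← mul_assoc, ← mul_assoc, parityX_mul_self, one_mul]

theorem parityX_dotProduct (ψ χ : State N) :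
    star (parityX N *ᵥ ψ) ⬝ᵥ (parityX N *ᵥ χ) = star ψ ⬝ᵥ χ := by
  rw [star_mulVec_dotProduct, parityX_conjTranspose, parityX_mulVec_self]

/-- Shifting q by π changes the signs of x and y. Since (r - x)(r + x) = y², the argument t > 0 of
the arctangent becomes -1/t. -/
theorem bogAngle_sub_pi {φ q : ℝ} (hφ : φ ∈ Set.Ioo (-(Real.pi / 4)) (Real.pi / 4))
    (h0 : 0 < q) (h1 : q < Real.pi) : bogAngle φ (q - Real.pi) = bogAngle φ q - Real.pi / 2 := by
  have hr2 := norm_sq_symbol' φ q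
  have hcos : Real.cos (2 * (q - Real.pi)) = Real.cos (2 * q) := by
    rw [mul_sub, Real.cos_sub_two_pi]
  rw [bogAngle, norm_symbol_congr hcos, Real.cos_sub_pi, Real.sin_sub_pi, bogAngle]
  set r := ‖(Real.sin φ : ℂ) + (Real.cos φ : ℂ) * Complex.exp (Complex.I * 2 * (q : ℂ))‖ with hr
  have hr0 : 0 ≤ r := norm_nonneg _
  have hy : 0 < (Real.cos φ - Real.sin φ) * Real.sin q :=
    mul_pos (cos_add_sin_pos hφ).2 (Real.sin_pos_of_pos_of_lt_pi h0 h1)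
  rw [mul_neg, mul_neg]
  set x := (Real.sin φ + Real.cos φ) * Real.cos q
  set y := (Real.cos φ - Real.sin φ) * Real.sin q
  have hx := abs_lt.mp (abs_lt_of_sq_lt_sq (by nlinarith : x ^ 2 < r ^ 2) hr0)
  have hpos : 0 < (r - x) / y := div_pos (by linarith) hy
  have h : (r - -x) / -y = -((r - x) / y)⁻¹ := by
    have h3 : r - x ≠ 0 := by linarith
    field_simp
    linear_combination -hr2
  rw [h, Real.arctan_neg, Real.arctan_inv_of_pos hpos]
  ring

theorem bogA_of_ne {φ q : ℝ} (h0 : q ≠ 0) (h1 : q ≠ Real.pi) :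
    bogA N φ q = (Real.cos (bogAngle φ q) : ℂ) • fermiB N q
      + (Complex.I * (Real.sin (bogAngle φ q) : ℂ)) • (fermiB N (-q))ᴴ :=
  if_neg (not_or.mpr ⟨h0, h1⟩)

theorem bogA_congr {φ q q' : ℝ} (n : ℤ) (h : q' = q + n * (2 * Real.pi)) (h0 : q ≠ 0)
    (h1 : q ≠ Real.pi) (h0' : q' ≠ 0) (h1' : q' ≠ Real.pi) : bogA N φ q' = bogA N φ q := by
  have h2 : -q' = -q + ((-n : ℤ) : ℝ) * (2 * Real.pi) := by
    rw [h]
    push_cast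
    ring
  rw [bogA_of_ne h0 h1, bogA_of_ne h0' h1', h2, h, bogAngle_add_int_mul_two_pi,
    fermiB_add_int_mul_two_pi, fermiB_add_int_mul_two_pi]

/-- Conjugation exchanges creation and annihilation, hence the roles of cos θ and sin θ; the shift
of θ by π/2 undoes this exchange, so an annihilator goes to an annihilator. -/
theorem parityX_conj_bogA {φ q : ℝ} (hφ : φ ∈ Set.Ioo (-(Real.pi / 4)) (Real.pi / 4))
    (h0 : 0 < q) (h1 : q < Real.pi) :
    parityX N * bogA N φ q * parityX N = -Complex.I • bogA N φ (q - Real.pi) := by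
  rw [bogA_of_ne h0.ne' h1.ne, bogA_of_ne (by linarith) (by linarith), bogAngle_sub_pi hφ h0 h1,
    Real.cos_sub_pi_div_two, Real.sin_sub_pi_div_two]
  have h : fermiB N (q - Real.pi) = fermiB N (Real.pi - -q) := by
    rw [← fermiB_add_int_mul_two_pi (q - Real.pi) 1]
    congr 1
    push_cast
    ring
  rw [h, neg_sub, mul_add, add_mul, mul_smul_comm, mul_smul_comm, smul_mul_assoc, smul_mul_assoc,
    parityX_conj_conjTranspose, parityX_conj_fermiB, parityX_conj_fermiB, conjTranspose_neg,
    conjTranspose_conjTranspose, smul_add, smul_smul, smul_smul, Complex.ofReal_neg]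
  have hI : -Complex.I * (Complex.I * -(Real.cos (bogAngle φ q) : ℂ))
      = -(Real.cos (bogAngle φ q) : ℂ) := by
    linear_combination (Real.cos (bogAngle φ q) : ℂ) * Complex.I_mul_I
  rw [hI]
  module

theorem parityX_conj_bogA_neg {φ q : ℝ} (hφ : φ ∈ Set.Ioo (-(Real.pi / 4)) (Real.pi / 4))
    (h0 : -Real.pi < q) (h1 : q < 0) :
    parityX N * bogA N φ q * parityX N = Complex.I • bogA N φ (q + Real.pi) := by
  have h := parityX_conj_bogA (N := N) hφ (q := q + Real.pi) (by linarith) (by linarith)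
  rw [add_sub_cancel_right] at h
  have h2 : bogA N φ q = Complex.I • (parityX N * bogA N φ (q + Real.pi) * parityX N) := by
    rw [h, smul_smul, mul_neg, Complex.I_mul_I, neg_neg, one_smul]
  rw [h2, mul_smul_comm, smul_mul_assoc]
  congr 1
  rw [← mul_assoc, ← mul_assoc, parityX_mul_self, one_mul, mul_assoc, parityX_mul_self, mul_one]

theorem parityZ_conjTranspose : (parityZ N)ᴴ = parityZ N := by
  simp only [parityZ, tensorOp_conjTranspose, pauliZ_conjTranspose]

theorem parityZ_mul_fermiB (q : ℝ) : parityZ N * fermiB N q = -(fermiB N q * parityZ N) := by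
  simp only [fermiB, mul_smul_comm, smul_mul_assoc, Finset.mul_sum, Finset.sum_mul,
    parityZ_mul_fermiC, smul_neg, Finset.sum_neg_distrib]

theorem parityZ_mul_conjTranspose {A : Op N} (h : parityZ N * A = -(A * parityZ N)) :
    parityZ N * Aᴴ = -(Aᴴ * parityZ N) := by
  have h' := congrArg conjTranspose h
  rw [conjTranspose_neg, conjTranspose_mul, conjTranspose_mul, parityZ_conjTranspose] at h'
  rw [h', neg_neg]

theorem parityZ_mul_bogA (φ q : ℝ) : parityZ N * bogA N φ q = -(bogA N φ q * parityZ N) := by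
  rw [bogA_eq, mul_add, add_mul, mul_smul_comm, mul_smul_comm, parityZ_mul_fermiB,
    parityZ_mul_conjTranspose (parityZ_mul_fermiB _), smul_mul_assoc, smul_mul_assoc, smul_neg,
    smul_neg, neg_add]

theorem commute_parityZ_pairFactor (φ q : ℝ) : Commute (parityZ N) (pairFactor N φ q) := by
  unfold pairFactor
  split_ifs
  · refine ((Commute.one_right _).smul_right _).sub_right (Commute.smul_right ?_ _)
    change _ = _
    rw [← mul_assoc, parityZ_mul_conjTranspose (parityZ_mul_fermiB _), neg_mul, mul_assoc,
      parityZ_mul_conjTranspose (parityZ_mul_fermiB _), mul_neg, neg_neg, mul_assoc]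
  · exact Commute.one_right _

theorem dotProduct_eq_zero_of_parity {v w : State N} (hv : parityZ N *ᵥ v = -v)
    (hw : parityZ N *ᵥ w = w) : star v ⬝ᵥ w = 0 := by
  have h := star_mulVec_dotProduct (parityZ N) v w
  rw [parityZ_conjTranspose, hv, hw, star_neg, neg_dotProduct] at h
  exact self_eq_neg.mp h.symm

theorem parityZ_mulVec_parityX (hN : Odd N) {v : State N} (hv : parityZ N *ᵥ v = -v) :
    parityZ N *ᵥ (parityX N *ᵥ v) = parityX N *ᵥ v := by
  rw [mulVec_mulVec, ← neg_eq_iff_eq_neg.mpr (parityX_mul_parityZ hN), neg_mulVec,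
    ← mulVec_mulVec, hv, mulVec_neg, neg_neg]

theorem parityZ_mulVec_parityX_of_even (hN : Odd N) {v : State N} (hv : parityZ N *ᵥ v = v) :
    parityZ N *ᵥ (parityX N *ᵥ v) = -(parityX N *ᵥ v) := by
  rw [mulVec_mulVec, ← neg_eq_iff_eq_neg.mpr (parityX_mul_parityZ hN), neg_mulVec,
    ← mulVec_mulVec, hv]

/-- If `Πˣ ψ` is a phase times `χ`, then `Πˣ χ` is a phase times `ψ`. -/
theorem exists_phase_symm {ψ χ : State N} (h : ∃ z : ℂ, ‖z‖ = 1 ∧ parityX N *ᵥ ψ = z • χ) :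
    ∃ z : ℂ, ‖z‖ = 1 ∧ parityX N *ᵥ χ = z • ψ := by
  obtain ⟨z, hz, hψ⟩ := h
  have hz0 : z ≠ 0 := by
    rintro rfl
    simp at hz
  refine ⟨z⁻¹, by rw [norm_inv, hz, inv_one], ?_⟩
  rw [← parityX_mulVec_self ψ, hψ, mulVec_smul, smul_smul, inv_mul_cancel₀ hz0, one_smul]

variable [NeZero N]

theorem parityZ_mulVec_vacuum (s φ : ℝ) : parityZ N *ᵥ vacuum N s φ = vacuum N s φ := by
  have h : Commute (parityZ N)
      ((List.finRange N).map fun k => pairFactor N φ (modeMom s k)).prod :=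
    Commute.list_prod_right _ _ fun x hx => by
      obtain ⟨k, -, rfl⟩ := List.mem_map.mp hx
      exact commute_parityZ_pairFactor φ _
  rw [vacuum, mulVec_mulVec, h.eq, ← mulVec_mulVec, parityZ_mulVec_allUp]

theorem parityZ_mulVec_oneParticle (φ q : ℝ) :
    parityZ N *ᵥ oneParticle N φ q = -oneParticle N φ q := by
  rw [oneParticle, vacMinus_eq, mulVec_mulVec, parityZ_mul_conjTranspose (parityZ_mul_bogA φ q),
    neg_mulVec, ← mulVec_mulVec, parityZ_mulVec_vacuum]

theorem oneParticle_dotProduct (φ : ℝ) (k l : Fin N) :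
    star (oneParticle N φ (modeMom 0 k)) ⬝ᵥ oneParticle N φ (modeMom 0 l)
      = if k = l then 1 else 0 := by
  have hτ := isPairing_neg (N := N)
  have hC := hτ.isCAR_bogA le_rfl one_pos φ
  have h1 : bogA N φ (modeMom 0 k) * (bogA N φ (modeMom 0 l))ᴴ
      = (if k = l then 1 else 0) - (bogA N φ (modeMom 0 l))ᴴ * bogA N φ (modeMom 0 k) :=
    eq_sub_of_add_eq (hC.2 k l)
  rw [oneParticle, oneParticle, vacMinus_eq, star_mulVec_dotProduct, conjTranspose_conjTranspose,
    mulVec_mulVec, h1, sub_mulVec, ← mulVec_mulVec, hτ.bogA_mulVec_vacuum le_rfl one_pos,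
    mulVec_zero, sub_zero]
  split_ifs
  · rw [one_mulVec, hτ.star_vacuum_dotProduct le_rfl one_pos]
  · rw [zero_mulVec, dotProduct_zero]

theorem modeMom_zero_zero : modeMom 0 (0 : Fin N) = 0 := by
  simp [modeMom]

/-- The label of the momentum `π` in the even sector. -/
theorem exists_modeMom_eq_pi (hN : Odd N) : ∃ k : Fin N, modeMom (1 / 2) k = Real.pi := by
  obtain ⟨h, hh⟩ := hN
  have hN : (N : ℝ) ≠ 0 := NeZero.ne _
  refine ⟨⟨h, by omega⟩, ?_⟩
  have hN2 : (N : ℝ) = 2 * h + 1 := by rw [hh]; push_cast; ring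
  rw [modeMom, div_eq_iff hN, hN2]
  ring

/-- With N = 2h + 1, π is the momentum 2π(h + 1/2)/N, so adding it moves the label by h and turns Γ⁻
into Γ⁺. -/
theorem modeMom_add_pi (hN : Odd N) (k : Fin N) (hk : modeMom 0 k < Real.pi) :
    ∃ l : Fin N, modeMom (1 / 2) l = modeMom 0 k + Real.pi := by
  obtain ⟨h, hh⟩ := hN
  have hN : (N : ℝ) ≠ 0 := NeZero.ne _
  have hN' : (0 : ℝ) < N := by exact_mod_cast NeZero.pos N
  have hk' : 2 * (k : ℕ) < N := by
    rw [modeMom, div_lt_iff₀ hN'] at hk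
    have : (2 * (k : ℕ) : ℝ) < N := by nlinarith [Real.pi_pos]
    exact_mod_cast this
  refine ⟨⟨k + h, by omega⟩, ?_⟩
  have hN2 : (N : ℝ) = 2 * h + 1 := by rw [hh]; push_cast; ring
  rw [modeMom, modeMom]
  field_simp
  rw [hN2]
  push_cast
  ring

theorem modeMom_sub_pi (hN : Odd N) (k : Fin N) (hk : Real.pi < modeMom 0 k) :
    ∃ l : Fin N, modeMom (1 / 2) l = modeMom 0 k - Real.pi := by
  obtain ⟨h, hh⟩ := hN
  have hN : (N : ℝ) ≠ 0 := NeZero.ne _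
  have hN' : (0 : ℝ) < N := by exact_mod_cast NeZero.pos N
  have hk' : N < 2 * (k : ℕ) := by
    rw [modeMom, lt_div_iff₀ hN'] at hk
    have : (N : ℝ) < 2 * (k : ℕ) := by nlinarith [Real.pi_pos]
    exact_mod_cast this
  refine ⟨⟨k - (h + 1), by omega⟩, ?_⟩
  have hN2 : (N : ℝ) = 2 * h + 1 := by rw [hh]; push_cast; ring
  rw [modeMom, modeMom]
  simp only
  rw [Nat.cast_sub (by omega)]
  field_simp
  rw [hN2]
  push_cast
  ring

/-- Every a_q with q ≠ 0 in Γ⁻ is conjugate, up to a phase, to an annihilator of |0⁺⟩. The exception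
is q = 0, where a_0† is conjugate to -b_π: the mode 0 is filled. -/
theorem exists_parityX_mulVec_vacuum (hN : Odd N) {φ : ℝ}
    (hφ : φ ∈ Set.Ioo (-(Real.pi / 4)) (Real.pi / 4)) :
    ∃ z : ℂ, ‖z‖ = 1 ∧ parityX N *ᵥ vacuum N (1 / 2) φ = z • oneParticle N φ 0 := by
  have hp := Real.pi_pos
  have hτ := isPairing_neg (N := N)
  have hτ' := isPairing_rev (N := N)
  have hC := hτ.isCAR_bogA le_rfl one_pos φ
  set ψ := parityX N *ᵥ vacuum N (1 / 2) φ with hψ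
  have kill : ∀ k : Fin N, k ≠ 0 → bogA N φ (modeMom 0 k) *ᵥ ψ = 0 := by
    intro k hk
    have hpos := modeMom_pos_label k hk
    have hlt := modeMom_lt one_pos k
    have hvac := hτ'.bogA_mulVec_vacuum (by norm_num) (by norm_num) φ
    have key : ∀ A : Op N, (parityX N * A * parityX N) *ᵥ vacuum N (1 / 2) φ = 0 → A *ᵥ ψ = 0 := by
      intro A hA
      rw [hψ, mulVec_parityX_mulVec, hA, mulVec_zero]
    rcases lt_or_gt_of_ne (modeMom_ne_pi hN k) with h | h
    · obtain ⟨l, hl⟩ := modeMom_add_pi hN k h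
      refine key _ ?_
      rw [parityX_conj_bogA hφ hpos h, smul_mulVec, bogA_congr (q := modeMom (1 / 2) l) (-1)
        (by rw [hl]; push_cast; ring) (by linarith) (by linarith) (by linarith) (by linarith),
        hvac, smul_zero]
    · obtain ⟨l, hl⟩ := modeMom_sub_pi hN k h
      refine key _ ?_
      -- Labels represent momenta in [0, 2π); the representative in (-π, 0) is the one to which the
      -- conjugation rule applies.
      rw [bogA_congr (q := modeMom 0 k - 2 * Real.pi) 1 (by push_cast; ring) (by linarith)
        (by linarith) (by linarith) (by linarith), parityX_conj_bogA_neg hφ (by linarith)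
        (by linarith), smul_mulVec,
        show modeMom 0 k - 2 * Real.pi + Real.pi = modeMom (1 / 2) l by rw [hl]; ring, hvac,
        smul_zero]
  have kill0 : (bogA N φ 0)ᴴ *ᵥ ψ = 0 := by
    obtain ⟨l, hl⟩ := exists_modeMom_eq_pi hN
    have h1 := hτ'.bogA_mulVec_vacuum (by norm_num) (by norm_num) φ l
    rw [hl, bogA, if_pos (Or.inr rfl)] at h1
    rw [hψ, mulVec_parityX_mulVec, parityX_conj_conjTranspose, bogA, if_pos (Or.inl rfl), parityX_conj_fermiB, sub_zero,
      conjTranspose_neg, conjTranspose_conjTranspose, neg_mulVec, h1, neg_zero, mulVec_zero]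
  have hC0 := hC.2 0 0
  simp only [modeMom_zero_zero, if_true] at hC0
  -- Emptying the filled mode 0 leaves a vector killed by all modes, so a multiple of |0⁻⟩; the
  -- anticommutator of a_0 and a_0† then recovers ψ from it.
  obtain ⟨z, hz⟩ := hτ.eq_smul_vacuum le_rfl one_pos φ (ψ := bogA N φ 0 *ᵥ ψ) fun k => by
    have h1 := hC.mul_eq_neg k 0
    rw [modeMom_zero_zero] at h1
    by_cases hk : k = 0
    · have h2 : bogA N φ 0 * bogA N φ 0 = 0 := by
        rw [hk, modeMom_zero_zero] at h1
        ext i j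
        exact self_eq_neg.mp (congrFun₂ h1 i j)
      rw [hk, modeMom_zero_zero, mulVec_mulVec, h2, zero_mulVec]
    · rw [mulVec_mulVec, h1, neg_mulVec, ← mulVec_mulVec, kill k hk, mulVec_zero, neg_zero]
  have hψz : ψ = z • oneParticle N φ 0 := by
    calc ψ = (bogA N φ 0 * (bogA N φ 0)ᴴ + (bogA N φ 0)ᴴ * bogA N φ 0) *ᵥ ψ := by
          rw [hC0, one_mulVec]
      _ = z • oneParticle N φ 0 := by
          rw [add_mulVec, ← mulVec_mulVec, kill0, mulVec_zero, zero_add, ← mulVec_mulVec, hz,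
            mulVec_smul, oneParticle, vacMinus_eq]
  refine ⟨z, ?_, hψz⟩
  have h1 : star ψ ⬝ᵥ ψ = 1 := by
    rw [hψ, parityX_dotProduct, hτ'.star_vacuum_dotProduct (by norm_num) (by norm_num)]
  have h2 := oneParticle_dotProduct φ (0 : Fin N) 0
  rw [modeMom_zero_zero, if_pos rfl] at h2
  rw [hψz, star_smul, smul_dotProduct, dotProduct_smul, h2, smul_eq_mul, smul_eq_mul, mul_one,
    Complex.star_def, ← Complex.normSq_eq_conj_mul_self, Complex.normSq_eq_norm_sq] at h1
  have h3 : ‖z‖ ^ 2 = 1 := by exact_mod_cast h1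
  exact (pow_eq_one_iff_of_nonneg (norm_nonneg z) two_ne_zero).mp h3

/-- Under Πˣ, a_π† becomes -b_0, which removes the particle from a_0†|0⁻⟩, and a_q† then creates the
single particle at q'. -/
theorem exists_parityX_mulVec_twoParticle (hN : Odd N) {φ q q' : ℝ}
    (hφ : φ ∈ Set.Ioo (-(Real.pi / 4)) (Real.pi / 4)) {c : ℂ} (hc : ‖c‖ = 1)
    (h : parityX N * bogA N φ q * parityX N = c • bogA N φ q') :
    ∃ z : ℂ, ‖z‖ = 1 ∧ parityX N *ᵥ twoParticle N φ q = z • oneParticle N φ q' := by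
  obtain ⟨z, hz, hvac⟩ := exists_parityX_mulVec_vacuum hN hφ
  have hτ := isPairing_neg (N := N)
  have hC0 := (hτ.isCAR_bogA le_rfl one_pos φ).mul_adj_self 0
  simp only [modeMom_zero_zero] at hC0
  have h1 : bogA N φ 0 *ᵥ oneParticle N φ 0 = vacMinus N φ := by
    have h2 := hτ.bogA_mulVec_vacuum le_rfl one_pos φ 0
    rw [modeMom_zero_zero] at h2
    rw [oneParticle, mulVec_mulVec, hC0, sub_mulVec, ← mulVec_mulVec, vacMinus_eq, h2, mulVec_zero,
      sub_zero, one_mulVec]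
  have h3 : bogA N φ 0 = fermiB N 0 := if_pos (Or.inl rfl)
  have h4 : bogA N φ Real.pi = fermiB N Real.pi := if_pos (Or.inr rfl)
  -- The conjugate of `c` comes from taking adjoints, the minus sign from the conjugation of b_π.
  refine ⟨star c * -z, by rw [norm_mul, norm_star, norm_neg, hc, hz, one_mul], ?_⟩
  rw [twoParticle, parityX_mulVec_mulVec, parityX_mulVec_mulVec, vacPlus_eq, hvac,
    parityX_conj_conjTranspose, h, parityX_conj_conjTranspose, h4, parityX_conj_fermiB, sub_self,
    conjTranspose_neg, conjTranspose_conjTranspose, neg_mulVec, mulVec_smul, ← h3, h1,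
    conjTranspose_smul, smul_mulVec, mulVec_neg, mulVec_smul, ← neg_smul, smul_smul, oneParticle]

end Parity

/-! ### The ground space for a given least excitation energy, and the minimizing momenta -/

section GroundSpace

variable {N : ℕ}

theorem finrank_span_range_of_orthonormal {n : ℕ} {f : Fin n → State N}
    (h : ∀ i j, star (f i) ⬝ᵥ f j = if i = j then 1 else 0) :
    Module.finrank ℂ (Submodule.span ℂ (Set.range f)) = n := by
  rw [finrank_span_eq_card, Fintype.card_fin]
  rw [Fintype.linearIndependent_iff]
  intro g hg i
  have h1 := congrArg (star (f i) ⬝ᵥ ·) hg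
  simpa [dotProduct_sum, h] using h1

theorem gammaMinus_eq : GammaMinus N = Set.range fun k : Fin N => modeMom 0 k := by
  ext q
  constructor
  · rintro ⟨k, hk, rfl⟩
    exact ⟨⟨k, hk⟩, by simp [modeMom, momMinus]⟩
  · rintro ⟨k, rfl⟩
    exact ⟨k, k.2, by simp [modeMom, momMinus]⟩

theorem gammaPlus_eq : GammaPlus N = Set.range fun k : Fin N => modeMom (1 / 2) k := by
  ext q
  constructor
  · rintro ⟨k, hk, rfl⟩
    exact ⟨⟨k, hk⟩, rfl⟩
  · rintro ⟨k, rfl⟩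
    exact ⟨k, k.2, rfl⟩

variable [NeZero N]

/-- The ground energy, in terms of the least excitation energy `e`. -/
def groundEnergy (N : ℕ) [NeZero N] (φ e : ℝ) : ℝ :=
  e - ∑ k : Fin N, dispersion φ (modeMom 0 k) / 2

variable {φ e : ℝ}

theorem hamiltonian_mulVec_oneParticle (hN : Odd N)
    (hφ : φ ∈ Set.Ioo (-(Real.pi / 4)) (Real.pi / 4)) (k : Fin N) :
    hamiltonian N φ *ᵥ oneParticle N φ (modeMom 0 k)
      = (groundEnergy N φ (dispersion φ (modeMom 0 k)) : ℂ) • oneParticle N φ (modeMom 0 k) := by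
  have hτ := isPairing_neg (N := N)
  have h0 : freeEnergy (fun k : Fin N => bogA N φ (modeMom 0 k))
      (fun k => dispersion φ (modeMom 0 k)) *ᵥ vacMinus N φ = 0 := by
    rw [freeEnergy, Matrix.sum_mulVec]
    refine Finset.sum_eq_zero fun l _ => ?_
    rw [smul_mulVec, ← mulVec_mulVec, vacMinus_eq, hτ.bogA_mulVec_vacuum le_rfl one_pos,
      mulVec_zero, smul_zero]
  have h1 := (hτ.isCAR_bogA le_rfl one_pos φ).freeEnergy_mul_adj
    (fun k => dispersion φ (modeMom 0 k)) k
  rw [hamiltonian_mulVec_of_odd φ (parityZ_mulVec_oneParticle φ _),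
    fermiHamiltonian_eq_freeEnergy hN hφ, sub_mulVec, smul_mulVec, one_mulVec]
  nth_rw 1 [oneParticle]
  rw [mulVec_mulVec, h1, add_mulVec, ← mulVec_mulVec, h0, mulVec_zero, zero_add, smul_mulVec,
    ← oneParticle, ← sub_smul, groundEnergy, Complex.ofReal_sub]

/-- Of the two alternatives for a low-lying eigenvector, the vacuum has even parity, so an odd
multiple of it is zero. -/
theorem odd_eigenvector (hN : Odd N) (hφ : φ ∈ Set.Ioo (-(Real.pi / 4)) (Real.pi / 4))
    (he : 0 < e) (hmin : ∀ k : Fin N, e ≤ dispersion φ (modeMom 0 k)) {x : ℝ}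
    (hx : x ≤ groundEnergy N φ e) {ψ : State N} (hodd : parityZ N *ᵥ ψ = -ψ)
    (hψ : hamiltonian N φ *ᵥ ψ = (x : ℂ) • ψ) :
    (ψ = 0 ∨ x = groundEnergy N φ e) ∧
      ψ ∈ Submodule.span ℂ ((fun k : Fin N => oneParticle N φ (modeMom 0 k)) ''
        {k | dispersion φ (modeMom 0 k) = e}) := by
  have hτ := isPairing_neg (N := N)
  have hψ' : freeEnergy (fun k : Fin N => bogA N φ (modeMom 0 k))
        (fun k => dispersion φ (modeMom 0 k)) *ᵥ ψ
      = ((x + ∑ k : Fin N, dispersion φ (modeMom 0 k) / 2 : ℝ) : ℂ) • ψ := by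
    rw [hamiltonian_mulVec_of_odd φ hodd, fermiHamiltonian_eq_freeEnergy hN hφ, sub_mulVec,
      smul_mulVec, one_mulVec, sub_eq_iff_eq_add] at hψ
    rw [hψ, ← add_smul, ← Complex.ofReal_add]
  unfold groundEnergy at hx ⊢
  rcases (hτ.isCAR_bogA le_rfl one_pos φ).eigenvector_freeEnergy he hmin
    (fun ψ hψ => hτ.eq_smul_vacuum le_rfl one_pos φ hψ) (by linarith) hψ' with ⟨z, hz⟩ | ⟨h1, h2⟩
  · have h0 : ψ = 0 := by
      have h3 : parityZ N *ᵥ ψ = ψ := by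
        rw [hz, mulVec_smul, parityZ_mulVec_vacuum]
      rw [hodd] at h3
      funext s
      exact self_eq_neg.mp (congrFun h3 s).symm
    refine ⟨Or.inl h0, ?_⟩
    rw [h0]
    exact Submodule.zero_mem _
  · refine ⟨Or.inr (by linarith), ?_⟩
    simpa only [oneParticle, vacMinus_eq] using h2

/-- Projections by Πᶻ preserve eigenvectors, and Πˣ moves the even component into the odd sector, so
`odd_eigenvector` controls both components. -/
theorem isGroundSpace_span (hN : Odd N) (hφ : φ ∈ Set.Ioo (-(Real.pi / 4)) (Real.pi / 4))
    (he : 0 < e) (hmin : ∀ k : Fin N, e ≤ dispersion φ (modeMom 0 k))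
    (hex : ∃ k : Fin N, dispersion φ (modeMom 0 k) = e) :
    IsGroundSpace (hamiltonian N φ) (Submodule.span ℂ
      ((fun k : Fin N => oneParticle N φ (modeMom 0 k)) '' {k | dispersion φ (modeMom 0 k) = e} ∪
        (fun k : Fin N => parityX N *ᵥ oneParticle N φ (modeMom 0 k)) ''
          {k | dispersion φ (modeMom 0 k) = e})) := by
  set K : Set (Fin N) := {k | dispersion φ (modeMom 0 k) = e} with hK
  set W := Submodule.span ℂ ((fun k : Fin N => oneParticle N φ (modeMom 0 k)) '' K) with hW
  have hmap : Submodule.span ℂ ((fun k : Fin N => parityX N *ᵥ oneParticle N φ (modeMom 0 k)) '' K)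
      = W.map (Matrix.toLin' (parityX N)) := by
    rw [hW, Submodule.map_span, ← Set.image_comp]
    rfl
  have hX : ∀ ψ : State N, hamiltonian N φ *ᵥ (parityX N *ᵥ ψ)
      = parityX N *ᵥ (hamiltonian N φ *ᵥ ψ) := fun ψ => by
    rw [mulVec_mulVec, (hamiltonian_commute_parityX φ).eq, mulVec_mulVec]
  have hZ : ∀ ψ : State N, hamiltonian N φ *ᵥ (parityZ N *ᵥ ψ)
      = parityZ N *ᵥ (hamiltonian N φ *ᵥ ψ) := fun ψ => by
    rw [mulVec_mulVec, (hamiltonian_commute_parityZ φ).eq, mulVec_mulVec]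
  have hmem : ∀ {x : ℝ} {ψ : State N}, x ≤ groundEnergy N φ e →
      hamiltonian N φ *ᵥ ψ = (x : ℂ) • ψ → (ψ = 0 ∨ x = groundEnergy N φ e) ∧
        ψ ∈ W ⊔ W.map (Matrix.toLin' (parityX N)) := by
    intro x ψ hx hψ
    have hZψ : hamiltonian N φ *ᵥ (parityZ N *ᵥ ψ) = (x : ℂ) • (parityZ N *ᵥ ψ) := by
      rw [hZ, hψ, mulVec_smul]
    have hZZ : parityZ N *ᵥ (parityZ N *ᵥ ψ) = ψ := by
      rw [mulVec_mulVec, parityZ_mul_self, one_mulVec]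
    have hodd := odd_eigenvector hN hφ he hmin hx (ψ := ψ - parityZ N *ᵥ ψ)
      (by rw [mulVec_sub, hZZ, neg_sub]) (by rw [mulVec_sub, hψ, hZψ, smul_sub])
    have heven := odd_eigenvector hN hφ he hmin hx (ψ := parityX N *ᵥ (ψ + parityZ N *ᵥ ψ))
      (parityZ_mulVec_parityX_of_even hN (by rw [mulVec_add, hZZ, add_comm]))
      (by rw [hX, mulVec_add, hψ, hZψ, ← smul_add, mulVec_smul])
    -- The odd and even parts of ψ, the latter written as the Πˣ-image of an odd vector.
    have hsplit : ψ = (1 / 2 : ℂ) • (ψ - parityZ N *ᵥ ψ)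
        + (1 / 2 : ℂ) • (parityX N *ᵥ (parityX N *ᵥ (ψ + parityZ N *ᵥ ψ))) := by
      rw [parityX_mulVec_self]
      module
    constructor
    · by_cases hxe : x = groundEnergy N φ e
      · exact Or.inr hxe
      · left
        rw [hsplit, hodd.1.resolve_right hxe, heven.1.resolve_right hxe, mulVec_zero, smul_zero,
          add_zero]
    · rw [hsplit]
      refine Submodule.add_mem_sup (Submodule.smul_mem _ _ hodd.2) (Submodule.smul_mem _ _ ?_)
      exact ⟨_, heven.2, rfl⟩
  have hle : W ≤ Module.End.eigenspace (Matrix.toLin' (hamiltonian N φ))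
      (groundEnergy N φ e : ℂ) := by
    rw [hW, Submodule.span_le]
    rintro _ ⟨k, hk, rfl⟩
    rw [SetLike.mem_coe, Module.End.mem_eigenspace_iff, toLin'_apply,
      hamiltonian_mulVec_oneParticle hN hφ, hk]
  rw [Submodule.span_union, hmap]
  refine ⟨groundEnergy N φ e, ⟨?_, ?_⟩, le_antisymm (sup_le hle ?_) ?_⟩
  · obtain ⟨k, hk⟩ := hex
    refine Module.End.hasEigenvalue_of_hasEigenvector
      (x := oneParticle N φ (modeMom 0 k)) ⟨hle (Submodule.subset_span ⟨k, hk, rfl⟩), ?_⟩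
    intro h0
    have h1 := oneParticle_dotProduct φ k k
    rw [h0, dotProduct_zero, if_pos rfl] at h1
    exact zero_ne_one h1
  · intro x hx
    obtain ⟨ψ, hψ, hψ0⟩ := hx.exists_hasEigenvector
    rw [Module.End.mem_eigenspace_iff, toLin'_apply] at hψ
    by_contra hlt
    rcases (hmem (not_le.mp hlt).le hψ).1 with h | h
    · exact hψ0 h
    · exact hlt h.ge
  · rintro _ ⟨ψ, hψ, rfl⟩
    have hψ' := hle hψ
    rw [Module.End.mem_eigenspace_iff, toLin'_apply] at hψ' ⊢
    rw [toLin'_apply, hX, hψ', mulVec_smul]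
  · intro ψ hψ
    rw [Module.End.mem_eigenspace_iff, toLin'_apply] at hψ
    exact (hmem le_rfl hψ).2

theorem oneParticle_even_dotProduct_odd (hN : Odd N) (q q' : ℝ) :
    star (parityX N *ᵥ oneParticle N φ q) ⬝ᵥ oneParticle N φ q' = 0 ∧
      star (oneParticle N φ q) ⬝ᵥ (parityX N *ᵥ oneParticle N φ q') = 0 := by
  have h : ∀ q q' : ℝ, star (oneParticle N φ q) ⬝ᵥ (parityX N *ᵥ oneParticle N φ q') = 0 :=
    fun q q' => dotProduct_eq_zero_of_parity (parityZ_mulVec_oneParticle φ q)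
      (parityZ_mulVec_parityX hN (parityZ_mulVec_oneParticle φ q'))
  refine ⟨?_, h q q'⟩
  rw [star_mulVec_dotProduct, parityX_conjTranspose, h]

theorem cos_two_mul_lt_one {q : ℝ} (h0 : 0 < q) (h1 : q < 2 * Real.pi) (h2 : q ≠ Real.pi) :
    Real.cos (2 * q) < 1 := by
  have := pow_pos (abs_pos.mpr (sin_ne_zero_of_lt_two_pi h0 h1 h2)) 2
  rw [sq_abs] at this
  rw [Real.cos_two_mul', Real.cos_sq']
  linarith

theorem cos_two_mul_modeMom {s : ℝ} {m : ℤ} (k : Fin N)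
    (hm : (m : ℝ) = 4 * ((k : ℕ) + s) - N) :
    Real.cos (2 * modeMom s k) = -Real.cos (Real.pi * m / N) := by
  have hN : (N : ℝ) ≠ 0 := NeZero.ne _
  rw [← Real.cos_add_pi, hm, modeMom]
  congr 1
  field_simp
  ring

/-- By `cos_two_mul_modeMom` a label corresponds to m = 4l - N on Γ⁻ and m = 4l + 2 - N on Γ⁺. Both
are odd and lie in [-N, 3N], and cos 2q is least when m is ±1 modulo 2N. -/
theorem groundMomentum_spec (hN : Odd N) (hN3 : 3 ≤ N) :
    0 < groundMomentum N ∧ groundMomentum N < Real.pi ∧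
    Real.cos (2 * groundMomentum N) = -Real.cos (Real.pi * 1 / N) ∧
    (∃ k : Fin N, modeMom 0 k = groundMomentum N ∧
      ∀ l : Fin N, l ≠ k → l ≠ -k → -Real.cos (Real.pi * 1 / N) < Real.cos (2 * modeMom 0 l)) ∧
    ∃ k : Fin N, modeMom (1 / 2) k = Real.pi - groundMomentum N ∧
      ∀ l : Fin N, l ≠ k → l ≠ Fin.rev k →
        -Real.cos (Real.pi * 1 / N) < Real.cos (2 * modeMom (1 / 2) l) := by
  have hNR : (N : ℝ) ≠ 0 := NeZero.ne _
  have hp := Real.pi_pos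
  have hminus : ∀ l : Fin N, Real.cos (2 * modeMom 0 l)
      = -Real.cos (Real.pi * ((4 * (l : ℕ) - N : ℤ) : ℝ) / N) := fun l =>
    cos_two_mul_modeMom l (by push_cast; ring)
  have hplus : ∀ l : Fin N, Real.cos (2 * modeMom (1 / 2) l)
      = -Real.cos (Real.pi * ((4 * (l : ℕ) + 2 - N : ℤ) : ℝ) / N) := fun l =>
    cos_two_mul_modeMom l (by push_cast; ring)
  have hneg : ∀ (l : Fin N) (a : ℕ) (ha : a < N), 0 < a → (l : ℕ) = N - a → l = -⟨a, ha⟩ := by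
    intro l a ha ha0 hl
    rw [Fin.ext_iff, Fin.val_neg', hl]
    exact (Nat.mod_eq_of_lt (by omega)).symm
  have hrev : ∀ (l : Fin N) (a : ℕ) (ha : a < N), (l : ℕ) = N - (a + 1) →
      l = Fin.rev ⟨a, ha⟩ := by
    intro l a ha hl
    rw [Fin.ext_iff, Fin.val_rev, hl]
  have hcos : Real.cos (-(Real.pi * 1 / N)) = Real.cos (Real.pi * 1 / N) := Real.cos_neg _
  have hN' : N % 4 = 1 ∨ N % 4 = 3 := by
    obtain ⟨n, hn⟩ := hN
    omega
  rcases hN' with h4 | h4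
  -- Label n gives m = -1 on Γ⁻ and m = 1 on Γ⁺; the partners give 2N + 1 and 2N - 1.
  · obtain ⟨n, hn⟩ : ∃ n, N = 4 * n + 1 := ⟨N / 4, by omega⟩
    have hn' : (N : ℝ) = 4 * n + 1 := by rw [hn]; push_cast; ring
    have hp1 : modeMom 0 (⟨n, by omega⟩ : Fin N) = groundMomentum N := by
      rw [groundMomentum, if_pos h4, modeMom]
      field_simp
      rw [hn']
      ring
    have hp2 : modeMom (1 / 2) (⟨n, by omega⟩ : Fin N) = Real.pi - groundMomentum N := by
      rw [groundMomentum, if_pos h4, modeMom]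
      field_simp
      rw [hn']
      ring
    have hpos : 0 < groundMomentum N := by
      rw [← hp1]
      refine modeMom_pos_label _ fun h => ?_
      have := congrArg Fin.val h
      rw [Fin.val_zero] at this
      simp only at this
      omega
    have hlt : groundMomentum N < Real.pi := by
      have : 0 < modeMom (1 / 2) (⟨n, by omega⟩ : Fin N) := by
        unfold modeMom
        positivity
      linarith
    refine ⟨hpos, hlt, ?_, ⟨⟨n, by omega⟩, hp1, fun l h1 h2 => ?_⟩,
      ⟨⟨n, by omega⟩, hp2, fun l h1 h2 => ?_⟩⟩
    · rw [← hp1, hminus, ← hcos]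
      congr 2
      push_cast
      rw [hn']
      ring
    · rw [hminus, neg_lt_neg_iff]
      have hl := l.2
      have g1 : (l : ℕ) ≠ n := fun h => h1 (Fin.ext h)
      have g2 : (l : ℕ) ≠ N - n := fun h => h2 (hneg l n (by omega) (by omega) h)
      exact cos_pi_mul_odd_lt (by omega) ⟨2 * (l : ℕ) - 2 * n - 1, by omega⟩ (by omega) (by omega)
        (by omega) (by omega) (by omega) (by omega)
    · rw [hplus, neg_lt_neg_iff]
      have hl := l.2
      have g1 : (l : ℕ) ≠ n := fun h => h1 (Fin.ext h)
      have g2 : (l : ℕ) ≠ N - (n + 1) := fun h => h2 (hrev l n (by omega) h)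
      exact cos_pi_mul_odd_lt (by omega) ⟨2 * (l : ℕ) - 2 * n, by omega⟩ (by omega) (by omega)
        (by omega) (by omega) (by omega) (by omega)
  -- Here m = 1 has label n + 1 on Γ⁻ and m = -1 has label n on Γ⁺, with partners at 2N - 1 and 2N +
  -- 1.
  · obtain ⟨n, hn⟩ : ∃ n, N = 4 * n + 3 := ⟨N / 4, by omega⟩
    have hn' : (N : ℝ) = 4 * n + 3 := by rw [hn]; push_cast; ring
    have hp1 : modeMom 0 (⟨n + 1, by omega⟩ : Fin N) = groundMomentum N := by
      rw [groundMomentum, if_neg (by omega), modeMom]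
      field_simp
      push_cast
      rw [hn']
      ring
    have hp2 : modeMom (1 / 2) (⟨n, by omega⟩ : Fin N) = Real.pi - groundMomentum N := by
      rw [groundMomentum, if_neg (by omega), modeMom]
      field_simp
      rw [hn']
      ring
    have hpos : 0 < groundMomentum N := by
      rw [← hp1]
      refine modeMom_pos_label _ fun h => ?_
      have := congrArg Fin.val h
      rw [Fin.val_zero] at this
      simp only at this
      omega
    have hlt : groundMomentum N < Real.pi := by
      have : 0 < modeMom (1 / 2) (⟨n, by omega⟩ : Fin N) := by
        unfold modeMom
        positivity
      linarith
    refine ⟨hpos, hlt, ?_, ⟨⟨n + 1, by omega⟩, hp1, fun l h1 h2 => ?_⟩,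
      ⟨⟨n, by omega⟩, hp2, fun l h1 h2 => ?_⟩⟩
    · rw [← hp1, hminus]
      congr 3
      push_cast
      rw [hn']
      ring
    · rw [hminus, neg_lt_neg_iff]
      have hl := l.2
      have g1 : (l : ℕ) ≠ n + 1 := fun h => h1 (Fin.ext h)
      have g2 : (l : ℕ) ≠ N - (n + 1) := fun h => h2 (hneg l (n + 1) (by omega) (by omega) h)
      exact cos_pi_mul_odd_lt (by omega) ⟨2 * (l : ℕ) - 2 * n - 2, by omega⟩ (by omega) (by omega)
        (by omega) (by omega) (by omega) (by omega)
    · rw [hplus, neg_lt_neg_iff]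
      have hl := l.2
      have g1 : (l : ℕ) ≠ n := fun h => h1 (Fin.ext h)
      have g2 : (l : ℕ) ≠ N - (n + 1) := fun h => h2 (hrev l n (by omega) h)
      exact cos_pi_mul_odd_lt (by omega) ⟨2 * (l : ℕ) - 2 * n - 1, by omega⟩ (by omega) (by omega)
        (by omega) (by omega) (by omega) (by omega)

end GroundSpace

/-! ### The two parameter regions -/

section Regions

variable {N : ℕ} [NeZero N] {φ : ℝ}

theorem dispersion_zero_lt (hφ : φ ∈ Set.Ioo (-(Real.pi / 4)) 0) {q : ℝ} (h0 : 0 < q)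
    (h1 : q < 2 * Real.pi) (h2 : q ≠ Real.pi) : dispersion φ 0 < dispersion φ q := by
  have hp := Real.pi_pos
  have hφ' : φ ∈ Set.Ioo (-(Real.pi / 4)) (Real.pi / 4) := ⟨hφ.1, by linarith [hφ.2]⟩
  have hs : Real.sin (2 * φ) < 0 :=
    Real.sin_neg_of_neg_of_neg_pi_lt (by linarith [hφ.2]) (by linarith [hφ.1])
  rw [dispersion_eq hφ' hp.ne, dispersion_eq hφ' h2]
  have := norm_symbol_lt (φ := φ) (q := 0) (q' := q) (by
    rw [mul_zero, Real.cos_zero]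
    exact mul_lt_mul_of_neg_left (cos_two_mul_lt_one h0 h1 h2) hs)
  linarith

theorem minimizers_gammaMinus_neg (hN : Odd N) (hφ : φ ∈ Set.Ioo (-(Real.pi / 4)) 0) :
    {q ∈ GammaMinus N | IsMinOn (dispersion φ) (GammaMinus N) q} = {0} := by
  rw [gammaMinus_eq]
  refine setOf_isMinOn_eq (m := dispersion φ 0) ?_ (Set.singleton_nonempty 0) ?_ ?_
  · rw [Set.singleton_subset_iff]
    exact ⟨0, modeMom_zero_zero⟩
  · rintro q rfl
    rfl
  · rintro _ ⟨k, rfl⟩ hk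
    exact dispersion_zero_lt hφ (lt_of_le_of_ne (modeMom_nonneg le_rfl k) (Ne.symm hk))
      (modeMom_lt one_pos k) (modeMom_ne_pi hN k)

theorem minimizers_gammaPlus_neg (hN : Odd N) (hφ : φ ∈ Set.Ioo (-(Real.pi / 4)) 0) :
    {q ∈ GammaPlus N | IsMinOn (fun k => |dispersion φ k|) (GammaPlus N) q} = {Real.pi} := by
  have hφ' : φ ∈ Set.Ioo (-(Real.pi / 4)) (Real.pi / 4) :=
    ⟨hφ.1, by linarith [hφ.2, Real.pi_pos]⟩
  rw [gammaPlus_eq]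
  refine setOf_isMinOn_eq (m := dispersion φ 0) ?_ (Set.singleton_nonempty _) ?_ ?_
  · rw [Set.singleton_subset_iff]
    exact exists_modeMom_eq_pi hN
  · rintro q rfl
    rw [abs_dispersion hφ', dispersion_eq hφ' Real.pi_ne_zero.symm,
      norm_symbol_congr (q := Real.pi) (q' := 0) (by simp)]
  · rintro _ ⟨k, rfl⟩ hk
    have hpos : 0 < modeMom (1 / 2) k := by
      have := Real.pi_pos
      have : (0 : ℝ) < N := by exact_mod_cast NeZero.pos N
      unfold modeMom
      positivity
    exact (dispersion_zero_lt hφ hpos (modeMom_lt (by norm_num) k) hk).trans_le (le_abs_self _)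

theorem image_setOf_dispersion_eq_zero (hN : Odd N) (hφ : φ ∈ Set.Ioo (-(Real.pi / 4)) 0) :
    {k : Fin N | dispersion φ (modeMom 0 k) = dispersion φ 0} = {0} := by
  ext k
  constructor
  · intro hk
    by_contra h
    exact (dispersion_zero_lt hφ (modeMom_pos_label k h) (modeMom_lt one_pos k)
      (modeMom_ne_pi hN k)).ne' hk
  · rintro rfl
    change dispersion φ (modeMom 0 0) = dispersion φ 0
    rw [modeMom_zero_zero]

theorem ground_region_neg (hN : Odd N) (hφ : φ ∈ Set.Ioo (-(Real.pi / 4)) 0) :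
    IsGroundSpace (hamiltonian N φ)
        (Submodule.span ℂ {oneParticle N φ 0, parityX N *ᵥ oneParticle N φ 0}) ∧
      Module.finrank ℂ
        (Submodule.span ℂ {oneParticle N φ 0, parityX N *ᵥ oneParticle N φ 0}) = 2 := by
  have hφ' : φ ∈ Set.Ioo (-(Real.pi / 4)) (Real.pi / 4) :=
    ⟨hφ.1, by linarith [hφ.2, Real.pi_pos]⟩
  have he : 0 < dispersion φ 0 := by
    have := (cos_add_sin_pos hφ').1
    rw [dispersion, if_pos rfl]
    linarith
  constructor
  · have h := isGroundSpace_span (N := N) hN hφ' he (fun k => ?_) ⟨0, by rw [modeMom_zero_zero]⟩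
    · rwa [image_setOf_dispersion_eq_zero hN hφ, Set.image_singleton, Set.image_singleton,
        modeMom_zero_zero, Set.singleton_union] at h
    · by_cases hk : k = 0
      · rw [hk, modeMom_zero_zero]
      · exact (dispersion_zero_lt hφ (modeMom_pos_label k hk) (modeMom_lt one_pos k)
          (modeMom_ne_pi hN k)).le
  · have h1 := oneParticle_dotProduct φ (0 : Fin N) 0
    rw [modeMom_zero_zero, if_pos rfl] at h1
    have h2 := oneParticle_even_dotProduct_odd (φ := φ) hN 0 0
    have h := finrank_span_range_of_orthonormal
      (f := ![oneParticle N φ 0, parityX N *ᵥ oneParticle N φ 0]) (fun i j => by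
        fin_cases i <;> fin_cases j <;> simp [h1, h2.1, h2.2, parityX_dotProduct])
    rwa [Matrix.range_cons, Matrix.range_cons, Matrix.range_empty, Set.union_empty,
      Set.singleton_union] at h

theorem dispersion_groundMomentum_lt (hφ : φ ∈ Set.Ioo 0 (Real.pi / 4)) {p q : ℝ}
    (h : Real.cos (2 * p) < Real.cos (2 * q)) : |dispersion φ p| < |dispersion φ q| := by
  have hφ' : φ ∈ Set.Ioo (-(Real.pi / 4)) (Real.pi / 4) :=
    ⟨by linarith [hφ.1, Real.pi_pos], hφ.2⟩
  have hs : 0 < Real.sin (2 * φ) :=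
    Real.sin_pos_of_pos_of_lt_pi (by linarith [hφ.1]) (by linarith [hφ.2, Real.pi_pos])
  rw [abs_dispersion hφ', abs_dispersion hφ']
  have := norm_symbol_lt (φ := φ) (mul_lt_mul_of_pos_left h hs)
  linarith

theorem abs_dispersion_congr (hφ : φ ∈ Set.Ioo (-(Real.pi / 4)) (Real.pi / 4)) {p q : ℝ}
    (h : Real.cos (2 * p) = Real.cos (2 * q)) : |dispersion φ p| = |dispersion φ q| := by
  rw [abs_dispersion hφ, abs_dispersion hφ, norm_symbol_congr h]

theorem cos_two_mul_two_pi_sub (q : ℝ) :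
    Real.cos (2 * (2 * Real.pi - q)) = Real.cos (2 * q) := by
  rw [show 2 * (2 * Real.pi - q) = -(2 * q) + (2 : ℤ) * (2 * Real.pi) by push_cast; ring,
    Real.cos_add_int_mul_two_pi, Real.cos_neg]

theorem dispersion_nonneg (hφ : φ ∈ Set.Ioo (-(Real.pi / 4)) (Real.pi / 4)) {q : ℝ}
    (hq : q ≠ Real.pi) : |dispersion φ q| = dispersion φ q := by
  rw [abs_dispersion hφ, dispersion_eq hφ hq]

/-- Stated for |ε| and an arbitrary pairing so that it serves both Γ⁻ and Γ⁺. -/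
theorem minimizers_of_pairing {s : ℝ} {τ : Fin N → Fin N} (hτ : IsPairing s τ) (h0 : 0 ≤ s)
    (h1 : s < 1) (hφ : φ ∈ Set.Ioo 0 (Real.pi / 4)) {k : Fin N} (hk : 0 < modeMom s k)
    (hmin : ∀ l : Fin N, l ≠ k → l ≠ τ k →
      Real.cos (2 * modeMom s k) < Real.cos (2 * modeMom s l)) :
    {q ∈ Set.range (modeMom s : Fin N → ℝ) |
        IsMinOn (fun q => |dispersion φ q|) (Set.range (modeMom s : Fin N → ℝ)) q}
      = {modeMom s k, 2 * Real.pi - modeMom s k} := by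
  have hφ' : φ ∈ Set.Ioo (-(Real.pi / 4)) (Real.pi / 4) :=
    ⟨by linarith [hφ.1, Real.pi_pos], hφ.2⟩
  have hpair : modeMom s (τ k) = 2 * Real.pi - modeMom s k := by
    rcases hτ.cases h0 h1 k with h | h
    · exact absurd h.1 hk.ne'
    · exact h.2
  refine setOf_isMinOn_eq (m := |dispersion φ (modeMom s k)|) ?_ (Set.insert_nonempty _ _) ?_ ?_
  · rintro q (rfl | rfl)
    · exact ⟨k, rfl⟩
    · exact ⟨τ k, hpair⟩
  · rintro q (rfl | rfl)
    · rfl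
    · exact abs_dispersion_congr hφ' (cos_two_mul_two_pi_sub _)
  · rintro _ ⟨l, rfl⟩ hl
    refine dispersion_groundMomentum_lt hφ (hmin l ?_ ?_)
    · rintro rfl
      exact hl (Or.inl rfl)
    · rintro rfl
      exact hl (Or.inr hpair)

theorem ground_region_pos (hN : Odd N) (hφ : φ ∈ Set.Ioo 0 (Real.pi / 4)) {k : Fin N}
    (hk0 : 0 < modeMom 0 k) (hkpi : modeMom 0 k < Real.pi)
    (hmin : ∀ l : Fin N, l ≠ k → l ≠ -k →
      Real.cos (2 * modeMom 0 k) < Real.cos (2 * modeMom 0 l)) :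
    IsGroundSpace (hamiltonian N φ)
        (Submodule.span ℂ {oneParticle N φ (modeMom 0 k), oneParticle N φ (-modeMom 0 k),
          parityX N *ᵥ oneParticle N φ (modeMom 0 k),
          parityX N *ᵥ oneParticle N φ (-modeMom 0 k)}) ∧
      Module.finrank ℂ
        (Submodule.span ℂ {oneParticle N φ (modeMom 0 k), oneParticle N φ (-modeMom 0 k),
          parityX N *ᵥ oneParticle N φ (modeMom 0 k),
          parityX N *ᵥ oneParticle N φ (-modeMom 0 k)}) = 4 := by
  have hφ' : φ ∈ Set.Ioo (-(Real.pi / 4)) (Real.pi / 4) :=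
    ⟨by linarith [hφ.1, Real.pi_pos], hφ.2⟩
  have hpair : modeMom 0 (-k) = 2 * Real.pi - modeMom 0 k := by
    rcases isPairing_neg.cases le_rfl one_pos k with h | h
    · exact absurd h.1 hk0.ne'
    · exact h.2
  have hkk : k ≠ -k := by
    intro h
    rw [← h] at hpair
    linarith
  -- Γ⁻ represents -q as 2π - q; the modes agree by periodicity, as neither value is 0 or π.
  have hone : oneParticle N φ (-modeMom 0 k) = oneParticle N φ (modeMom 0 (-k)) := by
    rw [oneParticle, oneParticle, bogA_congr (q := -modeMom 0 k) (q' := modeMom 0 (-k)) 1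
      (by rw [hpair]; push_cast; ring) (by linarith) (by linarith) (by linarith) (by linarith)]
  have hnn : ∀ l : Fin N, |dispersion φ (modeMom 0 l)| = dispersion φ (modeMom 0 l) := fun l =>
    dispersion_nonneg hφ' (modeMom_ne_pi hN l)
  have hlt : ∀ l : Fin N, l ≠ k → l ≠ -k →
      dispersion φ (modeMom 0 k) < dispersion φ (modeMom 0 l) := by
    intro l h1 h2
    rw [← hnn k, ← hnn l]
    exact dispersion_groundMomentum_lt hφ (hmin l h1 h2)
  have heq : dispersion φ (modeMom 0 (-k)) = dispersion φ (modeMom 0 k) := by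
    rw [← hnn k, ← hnn (-k), hpair]
    exact abs_dispersion_congr hφ' (cos_two_mul_two_pi_sub _)
  have hK : {l : Fin N | dispersion φ (modeMom 0 l) = dispersion φ (modeMom 0 k)} = {k, -k} := by
    ext l
    constructor
    · intro hl
      by_contra h
      rw [Set.mem_insert_iff, Set.mem_singleton_iff, not_or] at h
      exact (hlt l h.1 h.2).ne' hl
    · rintro (rfl | rfl)
      · rfl
      · exact heq
  -- The symbol has imaginary part (cos φ - sin φ) sin q after its phase e^{iq} is removed, and this
  -- is nonzero.
  have hpos : 0 < dispersion φ (modeMom 0 k) := by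
    rw [← hnn, abs_pos]
    intro h0
    have h1 := abs_dispersion hφ' (modeMom 0 k)
    rw [h0, abs_zero] at h1
    have h2 := norm_sq_symbol' φ (modeMom 0 k)
    have h3 : ((Real.cos φ - Real.sin φ) * Real.sin (modeMom 0 k)) ≠ 0 :=
      mul_ne_zero (cos_add_sin_pos hφ').2.ne' (Real.sin_pos_of_pos_of_lt_pi hk0 hkpi).ne'
    have h4 := pow_pos (abs_pos.mpr h3) 2
    rw [sq_abs] at h4
    rw [show ‖(Real.sin φ : ℂ) + (Real.cos φ : ℂ) *
      Complex.exp (Complex.I * 2 * (modeMom 0 k : ℂ))‖ = 0 by linarith] at h2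
    nlinarith [sq_nonneg ((Real.sin φ + Real.cos φ) * Real.cos (modeMom 0 k))]
  rw [hone]
  constructor
  · have h := isGroundSpace_span (N := N) hN hφ' hpos (fun l => ?_) ⟨k, rfl⟩
    · rw [hK, Set.image_pair, Set.image_pair] at h
      rwa [show ({oneParticle N φ (modeMom 0 k), oneParticle N φ (modeMom 0 (-k)),
          parityX N *ᵥ oneParticle N φ (modeMom 0 k),
          parityX N *ᵥ oneParticle N φ (modeMom 0 (-k))} : Set (State N))
        = {oneParticle N φ (modeMom 0 k), oneParticle N φ (modeMom 0 (-k))}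
          ∪ {parityX N *ᵥ oneParticle N φ (modeMom 0 k),
            parityX N *ᵥ oneParticle N φ (modeMom 0 (-k))} by
        rw [Set.insert_union, Set.singleton_union]]
    · by_cases h1 : l = k
      · rw [h1]
      · by_cases h2 : l = -k
        · rw [h2, heq]
        · exact (hlt l h1 h2).le
  · have h1 := oneParticle_dotProduct φ k k
    have h2 := oneParticle_dotProduct φ (-k) (-k)
    have h3 := oneParticle_dotProduct φ k (-k)
    have h4 := oneParticle_dotProduct φ (-k) k
    rw [if_pos rfl] at h1 h2
    rw [if_neg hkk] at h3
    rw [if_neg hkk.symm] at h4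
    have h5 := fun q q' => (oneParticle_even_dotProduct_odd (φ := φ) hN q q').1
    have h6 := fun q q' => (oneParticle_even_dotProduct_odd (φ := φ) hN q q').2
    have h := finrank_span_range_of_orthonormal
      (f := ![oneParticle N φ (modeMom 0 k), oneParticle N φ (modeMom 0 (-k)),
          parityX N *ᵥ oneParticle N φ (modeMom 0 k),
          parityX N *ᵥ oneParticle N φ (modeMom 0 (-k))]) (fun i j => by
        fin_cases i <;> fin_cases j <;> simp [h1, h2, h3, h4, h5, h6, parityX_dotProduct])
    rwa [Matrix.range_cons, Matrix.range_cons, Matrix.range_cons, Matrix.range_cons,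
      Matrix.range_empty, Set.union_empty, Set.singleton_union, Set.singleton_union,
      Set.singleton_union] at h

end Regions

end XYChain

end

/-! ### Assembly of the theorem -/

open XYChain
theorem mainTheorem2 (N : ℕ) [NeZero N] (hN : Odd N) (φ : ℝ) :
    -- the region `φ ∈ (-π/4, 0)`
    (φ ∈ Set.Ioo (-(Real.pi / 4)) 0 →
      {q ∈ GammaMinus N | IsMinOn (dispersion φ) (GammaMinus N) q} = {0} ∧
      {q ∈ GammaPlus N | IsMinOn (fun k => |dispersion φ k|) (GammaPlus N) q} = {Real.pi} ∧
      IsGroundSpace (hamiltonian N φ)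
        (Submodule.span ℂ {oneParticle N φ 0, parityX N *ᵥ oneParticle N φ 0}) ∧
      Module.finrank ℂ
        (Submodule.span ℂ {oneParticle N φ 0, parityX N *ᵥ oneParticle N φ 0}) = 2 ∧
      parityZ N *ᵥ oneParticle N φ 0 = -oneParticle N φ 0 ∧
      parityZ N *ᵥ (parityX N *ᵥ oneParticle N φ 0) = parityX N *ᵥ oneParticle N φ 0 ∧
      ∃ z : ℂ, ‖z‖ = 1 ∧ parityX N *ᵥ oneParticle N φ 0 = z • vacPlus N φ) ∧
    -- the region `φ ∈ (0, π/4)`, with `p' = π - p`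
    (3 ≤ N → φ ∈ Set.Ioo 0 (Real.pi / 4) →
      ∀ p p' : ℝ, p = groundMomentum N → p' = Real.pi - p →
      {q ∈ GammaMinus N | IsMinOn (dispersion φ) (GammaMinus N) q} = {p, 2 * Real.pi - p} ∧
      {q ∈ GammaPlus N | IsMinOn (fun k => |dispersion φ k|) (GammaPlus N) q}
        = {p', 2 * Real.pi - p'} ∧
      IsGroundSpace (hamiltonian N φ)
        (Submodule.span ℂ {oneParticle N φ p, oneParticle N φ (-p),
          parityX N *ᵥ oneParticle N φ p, parityX N *ᵥ oneParticle N φ (-p)}) ∧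
      Module.finrank ℂ
        (Submodule.span ℂ {oneParticle N φ p, oneParticle N φ (-p),
          parityX N *ᵥ oneParticle N φ p, parityX N *ᵥ oneParticle N φ (-p)}) = 4 ∧
      (∀ k ∈ ({p, -p} : Set ℝ),
        parityZ N *ᵥ oneParticle N φ k = -oneParticle N φ k ∧
        parityZ N *ᵥ (parityX N *ᵥ oneParticle N φ k) = parityX N *ᵥ oneParticle N φ k) ∧
      (∃ z : ℂ, ‖z‖ = 1 ∧ parityX N *ᵥ oneParticle N φ (-p) = z • twoParticle N φ p') ∧
      (∃ z : ℂ, ‖z‖ = 1 ∧ parityX N *ᵥ oneParticle N φ p = z • twoParticle N φ (-p'))) := by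
  constructor
  · intro hφ
    have hφ' : φ ∈ Set.Ioo (-(Real.pi / 4)) (Real.pi / 4) :=
      ⟨hφ.1, by linarith [hφ.2, Real.pi_pos]⟩
    have hodd := parityZ_mulVec_oneParticle (N := N) φ 0
    refine ⟨minimizers_gammaMinus_neg hN hφ, minimizers_gammaPlus_neg hN hφ,
      (ground_region_neg hN hφ).1, (ground_region_neg hN hφ).2, hodd,
      parityZ_mulVec_parityX hN hodd, ?_⟩
    rw [vacPlus_eq]
    exact exists_phase_symm (exists_parityX_mulVec_vacuum hN hφ')
  · rintro hN3 hφ p p' hp hp'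
    have hφ' : φ ∈ Set.Ioo (-(Real.pi / 4)) (Real.pi / 4) :=
      ⟨by linarith [hφ.1, Real.pi_pos], hφ.2⟩
    obtain ⟨hpos, hlt, hcos, ⟨k, hk, hkmin⟩, k', hk', hkmin'⟩ := groundMomentum_spec hN hN3
    rw [← hp] at hpos hlt hcos hk hk'
    rw [← hp'] at hk'
    have hcos' : Real.cos (2 * p') = Real.cos (2 * p) := by
      rw [hp', mul_sub, Real.cos_two_pi_sub]
    rw [← hcos, ← hk] at hkmin
    rw [← hcos, ← hcos', ← hk'] at hkmin'
    have hground := ground_region_pos hN hφ (by rwa [hk]) (by rwa [hk]) hkmin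
    rw [hk] at hground
    refine ⟨?_, ?_, hground.1, hground.2, fun q _ => ?_, ?_, ?_⟩
    · have h := minimizers_of_pairing isPairing_neg le_rfl one_pos hφ (by rwa [hk]) hkmin
      rw [hk] at h
      rw [gammaMinus_eq, ← h]
      -- On Γ⁻ the absolute value can be dropped, since π is absent and ε is nonnegative elsewhere.
      ext q
      refine and_congr_right fun hq => ?_
      simp only [isMinOn_iff, Set.forall_mem_range]
      obtain ⟨l, rfl⟩ := hq
      simp only [dispersion_nonneg hφ' (modeMom_ne_pi hN _)]
    · have h := minimizers_of_pairing isPairing_rev (by norm_num) (by norm_num) hφ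
        (by rw [hk']; linarith) hkmin'
      rw [hk'] at h
      rw [gammaPlus_eq, ← h]
    · have hodd := parityZ_mulVec_oneParticle (N := N) φ q
      exact ⟨hodd, parityZ_mulVec_parityX hN hodd⟩
    -- Conjugation takes a_{p'} to -i a_{p'-π}, and p' - π = -p.
    · refine exists_phase_symm (exists_parityX_mulVec_twoParticle hN hφ' (c := -Complex.I)
        (by simp) ?_)
      rw [parityX_conj_bogA hφ' (by linarith) (by linarith), hp', sub_sub_cancel_left]
    · refine exists_phase_symm (exists_parityX_mulVec_twoParticle hN hφ' (c := Complex.I)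
        (by simp) ?_)
      rw [parityX_conj_bogA_neg hφ' (by linarith) (by linarith), hp', neg_sub, sub_add_cancel]
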